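/- Let $K=\{p_1,\dots,p_N\}\subset\mathbb{R}^d$ ($N\ge 1$) be a finite set. For $x\in\mathbb{R}^d$ put $\operatorname{opt}(x)=\{y\in K: |x-y|=\operatorname{dist}(x,K)\}$ (the optimality class of $x$), let $\eta(x)$ be the projection of $x$ on the convex hull of $\operatorname{opt}(x)$, let $f_K(x)=-\tfrac12\operatorname{dist}(x,K)^2$, and let $\nabla f_K(x)$ be the extended gradient of $f_K$ at $x$, i.e. the element of minimal norm of the Gateaux subdifferential $\partial f_K(x)=\{\xi:\liminf_{t\to0^+}\frac{f_K(x+tv)-f_K(x)}{t}\ge \xi\cdot v\ \ \forall v\in\mathbb{R}^d\}$. For $H\subseteq K$ let $V_H=\{x:\operatorname{opt}(x)=H\}$ be the Voronoi cell of $H$; for $e\in\mathbb{R}^d$ let $Q_e=\{x:\eta(x)=e\}$ be the potential zone of $e$. Assume that $K$ is balanced, i.e. the partition of $\mathbb{R}^d$ into nonempty Voronoi cells coincides with its partition into nonempty potential zones. Let $h:[0,+\infty)\to[0,+\infty)$ be $C^\infty$ (up to $0$) and strictly increasing, let $\delta>0$, $x_0,x_\delta\in\mathbb{R}^d$, and let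 $I:C([0,\delta],\mathbb{R}^d)\to[0,+\infty]$ be the functional $$I(\gamma)=\int_0^\delta |\dot\gamma|^2+h\big(|\nabla f_K(\gamma)|^2\big)\,dt$$ if $\gamma$ is absolutely continuous with $\gamma(0)=x_0$ and $\gamma(\delta)=x_\delta$, and $I(\gamma)=+\infty$ otherwise. Let $\gamma$ be a local minimizer of $I$ for the uniform topology, with $I(\gamma)<+\infty$. A time $t\in[0,\delta]$ is a shock time of $\gamma$ if $\operatorname{opt}(\gamma)$ is not constant on any neighborhood of $t$ in $[0,\delta]$; let $S(\gamma)$ be the set of shock times. Then: (i) $S(\gamma)$ is finite, say $S(\gamma)=\{t_1<\dots<t_\ell\}$ with $0\le t_1$, $t_\ell\le\delta$ and $\ell\ge0$, and $\operatorname{opt}(\gamma)$ is constant in each connected component of $[0,\delta]\setminus\{t_1,\dots,t_\ell\}$. (ii) Setting $t_0=0$ and $t_{\ell+1}=\delta$, the curve $\gamma$ is $C^\infty$ in the closed interval $[t_i,t_{i+1}]$ for every $i\in\{0,\dots,\ell\}$. Moreover, if $t_i<t_{i+1}$, let $H_i$ be the constant value of $\operatorname{opt}(\gamma)$ in $(t_i,t_{i+1})$,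 let $\eta_{H_i}$ be the constant value of $\eta$ on $V_{H_i}$, and let $p_{H_i}$ be the unique point of intersection of the affine span of $H_i$ with $\{x: |x-p|=|x-q|\ \ \forall p,q\in H_i\}$. Then $$\ddot\gamma=h'\big(|\gamma-\eta_{H_i}|^2\big)(\gamma-p_{H_i})\quad\text{in }(t_i,t_{i+1}).$$ -/

import Mathlib

open Set Filter Topology MeasureTheory
open scoped ENNReal ContDiff

noncomputable section

/-- The Gateaux subdifferential of `f` at `x`: all `ξ` such that
`⟪ξ, v⟫ ≤ liminf_{t → 0⁺} (f (x + t v) - f x) / t` for every direction `v`.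
The lower limit is taken in the extended reals. -/
def gateauxSubdifferential {E : Type*} [NormedAddCommGroup E] [InnerProductSpace ℝ E]
    (f : E → ℝ) (x : E) : Set E :=
  {ξ | ∀ v : E, ((inner ℝ ξ v : ℝ) : EReal) ≤
    liminf (fun t : ℝ => (((f (x + t • v) - f x) / t : ℝ) : EReal)) (𝓝[>] (0 : ℝ))}

/-- A point of `C` at minimal distance from `x`; it is the metric projection of `x` on `C` when
`C` is nonempty, closed and convex. -/
def nearestPoint {E : Type*} [NormedAddCommGroup E] (C : Set E) (x : E) : E :=
  Classical.epsilon fun y => y ∈ C ∧ ∀ z ∈ C, ‖x - y‖ ≤ ‖x - z‖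

/-- The extended gradient of `f` at `x`: the element of minimal norm (the projection of `0`) of
the subdifferential of `f` at `x`. -/
def extendedGradient {E : Type*} [NormedAddCommGroup E] [InnerProductSpace ℝ E]
    (f : E → ℝ) (x : E) : E :=
  nearestPoint (gateauxSubdifferential f x) 0

/-- The opposite squared distance function `f_K (x) = - dist(x, K)² / 2`. -/
def oppSqDist {E : Type*} [NormedAddCommGroup E] (K : Set E) (x : E) : ℝ :=
  -(Metric.infDist x K) ^ 2 / 2

/-- The optimality class of `x`: the points of `K` that minimize the distance from `x`. -/
def optClass {E : Type*} [NormedAddCommGroup E] (K : Set E) (x : E) : Set E :=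
  {y | y ∈ K ∧ Metric.infDist x K = dist x y}

/-- The projection `η_K (x)` of `x` on the convex hull of its optimality class. -/
def etaMap {E : Type*} [NormedAddCommGroup E] [InnerProductSpace ℝ E] (K : Set E) (x : E) : E :=
  nearestPoint (convexHull ℝ (optClass K x)) x

/-- The Voronoi cell `V_H` of the points whose optimality class is `H`. -/
def voronoiCell {E : Type*} [NormedAddCommGroup E] (K H : Set E) : Set E :=
  {x | optClass K x = H}

/-- The potential zone `Q_e` of the points `x` with `η_K (x) = e`. -/
def potentialZone {E : Type*} [NormedAddCommGroup E] [InnerProductSpace ℝ E]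
    (K : Set E) (e : E) : Set E :=
  {x | etaMap K x = e}

/-- `K` is balanced if the partition into (nonempty) Voronoi cells and the partition into
(nonempty) potential zones coincide. -/
def IsBalanced {E : Type*} [NormedAddCommGroup E] [InnerProductSpace ℝ E] (K : Set E) : Prop :=
  {V : Set E | V.Nonempty ∧ ∃ H ⊆ K, V = voronoiCell K H} =
    {Q : Set E | Q.Nonempty ∧ ∃ e : E, Q = potentialZone K e}

/-- The space `B_H` of the points that are equidistant from all the points of `H`. -/
def equidistantSpace {E : Type*} [NormedAddCommGroup E] (H : Set E) : Set E :=
  {x | ∀ p ∈ H, ∀ q ∈ H, ‖x - p‖ = ‖x - q‖}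

open Classical in
/-- The action `∫₀^δ |γ'|² + h (|∇ f_K|² (γ))` with endpoint constraints, on `C([0, δ], E)`; it is
`+∞` on the curves that are not absolutely continuous or do not join `x₀` to `x₁`.
`IccExtend` extends a curve from `[0, δ]` to `ℝ` by constants. -/
def action {E : Type*} [NormedAddCommGroup E] [InnerProductSpace ℝ E] (K : Set E) (h : ℝ → ℝ)
    {δ : ℝ} (hδ : 0 < δ) (x₀ x₁ : E) (γ : C(Icc (0 : ℝ) δ, E)) : ℝ≥0∞ :=
  if AbsolutelyContinuousOnInterval (IccExtend hδ.le γ) 0 δ ∧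
      γ ⟨0, left_mem_Icc.2 hδ.le⟩ = x₀ ∧ γ ⟨δ, right_mem_Icc.2 hδ.le⟩ = x₁ then
    ∫⁻ t in Icc (0 : ℝ) δ, ENNReal.ofReal (‖deriv (IccExtend hδ.le γ) t‖ ^ 2 +
      h (‖extendedGradient (oppSqDist K) (IccExtend hδ.le γ t)‖ ^ 2))
  else ⊤

/-- Local minimizers of the action, with finite action, for the uniform topology of
`C([0, δ], E)`. -/
def IsLocalMinimizer {E : Type*} [NormedAddCommGroup E] [InnerProductSpace ℝ E] (K : Set E)
    (h : ℝ → ℝ) {δ : ℝ} (hδ : 0 < δ) (x₀ x₁ : E) (γ : C(Icc (0 : ℝ) δ, E)) : Prop :=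
  action K h hδ x₀ x₁ γ < ⊤ ∧ IsLocalMin (action K h hδ x₀ x₁) γ

/-- The set `S(γ)` of shock times: those `t ∈ [0, δ]` such that the optimality class of `γ` is not
constant on any neighborhood of `t` in `[0, δ]`. -/
def shockTimes {E : Type*} [NormedAddCommGroup E] (K : Set E) {δ : ℝ}
    (γ : C(Icc (0 : ℝ) δ, E)) : Set (Icc (0 : ℝ) δ) :=
  {t | ∀ I ∈ 𝓝 t, ¬ ∀ s ∈ I, ∀ r ∈ I, optClass K (γ s) = optClass K (γ r)}

end

/-!
Write `F (x) = h (|∇ f_K (x)|²)` for the potential. The subdifferential of `f_K` at `x` is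
`conv (opt x) - x` (`mem_gateauxSubdifferential_iff`), so `F (x) = h (dist (x, conv (opt x))²)`:
on each Voronoi cell, `F` is the restriction of a smooth function. Near a point, optimality classes
can only shrink, and since `K` is balanced a strictly smaller class has a different projection `η`,
hence a strictly larger distance from the hull. As `h` is strictly increasing, `F` jumps up by at
least a fixed amount `j` when the class shrinks (`IsBalanced.exists_potential_jump`).

The heart of the proof is that the class of a minimizer `c` is locally constant right after any
given time, say the time `0` (`LocMin.exists_eventually_optClass_eq`); reversing time gives the same
right before it, so shock times are isolated.

* Slowing the curve down near `0` gives `∫₀^σ |c'|² ≤ C σ`, hence `|c σ - c 0| ≤ C σ`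
  (`LocMin.exists_norm_sub_le`).
* Near `c 0` the cells are cones with vertex `c 0`, so `F` is almost invariant under dilations
  (`almostConical_potential`). The comparison of `c` with the segment from `c 0` to `c σ` shows that
  `σ⁻¹ ∫₀^σ (|c'|² + F (c)) - |c σ - c 0|² / σ²` is almost monotone in `σ`, with a derivative
  bounded below by `|c' - (c - c 0) / σ|² / σ - C`. The rescaled position `(c t - c 0) / t`
  therefore has an oscillation on `[σ, 8 σ]` that tends to `0` with `σ`
  (`LocMin.exists_oscillation_le`); it need not converge.
* By compactness of the set of rescaled positions, on each `[σ, 8 σ]` the curve stays in a narrow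
  cone around some direction `w₀` in which all classes are contained in the class `H` met in the
  direction `w₀` (`exists_conical_nhds`), and its distance from the cell of `H` is small compared
  with `σ`. Projecting the curve on the affine space of the points that are equidistant from `H`
  lowers `F` by `j` as long as the class is not `H`, and decreases the kinetic energy up to the cost
  of two ramps at the endpoints. Hence the curve visits the cell of `H` in every subinterval of
  length `σ` (`LocMin.exists_optClass_eq`), and it does not leave the cell between two visits
  (`LocMin.optClass_eq_of_endpoints`), because then no ramps are needed.

Between two consecutive shocks the class is a constant `H`, the curve moves in a relatively open
part of an affine space with direction `(span H)ᗮ`, in the sense of differences of points of `H`,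
and `F (x) = h (|x - η_H|²)` there. The tangential part of `x - η_H` is `x - p_H`, so the argument
of du Bois-Reymond gives the weak form of `c'' = h' (|c - η_H|²) (c - p_H)`
(`LocMin.exists_sub_eq_integral`). The right-hand side is smooth and `c` is continuous up to the
endpoints, so `c` is smooth up to the endpoints (`contDiffOn_Icc_of_integral_eq`).
-/

set_option linter.unusedSectionVars false

noncomputable section

variable {E : Type*} [NormedAddCommGroup E] [InnerProductSpace ℝ E]

/-! ### Nearest points of convex sets -/

lemma nearest_iff_inner_nonpos {C : Set E} (hC : Convex ℝ C) {x y : E} (hy : y ∈ C) :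
    (∀ z ∈ C, ‖x - y‖ ≤ ‖x - z‖) ↔ ∀ z ∈ C, inner ℝ (x - y) (z - y) ≤ 0 := by
  rw [← norm_eq_iInf_iff_real_inner_le_zero hC hy]
  have : Nonempty C := ⟨⟨y, hy⟩⟩
  constructor
  · intro h
    refine le_antisymm (le_ciInf fun z => h z z.2) (ciInf_le (f := fun w : C => ‖x - w‖) ⟨0, ?_⟩ ⟨y, hy⟩)
    rintro _ ⟨z, rfl⟩
    exact norm_nonneg _
  · intro h z hz
    rw [h]
    refine ciInf_le (f := fun w : C => ‖x - w‖) ⟨0, ?_⟩ ⟨z, hz⟩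
    rintro _ ⟨z, rfl⟩
    exact norm_nonneg _

lemma nearest_unique {C : Set E} (hC : Convex ℝ C) {x y y' : E} (hy : y ∈ C) (hy' : y' ∈ C)
    (h : ∀ z ∈ C, ‖x - y‖ ≤ ‖x - z‖) (h' : ∀ z ∈ C, ‖x - y'‖ ≤ ‖x - z‖) : y = y' := by
  have h1 := (nearest_iff_inner_nonpos hC hy).1 h y' hy'
  have h2 := (nearest_iff_inner_nonpos hC hy').1 h' y hy
  have h3 : inner ℝ (y - y') (y - y') ≤ (0 : ℝ) := by
    have : inner ℝ (y - y') (y - y')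
        = inner ℝ (x - y) (y' - y) + (inner ℝ (x - y') (y - y') : ℝ) := by
      simp only [inner_sub_left, inner_sub_right]
      ring
    linarith
  rw [real_inner_self_nonpos, sub_eq_zero] at h3
  exact h3

lemma nearestPoint_spec {C : Set E} (hC : IsCompact C) (hne : C.Nonempty) (x : E) :
    nearestPoint C x ∈ C ∧ ∀ z ∈ C, ‖x - nearestPoint C x‖ ≤ ‖x - z‖ := by
  obtain ⟨y, hy, hyx⟩ := hC.exists_infDist_eq_dist hne x
  have : ∃ y, y ∈ C ∧ ∀ z ∈ C, ‖x - y‖ ≤ ‖x - z‖ := by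
    refine ⟨y, hy, fun z hz => ?_⟩
    rw [← dist_eq_norm, ← dist_eq_norm, ← hyx]
    exact Metric.infDist_le_dist_of_mem hz
  exact Classical.epsilon_spec this

lemma norm_sub_nearestPoint {C : Set E} (hC : IsCompact C) (hne : C.Nonempty) (x : E) :
    ‖x - nearestPoint C x‖ = Metric.infDist x C := by
  obtain ⟨h1, h2⟩ := nearestPoint_spec hC hne x
  refine le_antisymm ((Metric.le_infDist hne).2 fun z hz => ?_) ?_
  · rw [dist_eq_norm]; exact h2 z hz
  · rw [← dist_eq_norm]; exact Metric.infDist_le_dist_of_mem h1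

/-- A linear form that is constant on `H` is constant on the convex hull of `H`. -/
lemma inner_sub_eq_zero_of_mem_convexHull {H : Set E} {v : E}
    (hv : ∀ p ∈ H, ∀ q ∈ H, inner ℝ v (p - q) = (0 : ℝ)) {y z : E}
    (hy : y ∈ convexHull ℝ H) (hz : z ∈ convexHull ℝ H) : inner ℝ v (y - z) = (0 : ℝ) := by
  obtain ⟨q, hq⟩ : H.Nonempty := convexHull_nonempty_iff.1 ⟨y, hy⟩
  have key : convexHull ℝ H ⊆ {p | inner ℝ v p = (inner ℝ v q : ℝ)} := by
    refine convexHull_min (fun p hp => ?_) ?_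
    · have := hv p hp q hq
      rw [inner_sub_right] at this
      simp only [mem_ofPred_eq]
      linarith
    · intro a ha b hb s t _ _ hst
      simp only [mem_ofPred_eq] at *
      rw [inner_add_right, inner_smul_right, inner_smul_right, ha, hb, ← add_mul, hst, one_mul]
  have h1 := key hy
  have h2 := key hz
  simp only [mem_ofPred_eq] at h1 h2
  rw [inner_sub_right, h1, h2, sub_self]

/-- Moving the base point orthogonally to the differences of the points of `H` does not change its
projection on the convex hull of `H`. -/
lemma nearestPoint_convexHull_congr {H : Set E} (hH : H.Finite) (hne : H.Nonempty) {x x' : E}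
    (h : ∀ p ∈ H, ∀ q ∈ H, inner ℝ (x' - x) (p - q) = (0 : ℝ)) :
    nearestPoint (convexHull ℝ H) x' = nearestPoint (convexHull ℝ H) x := by
  have hc := hH.isCompact_convexHull ℝ
  have hn : (convexHull ℝ H).Nonempty := convexHull_nonempty_iff.2 hne
  obtain ⟨h1, h2⟩ := nearestPoint_spec hc hn x
  obtain ⟨h1', h2'⟩ := nearestPoint_spec hc hn x'
  refine nearest_unique (convex_convexHull ℝ H) h1' h1 h2' ?_
  rw [nearest_iff_inner_nonpos (convex_convexHull ℝ H) h1] at h2 ⊢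
  intro z hz
  have e : x' - nearestPoint (convexHull ℝ H) x
      = (x - nearestPoint (convexHull ℝ H) x) + (x' - x) := by abel
  rw [e, inner_add_left, inner_sub_eq_zero_of_mem_convexHull h hz h1, add_zero]
  exact h2 z hz

/-! ### Optimality classes -/

lemma mem_optClass_iff {K : Set E} {x y : E} :
    y ∈ optClass K x ↔ y ∈ K ∧ ∀ z ∈ K, ‖x - y‖ ≤ ‖x - z‖ := by
  constructor
  · rintro ⟨hy, h⟩
    refine ⟨hy, fun z hz => ?_⟩
    rw [← dist_eq_norm, ← dist_eq_norm, ← h]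
    exact Metric.infDist_le_dist_of_mem hz
  · rintro ⟨hy, h⟩
    refine ⟨hy, le_antisymm (Metric.infDist_le_dist_of_mem hy) ?_⟩
    refine (Metric.le_infDist ⟨y, hy⟩).2 fun z hz => ?_
    rw [dist_eq_norm, dist_eq_norm]
    exact h z hz

lemma optClass_subset (K : Set E) (x : E) : optClass K x ⊆ K := fun _ h => h.1

lemma optClass_nonempty {K : Set E} (hK : K.Finite) (hne : K.Nonempty) (x : E) :
    (optClass K x).Nonempty := by
  obtain ⟨y, hy, h⟩ := hK.isCompact.exists_infDist_eq_dist hne x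
  exact ⟨y, hy, h⟩

lemma optClass_finite {K : Set E} (hK : K.Finite) (x : E) : (optClass K x).Finite :=
  hK.subset (optClass_subset K x)

lemma norm_sub_eq_of_mem_optClass {K : Set E} {x p q : E} (hp : p ∈ optClass K x)
    (hq : q ∈ optClass K x) : ‖x - p‖ = ‖x - q‖ := by
  rw [← dist_eq_norm, ← dist_eq_norm, ← hp.2, ← hq.2]

/-- Optimality classes can only shrink under small perturbations. -/
lemma eventually_optClass_subset {K : Set E} (hK : K.Finite) (x : E) :
    ∀ᶠ y in 𝓝 x, optClass K y ⊆ optClass K x := by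
  have : ∀ p ∈ K, ∀ᶠ y in 𝓝 x, p ∈ optClass K y → p ∈ optClass K x := by
    intro p hp
    by_cases hpx : p ∈ optClass K x
    · exact Eventually.of_forall fun _ _ => hpx
    · have hlt : Metric.infDist x K < dist x p :=
        lt_of_le_of_ne (Metric.infDist_le_dist_of_mem hp) fun h => hpx ⟨hp, h⟩
      have hc : Continuous fun y : E => Metric.infDist y K := Metric.continuous_infDist_pt K
      have hd : Continuous fun y : E => dist y p := continuous_id.dist continuous_const
      filter_upwards [(hc.tendsto x).eventually_lt (hd.tendsto x) hlt] with y hy h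
      exact absurd h.2 hy.ne
  filter_upwards [(eventually_all_finite hK).2 this] with y hy p hp
  exact hy p hp.1 hp

lemma norm_add_sub_le_iff {x v p q : E} (h : ‖x - p‖ = ‖x - q‖) :
    ‖x + v - p‖ ≤ ‖x + v - q‖ ↔ (inner ℝ v q : ℝ) ≤ inner ℝ v p := by
  have e : ∀ r : E, ‖x + v - r‖ ^ 2
      = ‖x - r‖ ^ 2 + 2 * (inner ℝ v x - inner ℝ v r) + ‖v‖ ^ 2 := by
    intro r
    have : x + v - r = (x - r) + v := by abel
    rw [this, norm_add_sq_real, inner_sub_left, real_inner_comm, real_inner_comm r v]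
  rw [← sq_le_sq₀ (norm_nonneg _) (norm_nonneg _), e, e, h]
  constructor <;> intro <;> linarith

/-- Near `x`, the optimality class of `x + v` is the face of the optimality class of `x` exposed by
the direction `v`. -/
lemma mem_optClass_add_iff {K : Set E} (hK : K.Finite) (hne : K.Nonempty) {x v : E}
    (hs : optClass K (x + v) ⊆ optClass K x) {p : E} :
    p ∈ optClass K (x + v) ↔
      p ∈ optClass K x ∧ ∀ q ∈ optClass K x, (inner ℝ v q : ℝ) ≤ inner ℝ v p := by
  constructor
  · intro hp
    refine ⟨hs hp, fun q hq => ?_⟩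
    rw [← norm_add_sub_le_iff (norm_sub_eq_of_mem_optClass (hs hp) hq)]
    exact (mem_optClass_iff.1 hp).2 q hq.1
  · rintro ⟨hp, h⟩
    obtain ⟨q, hq⟩ := optClass_nonempty hK hne (x + v)
    refine mem_optClass_iff.2 ⟨hp.1, fun z hz => ?_⟩
    refine le_trans ?_ ((mem_optClass_iff.1 hq).2 z hz)
    rw [norm_add_sub_le_iff (norm_sub_eq_of_mem_optClass hp (hs hq))]
    exact h q (hs hq)

/-- Near `x`, the partition into Voronoi cells is invariant under dilations centered at `x`. -/
lemma optClass_add_smul {K : Set E} (hK : K.Finite) (hne : K.Nonempty) {x v : E} {s : ℝ}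
    (hs : 0 < s) (h : optClass K (x + v) ⊆ optClass K x)
    (h' : optClass K (x + s • v) ⊆ optClass K x) :
    optClass K (x + s • v) = optClass K (x + v) := by
  ext p
  rw [mem_optClass_add_iff hK hne h, mem_optClass_add_iff hK hne h']
  simp only [inner_smul_left, RCLike.conj_to_real, mul_le_mul_iff_right₀ hs]

/-- If `x` and `x + v` are both equidistant from the points of `H`, then `v` is orthogonal to the
differences of the points of `H`, and conversely. -/
lemma norm_add_sub_eq_iff {x v p q : E} (h : ‖x - p‖ = ‖x - q‖) :
    ‖x + v - p‖ = ‖x + v - q‖ ↔ (inner ℝ v (p - q) : ℝ) = 0 := by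
  rw [inner_sub_right, sub_eq_zero, le_antisymm_iff, norm_add_sub_le_iff h,
    norm_add_sub_le_iff h.symm, ← le_antisymm_iff, eq_comm]

lemma inner_sub_eq_zero_of_equidistant {x y p q : E} (hx : ‖x - p‖ = ‖x - q‖)
    (hy : ‖y - p‖ = ‖y - q‖) : (inner ℝ (y - x) (p - q) : ℝ) = 0 := by
  rw [← norm_add_sub_eq_iff hx]
  simpa using hy

/-- A point whose optimality class is contained in `H` and that is equidistant from the points of
`H ⊆ K` has optimality class `H`. -/
lemma optClass_eq_of_equidistant {K : Set E} (hK : K.Finite) (hne : K.Nonempty) {x : E} {H : Set E}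
    (hH : H ⊆ K) (h : optClass K x ⊆ H) (he : x ∈ equidistantSpace H) : optClass K x = H := by
  refine h.antisymm fun p hp => ?_
  obtain ⟨q, hq⟩ := optClass_nonempty hK hne x
  refine mem_optClass_iff.2 ⟨hH hp, fun z hz => ?_⟩
  rw [he p hp q (h hq)]
  exact (mem_optClass_iff.1 hq).2 z hz

/-! ### Balanced sets -/

lemma IsBalanced.optClass_eq {K : Set E} (hK : IsBalanced K) {x y : E}
    (h : etaMap K x = etaMap K y) : optClass K x = optClass K y := by
  have : potentialZone K (etaMap K x) ∈ {Q : Set E | Q.Nonempty ∧ ∃ e : E, Q = potentialZone K e} :=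
    ⟨⟨x, rfl⟩, _, rfl⟩
  rw [← hK] at this
  obtain ⟨-, H, -, hH⟩ := this
  have hx : x ∈ voronoiCell K H := hH ▸ (rfl : etaMap K x = etaMap K x)
  have hy : y ∈ voronoiCell K H := hH ▸ (h.symm : etaMap K y = etaMap K x)
  exact hx.trans hy.symm

lemma IsBalanced.etaMap_eq {K : Set E} (hK : IsBalanced K) {x y : E}
    (h : optClass K x = optClass K y) : etaMap K x = etaMap K y := by
  have : voronoiCell K (optClass K x) ∈ {V : Set E | V.Nonempty ∧ ∃ H ⊆ K, V = voronoiCell K H} :=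
    ⟨⟨x, rfl⟩, _, optClass_subset K x, rfl⟩
  rw [hK] at this
  obtain ⟨-, e, he⟩ := this
  have hx : x ∈ potentialZone K e := he ▸ (rfl : optClass K x = optClass K x)
  have hy : y ∈ potentialZone K e := he ▸ (h.symm : optClass K y = optClass K x)
  exact hx.trans hy.symm

/-- The projection of `x₀` on the convex hull of a class `optClass K x ⊆ optClass K x₀`. -/
lemma nearestPoint_eq_etaMap {K : Set E} (hK : K.Finite) (hne : K.Nonempty) {x₀ x : E}
    (h : optClass K x ⊆ optClass K x₀) :
    nearestPoint (convexHull ℝ (optClass K x)) x₀ = etaMap K x := by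
  refine nearestPoint_convexHull_congr (optClass_finite hK x) (optClass_nonempty hK hne x) ?_
  intro p hp q hq
  exact inner_sub_eq_zero_of_equidistant (norm_sub_eq_of_mem_optClass hp hq)
    (norm_sub_eq_of_mem_optClass (h hp) (h hq))

/-- In a balanced set, the distance to the convex hull of the optimality class jumps strictly up
when passing to a smaller class. -/
lemma IsBalanced.infDist_lt {K : Set E} (hK : K.Finite) (hne : K.Nonempty) (hb : IsBalanced K)
    {x₀ x y : E} (hxy : optClass K x ⊂ optClass K y) (hy : optClass K y ⊆ optClass K x₀) :
    Metric.infDist x₀ (convexHull ℝ (optClass K y))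
      < Metric.infDist x₀ (convexHull ℝ (optClass K x)) := by
  have cx := (optClass_finite hK x).isCompact_convexHull ℝ
  have cy := (optClass_finite hK y).isCompact_convexHull ℝ
  have nx : (convexHull ℝ (optClass K x)).Nonempty :=
    convexHull_nonempty_iff.2 (optClass_nonempty hK hne x)
  have ny : (convexHull ℝ (optClass K y)).Nonempty :=
    convexHull_nonempty_iff.2 (optClass_nonempty hK hne y)
  have hsub := convexHull_mono (𝕜 := ℝ) hxy.1
  obtain ⟨ax, bx⟩ := nearestPoint_spec cx nx x₀
  obtain ⟨ay, by'⟩ := nearestPoint_spec cy ny x₀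
  refine lt_of_le_of_ne (Metric.infDist_le_infDist_of_subset hsub nx) fun heq => ?_
  rw [← norm_sub_nearestPoint cx nx, ← norm_sub_nearestPoint cy ny] at heq
  have := nearest_unique (convex_convexHull ℝ (optClass K y)) ay (hsub ax) by'
    (fun z hz => heq ▸ by' z hz)
  rw [nearestPoint_eq_etaMap hK hne hy, nearestPoint_eq_etaMap hK hne (hxy.1.trans hy)] at this
  exact hxy.ne (hb.optClass_eq this).symm

end

noncomputable section

variable {E : Type*} [NormedAddCommGroup E] [InnerProductSpace ℝ E]

/-! ### The extended gradient of the opposite squared distance -/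

lemma oppSqDist_of_mem {K : Set E} {x p : E} (hp : p ∈ optClass K x) :
    oppSqDist K x = -‖x - p‖ ^ 2 / 2 := by
  rw [oppSqDist, hp.2, dist_eq_norm]

lemma eventually_add_smul {P : E → Prop} {x : E} (v : E) (h : ∀ᶠ y in 𝓝 x, P y) :
    ∀ᶠ t : ℝ in 𝓝[>] 0, P (x + t • v) := by
  have hc : Continuous fun t : ℝ => x + t • v := by fun_prop
  have := (hc.tendsto 0).mono_left (nhdsWithin_le_nhds (s := Ioi (0 : ℝ)))
  simp only [zero_smul, add_zero] at this
  exact this.eventually h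

/-- The directional derivative of `oppSqDist K` at `x` in the direction `v` is the largest value of
`⟪p - x, v⟫` over the optimality class of `x`. -/
lemma exists_tendsto_oppSqDist {K : Set E} (hK : K.Finite) (hne : K.Nonempty) (x v : E) :
    ∃ p ∈ optClass K x, (∀ q ∈ optClass K x, (inner ℝ v q : ℝ) ≤ inner ℝ v p) ∧
      Tendsto (fun t : ℝ => (oppSqDist K (x + t • v) - oppSqDist K x) / t) (𝓝[>] 0)
        (𝓝 (inner ℝ (p - x) v)) := by
  obtain ⟨p, hp, hmax⟩ := (optClass_finite hK x).exists_maximalFor (fun q => (inner ℝ v q : ℝ)) _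
    (optClass_nonempty hK hne x)
  have hmax' : ∀ q ∈ optClass K x, (inner ℝ v q : ℝ) ≤ inner ℝ v p := fun q hq => by
    rcases le_total (inner ℝ v p : ℝ) (inner ℝ v q) with h | h
    · exact hmax hq h
    · exact h
  refine ⟨p, hp, hmax', ?_⟩
  have hlim : Tendsto (fun t : ℝ => inner ℝ (p - x) v - t * ‖v‖ ^ 2 / 2) (𝓝[>] 0)
      (𝓝 (inner ℝ (p - x) v)) := by
    have hc : Continuous fun t : ℝ => inner ℝ (p - x) v - t * ‖v‖ ^ 2 / 2 := by fun_prop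
    have := (hc.tendsto 0).mono_left (nhdsWithin_le_nhds (s := Ioi (0 : ℝ)))
    simpa using this
  refine hlim.congr' ?_
  filter_upwards [eventually_add_smul v (eventually_optClass_subset hK x), self_mem_nhdsWithin]
    with t ht ht0
  have ht0' : (0 : ℝ) < t := ht0
  have hpt : p ∈ optClass K (x + t • v) := by
    rw [mem_optClass_add_iff hK hne ht]
    refine ⟨hp, fun q hq => ?_⟩
    simp only [inner_smul_left, RCLike.conj_to_real]
    exact mul_le_mul_of_nonneg_left (hmax' q hq) ht0'.le
  rw [oppSqDist_of_mem hp, oppSqDist_of_mem hpt]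
  have e : x + t • v - p = t • v - (p - x) := by abel
  have e2 : ‖x - p‖ = ‖p - x‖ := norm_sub_rev _ _
  rw [e, e2, norm_sub_sq_real, norm_smul, inner_smul_left, real_inner_comm]
  simp only [Real.norm_eq_abs, RCLike.conj_to_real, mul_pow, sq_abs]
  field_simp
  ring

/-- The subdifferential of `oppSqDist K` at `x` is the convex hull of the optimality class of `x`,
translated by `-x`; by Hahn-Banach separation a subgradient cannot lie outside of it. -/
lemma mem_gateauxSubdifferential_iff {K : Set E} (hK : K.Finite) (hne : K.Nonempty)
    [CompleteSpace E] {x ξ : E} :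
    ξ ∈ gateauxSubdifferential (oppSqDist K) x ↔ x + ξ ∈ convexHull ℝ (optClass K x) := by
  have key : ∀ v : E, ∃ p ∈ optClass K x, (∀ q ∈ optClass K x, (inner ℝ v q : ℝ) ≤ inner ℝ v p) ∧
      (((inner ℝ ξ v : ℝ) : EReal) ≤ liminf (fun t : ℝ =>
        (((oppSqDist K (x + t • v) - oppSqDist K x) / t : ℝ) : EReal)) (𝓝[>] (0 : ℝ)) ↔
        (inner ℝ v (x + ξ) : ℝ) ≤ inner ℝ v p) := by
    intro v
    obtain ⟨p, hp, hmax, hlim⟩ := exists_tendsto_oppSqDist hK hne x v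
    refine ⟨p, hp, hmax, ?_⟩
    have hl := ((continuous_coe_real_ereal.tendsto _).comp hlim).liminf_eq
    simp only [Function.comp_def] at hl
    rw [hl, EReal.coe_le_coe_iff,
      inner_sub_left, inner_add_right, real_inner_comm p v, real_inner_comm x v,
      real_inner_comm ξ v]
    constructor <;> intro <;> linarith
  constructor
  · intro h
    by_contra hcon
    obtain ⟨f, u, h1, h2⟩ := geometric_hahn_banach_closed_point (convex_convexHull ℝ (optClass K x))
      ((optClass_finite hK x).isCompact_convexHull ℝ).isClosed hcon
    obtain ⟨p, hp, -, hiff⟩ := key ((InnerProductSpace.toDual ℝ E).symm f)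
    have h3 := hiff.1 (h _)
    simp only [InnerProductSpace.toDual_symm_apply] at h3
    have := h1 p (subset_convexHull ℝ _ hp)
    linarith
  · intro h v
    obtain ⟨p, hp, hmax, hiff⟩ := key v
    rw [hiff]
    refine convexHull_min (s := optClass K x) (t := {y | (inner ℝ v y : ℝ) ≤ inner ℝ v p})
      (fun q hq => hmax q hq) ?_ h
    intro a ha b hb s t hs ht hst
    simp only [mem_ofPred_eq] at *
    rw [inner_add_right, inner_smul_right, inner_smul_right]
    calc s * (inner ℝ v a : ℝ) + t * inner ℝ v b ≤ s * inner ℝ v p + t * inner ℝ v p := by gcongr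
      _ = inner ℝ v p := by rw [← add_mul, hst, one_mul]

/-- The distance from `x` to the convex hull of its optimality class. -/
def hullDist (K : Set E) (x : E) : ℝ := Metric.infDist x (convexHull ℝ (optClass K x))

lemma norm_extendedGradient {K : Set E} (hK : K.Finite) (hne : K.Nonempty) [CompleteSpace E]
    (x : E) : ‖extendedGradient (oppSqDist K) x‖ = hullDist K x := by
  have hc := (optClass_finite hK x).isCompact_convexHull ℝ
  have hn := convexHull_nonempty_iff (𝕜 := ℝ).2 (optClass_nonempty hK hne x)
  have hset : gateauxSubdifferential (oppSqDist K) x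
      = (fun y => y - x) '' convexHull ℝ (optClass K x) := by
    ext ξ
    rw [mem_gateauxSubdifferential_iff hK hne]
    constructor
    · intro h; exact ⟨_, h, by simp⟩
    · rintro ⟨y, hy, rfl⟩; simpa using hy
  obtain ⟨h1, h2⟩ := nearestPoint_spec (hset ▸ hc.image (by fun_prop) :
    IsCompact (gateauxSubdifferential (oppSqDist K) x)) (hset ▸ hn.image _) 0
  simp only [zero_sub, norm_neg] at h2
  rw [extendedGradient, hullDist]
  refine le_antisymm ((Metric.le_infDist hn).2 fun z hz => ?_) ?_
  · rw [dist_comm, dist_eq_norm]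
    exact h2 _ (hset ▸ mem_image_of_mem _ hz)
  · rw [mem_gateauxSubdifferential_iff hK hne] at h1
    have := Metric.infDist_le_dist_of_mem (x := x) h1
    simpa [dist_eq_norm] using this

/-! ### The potential -/

/-- The potential energy `h (|∇ f_K|²)`, in terms of the distance to the convex hull of the
optimality class. -/
def potential (K : Set E) (h : ℝ → ℝ) (x : E) : ℝ := h (hullDist K x ^ 2)

lemma hullDist_nonneg (K : Set E) (x : E) : 0 ≤ hullDist K x := Metric.infDist_nonneg

lemma potential_nonneg {K : Set E} {h : ℝ → ℝ} (h0 : ∀ u ∈ Ici (0 : ℝ), 0 ≤ h u) (x : E) :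
    0 ≤ potential K h x := h0 _ (mem_Ici.2 (sq_nonneg _))

lemma lowerSemicontinuous_hullDist {K : Set E} (hK : K.Finite) (hne : K.Nonempty) :
    LowerSemicontinuous (hullDist K) := by
  intro x a ha
  have hc : Continuous fun y : E => Metric.infDist y (convexHull ℝ (optClass K x)) :=
    Metric.continuous_infDist_pt _
  filter_upwards [(hc.tendsto x).eventually_const_lt ha, eventually_optClass_subset hK x]
    with y hy hyx
  exact hy.trans_le (Metric.infDist_le_infDist_of_subset (convexHull_mono hyx)
    (convexHull_nonempty_iff.2 (optClass_nonempty hK hne y)))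

lemma measurable_potential {K : Set E} (hK : K.Finite) (hne : K.Nonempty) [MeasurableSpace E]
    [BorelSpace E] {h : ℝ → ℝ} (hh : ContinuousOn h (Ici 0)) : Measurable (potential K h) := by
  have h1 : Continuous fun u : ℝ => h (max u 0) :=
    hh.comp_continuous (by fun_prop) fun u => mem_Ici.2 (le_max_right _ _)
  have h2 : potential K h = fun x => h (max (hullDist K x ^ 2) 0) := by
    ext x
    rw [potential, max_eq_left (sq_nonneg _)]
  rw [h2]
  exact h1.measurable.comp ((lowerSemicontinuous_hullDist hK hne).measurable.pow_const 2)

lemma infDist_convexHull_le {K H : Set E} {R : ℝ} (hR : ∀ p ∈ K, ‖p‖ ≤ R) (hH : H ⊆ K)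
    (hne : H.Nonempty) (x : E) : Metric.infDist x (convexHull ℝ H) ≤ ‖x‖ + R := by
  obtain ⟨p, hp⟩ := hne
  calc _ ≤ dist x p := Metric.infDist_le_dist_of_mem (subset_convexHull ℝ _ hp)
    _ ≤ ‖x‖ + ‖p‖ := by rw [dist_eq_norm]; exact norm_sub_le _ _
    _ ≤ ‖x‖ + R := by linarith [hR p (hH hp)]

lemma exists_potential_le {K : Set E} (hK : K.Finite) (hne : K.Nonempty) {h : ℝ → ℝ}
    (hm : StrictMonoOn h (Ici 0)) (B : ℝ) : ∃ M, ∀ x : E, ‖x‖ ≤ B → potential K h x ≤ M := by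
  obtain ⟨R, hR⟩ := hK.isBounded.exists_norm_le
  refine ⟨h ((B + R) ^ 2), fun x hx => hm.monotoneOn (mem_Ici.2 (sq_nonneg _)) (mem_Ici.2 (sq_nonneg _)) ?_⟩
  have := infDist_convexHull_le hR (optClass_subset K x) (optClass_nonempty hK hne x) x
  exact pow_le_pow_left₀ (hullDist_nonneg K x) (by rw [hullDist]; linarith) 2

/-- Inside each Voronoi cell, the potential is locally Lipschitz. -/
lemma exists_potential_lipschitz {K : Set E} (hK : K.Finite) (hne : K.Nonempty) {h : ℝ → ℝ}
    (hs : ContDiffOn ℝ ∞ h (Ici 0)) (B : ℝ) : ∃ C, 0 ≤ C ∧ ∀ x y : E, ‖x‖ ≤ B → ‖y‖ ≤ B →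
      optClass K x = optClass K y → potential K h x ≤ potential K h y + C * ‖x - y‖ := by
  obtain ⟨R, hR⟩ := hK.isBounded.exists_norm_le
  obtain ⟨L, hL⟩ := (hs.mono (Icc_subset_Ici_self : Icc (0 : ℝ) ((B + R) ^ 2) ⊆ Ici 0)
    ).exists_lipschitzOnWith (by decide) (convex_Icc _ _) isCompact_Icc
  refine ⟨L * (2 * |B + R|), by positivity, fun x y hx hy hxy => ?_⟩
  have bd : ∀ z : E, ‖z‖ ≤ B → hullDist K z ≤ B + R := fun z hz => by
    have := infDist_convexHull_le hR (optClass_subset K z) (optClass_nonempty hK hne z) z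
    rw [hullDist]; linarith
  have mem : ∀ z : E, ‖z‖ ≤ B → hullDist K z ^ 2 ∈ Icc (0 : ℝ) ((B + R) ^ 2) := fun z hz =>
    ⟨sq_nonneg _, pow_le_pow_left₀ (hullDist_nonneg K z) (bd z hz) 2⟩
  have h1 := hL.dist_le_mul _ (mem x hx) _ (mem y hy)
  rw [Real.dist_eq, Real.dist_eq] at h1
  have h2 : |hullDist K x - hullDist K y| ≤ ‖x - y‖ := by
    rw [← Real.dist_eq, ← dist_eq_norm, hullDist, hullDist, hxy]
    have := (Metric.lipschitz_infDist_pt (convexHull ℝ (optClass K y))).dist_le_mul x y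
    simpa using this
  have h3 : |hullDist K x ^ 2 - hullDist K y ^ 2| ≤ 2 * |B + R| * ‖x - y‖ := by
    have e : hullDist K x ^ 2 - hullDist K y ^ 2
        = (hullDist K x + hullDist K y) * (hullDist K x - hullDist K y) := by ring
    rw [e, abs_mul]
    refine mul_le_mul ?_ h2 (abs_nonneg _) (by positivity)
    rw [abs_of_nonneg (add_nonneg (hullDist_nonneg K x) (hullDist_nonneg K y))]
    linarith [bd x hx, bd y hy, le_abs_self (B + R)]
  have h4 : |potential K h x - potential K h y| ≤ L * (2 * |B + R| * ‖x - y‖) :=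
    h1.trans (mul_le_mul_of_nonneg_left h3 L.2)
  linarith [le_abs_self (potential K h x - potential K h y)]

/-- In a balanced set, the potential jumps: near any point, passing to a strictly smaller
optimality class costs at least a fixed positive amount. -/
lemma IsBalanced.exists_potential_jump {K : Set E} (hK : K.Finite) (hne : K.Nonempty)
    (hb : IsBalanced K) {h : ℝ → ℝ} (hs : ContinuousOn h (Ici 0)) (hm : StrictMonoOn h (Ici 0))
    (x₀ : E) : ∃ c > 0, ∃ ρ > 0, ∀ x ∈ Metric.ball x₀ ρ, ∀ y ∈ Metric.ball x₀ ρ,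
      optClass K x ⊂ optClass K y → potential K h y + c ≤ potential K h x := by
  have hcont : ∀ H : Set E, Continuous fun x : E => h (Metric.infDist x (convexHull ℝ H) ^ 2) := by
    intro H
    exact hs.comp_continuous ((Metric.continuous_infDist_pt _).pow 2) fun u => mem_Ici.2 (sq_nonneg _)
  have claim : ∀ P ∈ 𝒫 K ×ˢ 𝒫 K, ∀ᶠ c : ℝ in 𝓝[>] 0, ∀ᶠ z in 𝓝 (x₀, x₀),
      optClass K z.1 = P.1 → optClass K z.2 = P.2 → P.1 ⊂ P.2 →
        potential K h z.2 + c ≤ potential K h z.1 := by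
    rintro ⟨H₁, H₂⟩ -
    by_cases hex : ∃ x y, optClass K x = H₁ ∧ optClass K y = H₂ ∧ H₁ ⊂ H₂ ∧ H₂ ⊆ optClass K x₀
    · obtain ⟨x, y, rfl, rfl, hxy, hy⟩ := hex
      have hlt := hb.infDist_lt hK hne hxy hy
      have hlt2 := hm (mem_Ici.2 (sq_nonneg _)) (mem_Ici.2 (sq_nonneg _))
        (pow_lt_pow_left₀ hlt Metric.infDist_nonneg two_ne_zero)
      obtain ⟨c₁, hc₁⟩ := exists_between (sub_pos.2 hlt2)
      filter_upwards [Ioo_mem_nhdsGT hc₁.1] with c hc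
      have hcz : Continuous fun z : E × E =>
          h (Metric.infDist z.1 (convexHull ℝ (optClass K x)) ^ 2)
            - h (Metric.infDist z.2 (convexHull ℝ (optClass K y)) ^ 2) :=
        ((hcont _).comp continuous_fst).sub ((hcont _).comp continuous_snd)
      filter_upwards [(hcz.tendsto (x₀, x₀)).eventually_const_lt (hc.2.trans hc₁.2)]
        with z hz h1 h2 _
      rw [potential, potential, hullDist, hullDist, h1, h2]
      linarith
    · refine Eventually.of_forall fun c => ?_
      have := (continuous_snd.tendsto (x₀, x₀)).eventually (eventually_optClass_subset hK x₀)
      filter_upwards [this] with z hz h1 h2 h3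
      refine (hex ⟨z.1, z.2, h1, h2, h3, ?_⟩).elim
      rw [← show optClass K z.2 = H₂ from h2]
      exact hz
  have hfin : (𝒫 K ×ˢ 𝒫 K).Finite := hK.finite_subsets.prod hK.finite_subsets
  have hall := (eventually_all_finite hfin).2 claim
  obtain ⟨c, hc, hc0⟩ := (hall.and self_mem_nhdsWithin).exists
  have hc' := (eventually_all_finite hfin).2 hc
  obtain ⟨ρ, hρ, hball⟩ := Metric.eventually_nhds_iff_ball.1 hc'
  refine ⟨c, mem_Ioi.1 hc0, ρ, hρ, ?_⟩
  intro x hx y hy hxy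
  have hmem : (x, y) ∈ Metric.ball (x₀, x₀) ρ := by
    rw [← ball_prod_same]
    exact mk_mem_prod hx hy
  have hP : (optClass K x, optClass K y) ∈ 𝒫 K ×ˢ 𝒫 K :=
    mk_mem_prod (optClass_subset K x) (optClass_subset K y)
  have hfin' := hball (x, y) hmem (optClass K x, optClass K y) hP
  exact hfin' rfl rfl hxy

end

noncomputable section

/-! ### Absolutely continuous curves -/

section AbsolutelyContinuous

open AbsolutelyContinuousOnInterval

lemma LipschitzWith.comp_absolutelyContinuousOnInterval {X Y : Type*} [PseudoMetricSpace X]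
    [PseudoMetricSpace Y] {C : NNReal} {φ : X → Y} (hφ : LipschitzWith C φ) {f : ℝ → X} {a b : ℝ}
    (hf : AbsolutelyContinuousOnInterval f a b) :
    AbsolutelyContinuousOnInterval (fun t => φ (f t)) a b := by
  have h := Tendsto.const_mul (C : ℝ) hf
  rw [mul_zero] at h
  refine squeeze_zero (fun t => Finset.sum_nonneg fun i _ => dist_nonneg) (fun t => ?_) h
  rw [Finset.mul_sum]
  exact Finset.sum_le_sum fun i _ => hφ.dist_le_mul _ _

lemma disjoint_uIoc_of_monotone {φ : ℝ → ℝ} (hφ : Monotone φ ∨ Antitone φ) {x y x' y' : ℝ}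
    (h : Disjoint (uIoc x y) (uIoc x' y')) :
    Disjoint (uIoc (φ x) (φ y)) (uIoc (φ x') (φ y')) := by
  simp only [uIoc, Ioc_disjoint_Ioc] at *
  rcases hφ with hφ | hφ
  · have := hφ h
    simpa only [hφ.map_min, hφ.map_max] using this
  · have := hφ h
    simpa only [hφ.map_min, hφ.map_max] using this

/-- Absolute continuity is preserved by monotone or antitone Lipschitz changes of time. -/
lemma AbsolutelyContinuousOnInterval.comp_monotone {X : Type*} [PseudoMetricSpace X]
    {f : ℝ → X} {φ : ℝ → ℝ} {C : NNReal} {a b c d : ℝ}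
    (hf : AbsolutelyContinuousOnInterval f c d) (hφ : Monotone φ ∨ Antitone φ)
    (hL : LipschitzWith C φ) (hmaps : MapsTo φ (uIcc a b) (uIcc c d)) :
    AbsolutelyContinuousOnInterval (fun t => f (φ t)) a b := by
  rw [absolutelyContinuousOnInterval_iff] at hf ⊢
  intro ε hε
  obtain ⟨δ, hδ, h⟩ := hf ε hε
  refine ⟨δ / (C + 1), by positivity, fun I hI hlen => ?_⟩
  refine h (I.1, fun i => (φ (I.2 i).1, φ (I.2 i).2)) ⟨fun i hi => ?_, fun i hi j hj hij => ?_⟩ ?_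
  · exact ⟨hmaps (hI.1 i hi).1, hmaps (hI.1 i hi).2⟩
  · exact disjoint_uIoc_of_monotone hφ (hI.2 hi hj hij)
  · calc ∑ i ∈ Finset.range I.1, dist (φ (I.2 i).1) (φ (I.2 i).2)
        ≤ ∑ i ∈ Finset.range I.1, (C + 1) * dist (I.2 i).1 (I.2 i).2 := by
          refine Finset.sum_le_sum fun i _ => (hL.dist_le_mul _ _).trans ?_
          gcongr
          linarith
      _ = (C + 1) * ∑ i ∈ Finset.range I.1, dist (I.2 i).1 (I.2 i).2 := by rw [Finset.mul_sum]
      _ < (C + 1) * (δ / (C + 1)) := by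
          have : (0 : ℝ) < C + 1 := by positivity
          gcongr
      _ = δ := by field_simp

variable {E : Type*} [NormedAddCommGroup E] [InnerProductSpace ℝ E]

lemma AbsolutelyContinuousOnInterval.norm_sq {f : ℝ → E} {a b : ℝ}
    (hf : AbsolutelyContinuousOnInterval f a b) :
    AbsolutelyContinuousOnInterval (fun t => ‖f t‖ ^ 2) a b := by
  have h := lipschitzWith_one_norm.comp_absolutelyContinuousOnInterval hf
  have h2 := h.fun_mul h
  simpa only [← pow_two] using h2

lemma AbsolutelyContinuousOnInterval.inner {f g : ℝ → E} {a b : ℝ}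
    (hf : AbsolutelyContinuousOnInterval f a b) (hg : AbsolutelyContinuousOnInterval g a b) :
    AbsolutelyContinuousOnInterval (fun t => (Inner.inner ℝ (f t) (g t) : ℝ)) a b := by
  have h1 := ((hf.fun_add hg).norm_sq.fun_sub (hf.fun_sub hg).norm_sq).const_mul (1 / 4)
  have e : (fun t => (1 / 4 : ℝ) * (‖f t + g t‖ ^ 2 - ‖f t - g t‖ ^ 2))
      = fun t => (Inner.inner ℝ (f t) (g t) : ℝ) := by
    ext t
    rw [norm_add_sq_real, norm_sub_sq_real]
    ring
  rwa [e] at h1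

lemma absolutelyContinuousOnInterval_const (x : E) (a b : ℝ) :
    AbsolutelyContinuousOnInterval (fun _ => x) a b :=
  (LipschitzWith.const x).lipschitzOnWith.absolutelyContinuousOnInterval (K := 0)

lemma AbsolutelyContinuousOnInterval.ae_hasDerivAt_deriv [FiniteDimensional ℝ E] {f : ℝ → E}
    {a b : ℝ} (hf : AbsolutelyContinuousOnInterval f a b) :
    ∀ᵐ t, t ∈ uIcc a b → HasDerivAt f (deriv f t) t := by
  filter_upwards [hf.boundedVariationOn.ae_differentiableAt_of_mem_uIcc] with t ht hmem
  exact (ht hmem).hasDerivAt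

lemma ae_ne (a : ℝ) : ∀ᵐ t : ℝ, t ≠ a := by simp [ae_iff, measure_singleton]

lemma ae_mem_Ioo_of_mem_uIoc (a b : ℝ) (hab : a ≤ b) :
    ∀ᵐ t : ℝ, t ∈ uIoc a b → t ∈ Ioo a b := by
  filter_upwards [ae_ne b] with t ht hmem
  rw [uIoc_of_le hab] at hmem
  exact ⟨hmem.1, lt_of_le_of_ne hmem.2 ht⟩

/-- The fundamental theorem of calculus for real absolutely continuous functions, with a prescribed
representative of the derivative. -/
lemma AbsolutelyContinuousOnInterval.integral_eq_sub {f g : ℝ → ℝ} {a b : ℝ} (hab : a ≤ b)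
    (hf : AbsolutelyContinuousOnInterval f a b)
    (hg : ∀ᵐ t, t ∈ Ioo a b → HasDerivAt f (g t) t) :
    IntervalIntegrable g volume a b ∧ ∫ t in a..b, g t = f b - f a := by
  have hae : ∀ᵐ t, t ∈ uIoc a b → deriv f t = g t := by
    filter_upwards [hg, ae_mem_Ioo_of_mem_uIoc a b hab] with t h1 h2 h3
    exact (h1 (h2 h3)).deriv
  refine ⟨hf.intervalIntegrable_deriv.congr_ae ?_, ?_⟩
  · rw [EventuallyEq, ae_restrict_iff' measurableSet_uIoc]
    exact hae
  · rw [← hf.integral_deriv_eq_sub]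
    exact (intervalIntegral.integral_congr_ae hae).symm

/-- The displacement of an absolutely continuous curve is at most the integral of its speed. -/
lemma AbsolutelyContinuousOnInterval.norm_sub_le_integral {f g : ℝ → E} {a b : ℝ} (hab : a ≤ b)
    (hf : AbsolutelyContinuousOnInterval f a b)
    (hg : ∀ᵐ t, t ∈ Ioo a b → HasDerivAt f (g t) t) {u : ℝ → ℝ}
    (hu : IntervalIntegrable u volume a b) (hgu : ∀ t ∈ Ioo a b, ‖g t‖ ≤ u t) :
    ‖f b - f a‖ ≤ ∫ t in a..b, u t := by
  by_cases h0 : f b - f a = 0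
  · rw [h0, norm_zero, intervalIntegral.integral_of_le hab, integral_Ioc_eq_integral_Ioo]
    exact setIntegral_nonneg measurableSet_Ioo fun t ht => (norm_nonneg _).trans (hgu t ht)
  set e := (‖f b - f a‖)⁻¹ • (f b - f a) with he
  have hn : ‖e‖ = 1 := by
    rw [he, norm_smul, norm_inv, norm_norm, inv_mul_cancel₀ (norm_ne_zero_iff.2 h0)]
  have hac := (absolutelyContinuousOnInterval_const e a b).inner hf
  have hder : ∀ᵐ t, t ∈ Ioo a b →
      HasDerivAt (fun t => (Inner.inner ℝ e (f t) : ℝ)) (Inner.inner ℝ e (g t)) t := by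
    filter_upwards [hg] with t ht hmem
    simpa using (hasDerivAt_const t e).inner ℝ (ht hmem)
  obtain ⟨hint, heq⟩ := hac.integral_eq_sub hab hder
  have h1 : ‖f b - f a‖ = ∫ t in a..b, (Inner.inner ℝ e (g t) : ℝ) := by
    rw [heq, ← inner_sub_right, he, inner_smul_left, real_inner_self_eq_norm_sq]
    have := norm_ne_zero_iff.2 h0
    simp only [RCLike.conj_to_real]
    field_simp
  rw [h1]
  refine intervalIntegral.integral_mono_on_of_le_Ioo hab hint hu fun t ht => ?_
  calc (Inner.inner ℝ e (g t) : ℝ) ≤ ‖e‖ * ‖g t‖ := real_inner_le_norm _ _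
    _ ≤ u t := by rw [hn, one_mul]; exact hgu t ht

end AbsolutelyContinuous

end

noncomputable section

variable {E : Type*} [NormedAddCommGroup E] [InnerProductSpace ℝ E] [FiniteDimensional ℝ E]
  [MeasurableSpace E] [BorelSpace E]

/-! ### Curves that minimize among nearby competitors -/

/-- The standing assumptions on a potential: measurable, nonnegative and bounded on bounded
sets. -/
structure IsPotential (F : E → ℝ) : Prop where
  meas : Measurable F
  nonneg : ∀ x, 0 ≤ F x
  bdd : ∀ B, ∃ M, ∀ x, ‖x‖ ≤ B → F x ≤ M

/-- The curve `c`, with derivative `g`, has finite energy on `[a, b]` and minimizes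
`∫ |c'|² + F (c)` on every subinterval of `[a, b]`, among the absolutely continuous curves with the
same endpoints that are `ε`-close to it. -/
structure LocMin (F : E → ℝ) (c g : ℝ → E) (a b ε : ℝ) : Prop where
  ac : AbsolutelyContinuousOnInterval c a b
  hasDeriv : ∀ᵐ t, t ∈ Ioo a b → HasDerivAt c (g t) t
  meas : Measurable g
  sqInt : IntervalIntegrable (fun t => ‖g t‖ ^ 2) volume a b
  integral_le : ∀ s r, a ≤ s → s < r → r ≤ b → ∀ c' g' : ℝ → E, AbsolutelyContinuousOnInterval c' s r →
    c' s = c s → c' r = c r → (∀ t ∈ Icc s r, ‖c' t - c t‖ ≤ ε) →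
    (∀ᵐ t, t ∈ Ioo s r → HasDerivAt c' (g' t) t) →
    IntervalIntegrable (fun t => ‖g' t‖ ^ 2) volume s r →
    ∫ t in s..r, (‖g t‖ ^ 2 + F (c t)) ≤ ∫ t in s..r, (‖g' t‖ ^ 2 + F (c' t))

lemma IsPotential.intervalIntegrable {F : E → ℝ} (hF : IsPotential F) {c : ℝ → E} {a b : ℝ}
    (hc : ContinuousOn c (uIcc a b)) : IntervalIntegrable (fun t => F (c t)) volume a b := by
  obtain ⟨B, hB⟩ := isCompact_uIcc.exists_bound_of_continuousOn hc
  obtain ⟨M, hM⟩ := hF.bdd B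
  have hm : AEStronglyMeasurable c (volume.restrict (uIoc a b)) :=
    (hc.mono uIoc_subset_uIcc).aestronglyMeasurable measurableSet_uIoc
  refine (intervalIntegrable_const (c := M)).mono_fun
    (hF.meas.comp_aemeasurable hm.aemeasurable).aestronglyMeasurable ?_
  filter_upwards [ae_restrict_mem measurableSet_uIoc] with t ht
  have h1 := hM _ (hB t (uIoc_subset_uIcc ht))
  have h0 := hF.nonneg (c t)
  rw [Real.norm_of_nonneg h0, Real.norm_of_nonneg (h0.trans h1)]
  exact h1

lemma LocMin.mono {F : E → ℝ} {c g : ℝ → E} {a b ε s r : ℝ} (H : LocMin F c g a b ε) (hs : a ≤ s)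
    (hsr : s ≤ r) (hr : r ≤ b) : LocMin F c g s r ε := by
  have hsub : uIcc s r ⊆ uIcc a b := by
    rw [uIcc_of_le hsr, uIcc_of_le (hs.trans (hsr.trans hr))]
    exact Icc_subset_Icc hs hr
  refine ⟨H.ac.mono hsub, ?_, H.meas, H.sqInt.mono_set hsub, ?_⟩
  · filter_upwards [H.hasDeriv] with t ht hmem
    exact ht (Ioo_subset_Ioo hs hr hmem)
  · intro s' r' h1 h2 h3
    exact H.integral_le s' r' (hs.trans h1) h2 (h3.trans hr)

lemma LocMin.intervalIntegrable {F : E → ℝ} (hF : IsPotential F) {c g : ℝ → E} {a b ε : ℝ}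
    (H : LocMin F c g a b ε) : IntervalIntegrable (fun t => ‖g t‖ ^ 2 + F (c t)) volume a b :=
  H.sqInt.add (hF.intervalIntegrable H.ac.continuousOn)

/-! ### Slowing down: a bound on the initial speed -/

lemma ae_comp_affine {P : ℝ → Prop} (h : ∀ᵐ t, P t) {α : ℝ} (hα : α ≠ 0) (d : ℝ) :
    ∀ᵐ t, P (α * (t + d)) := by
  have h1 := (Measure.quasiMeasurePreserving_smul (volume : Measure ℝ) hα).ae h
  exact (measurePreserving_add_right (volume : Measure ℝ) d).quasiMeasurePreserving.ae h1

lemma integral_comp_affine {f : ℝ → ℝ} {α d s r A B : ℝ} (hα : α ≠ 0) (hA : α * (s + d) = A)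
    (hB : α * (r + d) = B) (hf : IntervalIntegrable f volume A B) :
    IntervalIntegrable (fun t => f (α * (t + d))) volume s r ∧
      ∫ t in s..r, f (α * (t + d)) = α⁻¹ * ∫ t in A..B, f t := by
  subst hA hB
  constructor
  · have h1 := (hf.comp_mul_left (c := α)).comp_add_right d
    simpa [mul_div_cancel_left₀ _ hα] using h1
  · rw [intervalIntegral.integral_comp_add_right (fun t => f (α * t)),
      intervalIntegral.integral_comp_mul_left _ hα, smul_eq_mul]

/-- The kinetic energy spent in `[0, σ]` is at most of order `σ`: otherwise it would be cheaper to
run through the beginning of the curve at half the speed and to make up for the delay at later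
times. -/
lemma LocMin.exists_integral_sq_le {F : E → ℝ} (hF : IsPotential F) {c g : ℝ → E} {T ε : ℝ}
    (hT : 0 < T) (hε : 0 < ε) (H : LocMin F c g 0 T ε) :
    ∃ C, 0 ≤ C ∧ ∃ S, 0 < S ∧ S ≤ T ∧ ∀ σ, 0 < σ → σ ≤ S →
      ∫ t in (0 : ℝ)..σ, ‖g t‖ ^ 2 ≤ C * σ := by
  have hcont : ContinuousOn c (Icc 0 T) := by
    have := H.ac.continuousOn
    rwa [uIcc_of_le hT.le] at this
  obtain ⟨S₀, hS₀, hS₀T, hclose⟩ : ∃ S₀, 0 < S₀ ∧ S₀ ≤ T ∧ ∀ t ∈ Icc 0 S₀, ‖c t - c 0‖ ≤ ε / 2 := by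
    obtain ⟨δ, hδ, h⟩ := Metric.continuousWithinAt_iff.1 (hcont 0 ⟨le_rfl, hT.le⟩) (ε / 2)
      (by positivity)
    refine ⟨min (δ / 2) T, by positivity, min_le_right _ _, fun t ht => ?_⟩
    rw [← dist_eq_norm]
    refine (h ⟨ht.1, ht.2.trans (min_le_right _ _)⟩ ?_).le
    rw [Real.dist_eq, sub_zero, abs_of_nonneg ht.1]
    linarith [ht.2.trans (min_le_left _ _)]
  have H₀ := H.mono le_rfl hS₀.le hS₀T
  obtain ⟨B, hB⟩ := H₀.ac.exists_bound
  rw [uIcc_of_le hS₀.le] at hB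
  obtain ⟨M, hM⟩ := hF.bdd B
  have hFM : ∀ t ∈ Icc 0 S₀, F (c t) ≤ M := fun t ht => hM _ (hB t ht)
  have hM0 : 0 ≤ M := (hF.nonneg _).trans (hFM 0 ⟨le_rfl, hS₀.le⟩)
  set I := ∫ t in (0 : ℝ)..S₀, ‖g t‖ ^ 2 with hI
  have hI0 : 0 ≤ I := intervalIntegral.integral_nonneg hS₀.le fun t _ => sq_nonneg _
  refine ⟨2 * (M + 2 / S₀ * I), by positivity, S₀ / 4, by positivity, by linarith,
    fun σ hσ hσS => ?_⟩
  -- The reparametrization is `φ`: slope `1 / 2` on `[0, 2σ]`, slope `α` on `[2σ, S₀]`.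
  set α := (S₀ - σ) / (S₀ - 2 * σ) with hα
  have hden : 0 < S₀ - 2 * σ := by linarith
  have hα1 : α - 1 ≤ 2 / S₀ * σ := by
    have : α - 1 = σ / (S₀ - 2 * σ) := by
      rw [hα, div_sub_one hden.ne']; congr 1; ring
    rw [this, div_mul_eq_mul_div, div_le_div_iff₀ hden hS₀]
    nlinarith
  have hα0 : 1 ≤ α := by rw [hα, one_le_div hden]; linarith
  have hαpos : 0 < α := by linarith
  set d := σ / α - 2 * σ with hd
  have hαd : ∀ t, α * (t + d) = σ + α * (t - 2 * σ) := by
    intro t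
    rw [hd]
    field_simp
    ring
  have hend : α * (S₀ + d) = S₀ := by
    rw [hαd, hα, div_mul_cancel₀ _ hden.ne']
    ring
  have hmid : α * (2 * σ + d) = σ := by rw [hαd]; ring
  set φ : ℝ → ℝ := fun t => max (1 / 2 * (t + 0)) (α * (t + d)) with hφ
  have hφ1 : ∀ t, t ≤ 2 * σ → φ t = 1 / 2 * (t + 0) := by
    intro t ht
    rw [hφ]
    refine max_eq_left ?_
    rw [hαd]
    nlinarith
  have hφ2 : ∀ t, 2 * σ ≤ t → φ t = α * (t + d) := by
    intro t ht
    rw [hφ]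
    refine max_eq_right ?_
    rw [hαd]
    nlinarith
  have hmono : Monotone φ := by
    intro s t hst
    refine max_le_max ?_ ?_
    · linarith
    · exact mul_le_mul_of_nonneg_left (by linarith) hαpos.le
  have hlip : LipschitzWith (max (Real.toNNReal (1 / 2)) (Real.toNNReal α)) φ := by
    refine LipschitzWith.max ?_ ?_ <;> refine LipschitzWith.of_dist_le_mul fun s t => ?_
    · rw [Real.dist_eq, Real.dist_eq, Real.coe_toNNReal _ (by norm_num)]
      rw [show (1 / 2 : ℝ) * (s + 0) - 1 / 2 * (t + 0) = 1 / 2 * (s - t) by ring, abs_mul,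
        abs_of_nonneg (by norm_num : (0 : ℝ) ≤ 1 / 2)]
    · rw [Real.dist_eq, Real.dist_eq, Real.coe_toNNReal _ hαpos.le]
      rw [show α * (s + d) - α * (t + d) = α * (s - t) by ring, abs_mul, abs_of_pos hαpos]
  have hφ0 : φ 0 = 0 := by rw [hφ1 0 (by linarith)]; ring
  have hφS : φ S₀ = S₀ := by rw [hφ2 S₀ (by linarith), hend]
  have hmaps : MapsTo φ (uIcc 0 S₀) (uIcc 0 S₀) := by
    rw [uIcc_of_le hS₀.le]
    intro t ht
    have h1 := hmono ht.1
    have h2 := hmono ht.2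
    rw [hφ0] at h1
    rw [hφS] at h2
    exact ⟨h1, h2⟩
  have hac := H₀.ac.comp_monotone (Or.inl hmono) hlip hmaps
  set g' : ℝ → E := fun t => if t < 2 * σ then (1 / 2 : ℝ) • g (1 / 2 * (t + 0))
    else α • g (α * (t + d)) with hg'
  have hder : ∀ᵐ t, t ∈ Ioo 0 S₀ → HasDerivAt (fun t => c (φ t)) (g' t) t := by
    filter_upwards [ae_comp_affine H₀.hasDeriv (one_half_pos (α := ℝ)).ne' 0,
      ae_comp_affine H₀.hasDeriv hαpos.ne' d, ae_ne (2 * σ)] with t h1 h2 hne hmem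
    have haff : ∀ β e : ℝ, HasDerivAt (fun t : ℝ => β * (t + e)) β t := fun β e => by
      simpa using ((hasDerivAt_id t).add_const e).const_mul β
    rcases lt_or_gt_of_ne hne with hlt | hgt
    · rw [hg']
      simp only [hlt, if_true]
      have hm : 1 / 2 * (t + 0) ∈ Ioo 0 S₀ := ⟨by linarith [hmem.1], by linarith [hmem.2]⟩
      refine ((h1 hm).scomp t (haff _ _)).congr_of_eventuallyEq ?_
      filter_upwards [Iio_mem_nhds hlt] with s hs
      rw [hφ1 s (le_of_lt hs)]
      rfl
    · rw [hg']
      simp only [hgt.not_gt, if_false]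
      have hm : α * (t + d) ∈ Ioo 0 S₀ := by
        constructor
        · rw [hαd]
          nlinarith
        · calc α * (t + d) < α * (S₀ + d) := by
                have := hmem.2
                gcongr
            _ = S₀ := hend
      refine ((h2 hm).scomp t (haff _ _)).congr_of_eventuallyEq ?_
      filter_upwards [Ioi_mem_nhds hgt] with s hs
      rw [hφ2 s (le_of_lt hs)]
      rfl
  have hσS₀ : σ ≤ S₀ := by linarith
  have sub1 : uIcc 0 σ ⊆ uIcc 0 S₀ := by
    rw [uIcc_of_le hσ.le, uIcc_of_le hS₀.le]
    exact Icc_subset_Icc le_rfl hσS₀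
  have sub2 : uIcc σ S₀ ⊆ uIcc 0 S₀ := by
    rw [uIcc_of_le hσS₀, uIcc_of_le hS₀.le]
    exact Icc_subset_Icc hσ.le le_rfl
  have iF := hF.intervalIntegrable H₀.ac.continuousOn
  have ig1 := H₀.sqInt.mono_set sub1
  have ig2 := H₀.sqInt.mono_set sub2
  have iF1 := iF.mono_set sub1
  have iF2 := iF.mono_set sub2
  -- kinetic and potential energies of the two parts of the competitor
  obtain ⟨j1, k1⟩ := integral_comp_affine (s := 0) (r := 2 * σ) (α := 1 / 2) (d := 0) (by norm_num)
    (by norm_num) (by ring) (ig1.const_mul (1 / 4))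
  obtain ⟨j2, k2⟩ := integral_comp_affine (s := 0) (r := 2 * σ) (α := 1 / 2) (d := 0) (by norm_num)
    (by norm_num) (by ring) iF1
  obtain ⟨j3, k3⟩ := integral_comp_affine hαpos.ne' hmid hend (ig2.const_mul (α ^ 2))
  obtain ⟨j4, k4⟩ := integral_comp_affine hαpos.ne' hmid hend iF2
  have e1 : ∀ t ∈ Ioo 0 (2 * σ), 1 / 4 * ‖g (1 / 2 * (t + 0))‖ ^ 2 = ‖g' t‖ ^ 2 := by
    intro t ht
    rw [hg']
    simp only [ht.2, if_true, norm_smul, mul_pow]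
    norm_num
  have e2 : ∀ t ∈ Ioo (2 * σ) S₀, α ^ 2 * ‖g (α * (t + d))‖ ^ 2 = ‖g' t‖ ^ 2 := by
    intro t ht
    rw [hg']
    simp only [ht.1.not_gt, if_false, norm_smul, mul_pow, Real.norm_eq_abs, sq_abs]
  have f1 : ∀ t ∈ Ioo 0 (2 * σ), F (c (1 / 2 * (t + 0))) = F (c (φ t)) := fun t ht => by
    rw [hφ1 t ht.2.le]
  have f2 : ∀ t ∈ Ioo (2 * σ) S₀, F (c (α * (t + d))) = F (c (φ t)) := fun t ht => by
    rw [hφ2 t ht.1.le]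
  have h2σ : (0 : ℝ) ≤ 2 * σ := by linarith
  have h2σS : 2 * σ ≤ S₀ := by linarith
  have congrI : ∀ {u v : ℝ → ℝ} {p q : ℝ}, p ≤ q → (∀ t ∈ Ioo p q, u t = v t) →
      IntervalIntegrable u volume p q →
      IntervalIntegrable v volume p q ∧ ∫ t in p..q, v t = ∫ t in p..q, u t := by
    intro u v p q hpq huv hu
    have hae : ∀ᵐ t, t ∈ uIoc p q → u t = v t := by
      filter_upwards [ae_mem_Ioo_of_mem_uIoc p q hpq] with t h1 h2
      exact huv t (h1 h2)
    refine ⟨hu.congr_ae ?_, (intervalIntegral.integral_congr_ae hae).symm⟩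
    rw [EventuallyEq, ae_restrict_iff' measurableSet_uIoc]
    exact hae
  obtain ⟨j1', k1'⟩ := congrI h2σ e1 j1
  obtain ⟨j2', k2'⟩ := congrI h2σ f1 j2
  obtain ⟨j3', k3'⟩ := congrI h2σS e2 j3
  obtain ⟨j4', k4'⟩ := congrI h2σS f2 j4
  have hmin := H₀.integral_le 0 S₀ le_rfl hS₀ le_rfl (fun t => c (φ t)) g' hac (by simp [hφ0])
    (by simp [hφS]) (fun t ht => ?_) hder (j1'.trans j3')
  swap
  · have hm : φ t ∈ Icc 0 S₀ := by
      have := hmaps (x := t) (by rwa [uIcc_of_le hS₀.le])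
      rwa [uIcc_of_le hS₀.le] at this
    calc ‖c (φ t) - c t‖ = ‖(c (φ t) - c 0) - (c t - c 0)‖ := by congr 1; abel
      _ ≤ ‖c (φ t) - c 0‖ + ‖c t - c 0‖ := norm_sub_le _ _
      _ ≤ ε := by linarith [hclose _ hm, hclose t ht]
  rw [intervalIntegral.integral_add H₀.sqInt iF,
    intervalIntegral.integral_add (j1'.trans j3') (j2'.trans j4'),
    ← intervalIntegral.integral_add_adjacent_intervals j1' j3',
    ← intervalIntegral.integral_add_adjacent_intervals j2' j4', k1', k2', k3', k4', k1, k2, k3, k4,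
    intervalIntegral.integral_const_mul, intervalIntegral.integral_const_mul,
    ← intervalIntegral.integral_add_adjacent_intervals iF1 iF2] at hmin
  have hIsplit := intervalIntegral.integral_add_adjacent_intervals ig1 ig2
  rw [← hI] at hmin
  have hF1 : ∫ t in (0 : ℝ)..σ, F (c t) ≤ σ * M := by
    calc ∫ t in (0 : ℝ)..σ, F (c t) ≤ ∫ _ in (0 : ℝ)..σ, M :=
          intervalIntegral.integral_mono_on hσ.le iF1 intervalIntegrable_const
            fun t ht => hFM t ⟨ht.1, ht.2.trans hσS₀⟩
      _ = σ * M := by simp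
  have hF2 : 0 ≤ ∫ t in σ..S₀, F (c t) :=
    intervalIntegral.integral_nonneg hσS₀ fun t _ => hF.nonneg _
  have hg2 : 0 ≤ ∫ t in σ..S₀, ‖g t‖ ^ 2 :=
    intervalIntegral.integral_nonneg hσS₀ fun t _ => sq_nonneg _
  have hg1 : 0 ≤ ∫ t in (0 : ℝ)..σ, ‖g t‖ ^ 2 :=
    intervalIntegral.integral_nonneg hσ.le fun t _ => sq_nonneg _
  have hg2I : ∫ t in σ..S₀, ‖g t‖ ^ 2 ≤ I := by linarith
  have hinv : α⁻¹ * (∫ t in σ..S₀, F (c t)) ≤ ∫ t in σ..S₀, F (c t) :=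
    mul_le_of_le_one_left hF2 (inv_le_one_of_one_le₀ hα0)
  have hkin : α⁻¹ * (α ^ 2 * ∫ t in σ..S₀, ‖g t‖ ^ 2)
      = (∫ t in σ..S₀, ‖g t‖ ^ 2) + (α - 1) * ∫ t in σ..S₀, ‖g t‖ ^ 2 := by
    field_simp
    ring
  have hextra : (α - 1) * (∫ t in σ..S₀, ‖g t‖ ^ 2) ≤ 2 / S₀ * σ * I :=
    mul_le_mul hα1 hg2I hg2 (by positivity)
  norm_num at hmin
  rw [hkin] at hmin
  nlinarith

/-- A minimizing curve moves at most at bounded speed away from its initial point. -/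
lemma LocMin.exists_norm_sub_le {F : E → ℝ} (hF : IsPotential F) {c g : ℝ → E} {T ε : ℝ}
    (hT : 0 < T) (hε : 0 < ε) (H : LocMin F c g 0 T ε) :
    ∃ C, 0 ≤ C ∧ ∃ S, 0 < S ∧ S ≤ T ∧ ∀ σ, 0 < σ → σ ≤ S → ‖c σ - c 0‖ ≤ C * σ := by
  obtain ⟨C, hC, S, hS, hST, h⟩ := H.exists_integral_sq_le hF hT hε
  refine ⟨(1 + C) / 2, by positivity, S, hS, hST, fun σ hσ hσS => ?_⟩
  have Hσ := H.mono le_rfl hσ.le (hσS.trans hST)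
  have hint : IntervalIntegrable (fun t => 1 / 2 * (1 + ‖g t‖ ^ 2)) volume 0 σ :=
    (intervalIntegrable_const.add Hσ.sqInt).const_mul _
  have := Hσ.ac.norm_sub_le_integral hσ.le Hσ.hasDeriv hint fun t _ => by
    nlinarith [sq_nonneg (‖g t‖ - 1)]
  rw [intervalIntegral.integral_const_mul,
    intervalIntegral.integral_add intervalIntegrable_const Hσ.sqInt] at this
  simp only [intervalIntegral.integral_const, sub_zero, smul_eq_mul, mul_one] at this
  have := h σ hσ hσS
  linarith

end

noncomputable section

variable {E : Type*} [NormedAddCommGroup E] [InnerProductSpace ℝ E] [FiniteDimensional ℝ E]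
  [MeasurableSpace E] [BorelSpace E]

/-! ### The monotonicity formula -/

/-- The potential is almost radially nondecreasing at `x₀`. -/
def AlmostConical (F : E → ℝ) (x₀ : E) : Prop :=
  ∃ ρ > 0, ∃ C, 0 ≤ C ∧ ∀ v : E, ‖v‖ < ρ → ∀ s : ℝ, 0 < s → s ≤ 1 →
    F (x₀ + s • v) ≤ F (x₀ + v) + C * ‖v‖

/-- The energy on `[0, σ]` is compared with the energy of the straight segment from `c 0` to
`c σ`. -/
lemma LocMin.integral_le_segment {F : E → ℝ} (hF : IsPotential F) {c g : ℝ → E} {T ε : ℝ}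
    (hT : 0 < T) (hε : 0 < ε) (H : LocMin F c g 0 T ε) (hcone : AlmostConical F (c 0)) :
    ∃ C, 0 ≤ C ∧ ∃ S, 0 < S ∧ S ≤ T ∧ ∀ σ, 0 < σ → σ ≤ S → ‖c σ - c 0‖ ≤ C * σ ∧
      ∫ t in (0 : ℝ)..σ, (‖g t‖ ^ 2 + F (c t)) ≤
        ‖c σ - c 0‖ ^ 2 / σ + σ * F (c σ) + C * σ ^ 2 := by
  obtain ⟨C₁, hC₁, S₁, hS₁, hS₁T, hspeed⟩ := H.exists_norm_sub_le hF hT hε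
  obtain ⟨ρ, hρ, C₂, hC₂, hrad⟩ := hcone
  set m := min (ε / 2) (ρ / 2) with hm
  have hm0 : 0 < m := by positivity
  refine ⟨C₁ + C₂ * C₁, by positivity, min S₁ (m / (C₁ + 1)), by positivity,
    (min_le_left _ _).trans hS₁T, fun σ hσ hσS => ?_⟩
  have hσS₁ : σ ≤ S₁ := hσS.trans (min_le_left _ _)
  have hv := hspeed σ hσ hσS₁
  have hball : ∀ t, 0 ≤ t → t ≤ σ → ‖c t - c 0‖ ≤ m := by
    intro t ht htσ
    rcases ht.eq_or_lt with rfl | ht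
    · simpa using hm0.le
    · calc ‖c t - c 0‖ ≤ C₁ * t := hspeed t ht (htσ.trans hσS₁)
        _ ≤ (C₁ + 1) * σ := by gcongr; linarith
        _ ≤ (C₁ + 1) * (m / (C₁ + 1)) := by gcongr; exact hσS.trans (min_le_right _ _)
        _ = m := by field_simp
  set v := c σ - c 0 with hvdef
  have hvm : ‖v‖ ≤ m := hball σ hσ.le le_rfl
  refine ⟨hv.trans (by nlinarith [mul_nonneg hC₂ hC₁, hσ]), ?_⟩
  set c' : ℝ → E := fun t => c 0 + (t / σ) • v with hc'
  have hder : ∀ t, HasDerivAt c' ((1 / σ) • v) t := fun t =>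
    (((hasDerivAt_id t).div_const σ).smul_const v).const_add _
  have hac : AbsolutelyContinuousOnInterval c' 0 σ := by
    refine ContDiffOn.absolutelyContinuousOnInterval (ContDiff.contDiffOn ?_)
    rw [hc']
    fun_prop
  have hc'cont : ContinuousOn c' (uIcc 0 σ) := hac.continuousOn
  have hmin := H.integral_le 0 σ le_rfl hσ (hσS₁.trans hS₁T) c' (fun _ => (1 / σ) • v) hac
    (by simp [hc']) (by simp [hc', hσ.ne', hvdef]) (fun t ht => ?_)
    (Eventually.of_forall fun t _ => hder t) intervalIntegrable_const
  swap
  · have h1 := hball t ht.1 ht.2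
    have h2 : ‖(t / σ) • v‖ ≤ m := by
      rw [norm_smul, Real.norm_of_nonneg (div_nonneg ht.1 hσ.le)]
      calc t / σ * ‖v‖ ≤ 1 * ‖v‖ := by
            gcongr
            exact div_le_one_of_le₀ ht.2 hσ.le
        _ ≤ m := by linarith
    have h3 : m ≤ ε / 2 := min_le_left _ _
    calc ‖c' t - c t‖ = ‖(t / σ) • v - (c t - c 0)‖ := by rw [hc']; congr 1; module
      _ ≤ ‖(t / σ) • v‖ + ‖c t - c 0‖ := norm_sub_le _ _
      _ ≤ ε := by linarith
  refine hmin.trans ?_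
  have hle : ∫ t in (0 : ℝ)..σ, (‖(1 / σ) • v‖ ^ 2 + F (c' t))
      ≤ ∫ _ in (0 : ℝ)..σ, (‖(1 / σ) • v‖ ^ 2 + (F (c σ) + C₂ * ‖v‖)) := by
    refine intervalIntegral.integral_mono_on_of_le_Ioo hσ.le
      (intervalIntegrable_const.add (hF.intervalIntegrable hc'cont)) intervalIntegrable_const
      fun t ht => ?_
    have h := hrad v (hvm.trans_lt ((min_le_right _ _).trans_lt (half_lt_self hρ))) (t / σ)
      (div_pos ht.1 hσ) (div_le_one_of_le₀ ht.2.le hσ.le)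
    have e : c 0 + v = c σ := by rw [hvdef]; abel
    rw [e] at h
    gcongr
  refine hle.trans ?_
  rw [intervalIntegral.integral_const, sub_zero, smul_eq_mul, norm_smul, mul_pow,
    Real.norm_of_nonneg (by positivity : (0 : ℝ) ≤ 1 / σ)]
  have e : σ * ((1 / σ) ^ 2 * ‖v‖ ^ 2 + (F (c σ) + C₂ * ‖v‖))
      = ‖v‖ ^ 2 / σ + σ * F (c σ) + C₂ * (σ * ‖v‖) := by
    field_simp
    ring
  rw [e]
  have : C₂ * (σ * ‖v‖) ≤ (C₁ + C₂ * C₁) * σ ^ 2 := by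
    calc C₂ * (σ * ‖v‖) ≤ C₂ * (σ * (C₁ * σ)) := by gcongr
      _ ≤ (C₁ + C₂ * C₁) * σ ^ 2 := by nlinarith [mul_nonneg hC₁ (sq_nonneg σ)]
  linarith

/-- Rescaled energies `A σ = σ⁻¹ ∫₀^σ (|c'|² + F (c)) - |c σ - c 0|² / σ²` are almost monotone in
`σ`, because `A' ≥ |c' - (c - c 0) / σ|² / σ - C` by the comparison with segments. Since they are
bounded, the integral of the right-hand side converges at `0`. -/
lemma LocMin.exists_integral_defect_le {F : E → ℝ} (hF : IsPotential F) {c g : ℝ → E} {T ε : ℝ}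
    (hT : 0 < T) (hε : 0 < ε) (H : LocMin F c g 0 T ε) (hcone : AlmostConical F (c 0))
    {η : ℝ} (hη : 0 < η) :
    ∃ S, 0 < S ∧ S ≤ T ∧ ∀ a b, 0 < a → a ≤ b → b ≤ S →
      IntervalIntegrable (fun t => t⁻¹ * ‖g t - t⁻¹ • (c t - c 0)‖ ^ 2) volume a b ∧
      ∫ t in a..b, t⁻¹ * ‖g t - t⁻¹ • (c t - c 0)‖ ^ 2 ≤ η := by
  obtain ⟨C, hC, S, hS, hST, hseg⟩ := H.integral_le_segment hF hT hε hcone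
  set e : ℝ → ℝ := fun t => ‖g t‖ ^ 2 + F (c t) with he
  have he0 : ∀ t, 0 ≤ e t := fun t => add_nonneg (sq_nonneg _) (hF.nonneg _)
  have hei : IntervalIntegrable e volume 0 T := H.intervalIntegrable hF
  set A : ℝ → ℝ := fun t => t⁻¹ * (∫ u in (0 : ℝ)..t, e u) - (t⁻¹) ^ 2 * ‖c t - c 0‖ ^ 2 with hA
  set D : ℝ → ℝ := fun t => t⁻¹ * ‖g t - t⁻¹ • (c t - c 0)‖ ^ 2 with hD
  have hacv : AbsolutelyContinuousOnInterval (fun t => c t - c 0) 0 T :=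
    H.ac.fun_sub (absolutelyContinuousOnInterval_const _ _ _)
  have hacE : AbsolutelyContinuousOnInterval (fun t => ∫ u in (0 : ℝ)..t, e u) 0 T :=
    hei.absolutelyContinuousOnInterval_intervalIntegral left_mem_uIcc
  have hDeq : ∀ t, D t = t⁻¹ * ‖g t‖ ^ 2 - (t⁻¹) ^ 2 * (2 * inner ℝ (c t - c 0) (g t))
      + (t⁻¹) ^ 3 * ‖c t - c 0‖ ^ 2 := fun t => by
    simp only [hD]
    rw [norm_sub_sq_real, norm_smul, inner_smul_right, mul_pow, norm_inv, inv_pow,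
      Real.norm_eq_abs, sq_abs, real_inner_comm]
    ring
  have key : ∀ a b, 0 < a → a ≤ b → b ≤ S → IntervalIntegrable D volume a b ∧
      ∫ t in a..b, D t ≤ (A b + C * b) - (A a + C * a) := by
    intro a b ha hab hbS
    have hsub : uIcc a b ⊆ uIcc 0 T := by
      rw [uIcc_of_le hab, uIcc_of_le hT.le]
      exact Icc_subset_Icc ha.le (hbS.trans hST)
    have hpos : ∀ t ∈ uIcc a b, 0 < t := by
      intro t ht
      rw [uIcc_of_le hab] at ht
      exact ha.trans_le ht.1
    have hinv : ContDiffOn ℝ 1 (fun t : ℝ => t⁻¹) (uIcc a b) := fun t ht =>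
      (contDiffAt_inv ℝ (hpos t ht).ne').contDiffWithinAt
    have acinv := hinv.absolutelyContinuousOnInterval
    have acinv2 : AbsolutelyContinuousOnInterval (fun t : ℝ => (t⁻¹) ^ 2) a b := by
      simpa only [← pow_two] using acinv.fun_mul acinv
    have acA : AbsolutelyContinuousOnInterval A a b :=
      (acinv.fun_mul (hacE.mono hsub)).fun_sub (acinv2.fun_mul (hacv.mono hsub).norm_sq)
    have acv2 := (hacv.mono hsub).norm_sq
    have hgd : ∀ᵐ t, t ∈ Ioo a b → HasDerivAt (fun t => c t - c 0) (g t) t := by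
      filter_upwards [H.hasDeriv] with t ht hmem
      exact (ht ⟨ha.trans hmem.1, hmem.2.trans_le (hbS.trans hST)⟩).sub_const _
    have hv2d : ∀ᵐ t, t ∈ Ioo a b → HasDerivAt (fun t => ‖c t - c 0‖ ^ 2)
        (2 * inner ℝ (c t - c 0) (g t)) t := by
      filter_upwards [hgd] with t ht hmem
      exact (ht hmem).norm_sq
    obtain ⟨hinner, -⟩ := acv2.integral_eq_sub hab hv2d
    have cinv : ContinuousOn (fun t : ℝ => t⁻¹) (uIcc a b) := hinv.continuousOn
    have hDi : IntervalIntegrable D volume a b := by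
      have h1 := (H.sqInt.mono_set hsub).mul_continuousOn cinv
      have h2 := hinner.mul_continuousOn (cinv.pow 2)
      have h3 : IntervalIntegrable (fun t => ‖c t - c 0‖ ^ 2 * (t⁻¹) ^ 3) volume a b :=
        (acv2.continuousOn.mul (cinv.pow 3)).intervalIntegrable
      refine ((h1.sub h2).add h3).congr fun t _ => ?_
      simp only [hDeq, Pi.pow_apply]
      ring
    have hdA : ∀ᵐ t, t ∈ Ioo a b → HasDerivAt A
        ((-(t ^ 2)⁻¹ * (∫ u in (0 : ℝ)..t, e u) + t⁻¹ * e t) -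
          ((2 * t⁻¹ * (-(t ^ 2)⁻¹)) * ‖c t - c 0‖ ^ 2 +
            (t⁻¹) ^ 2 * (2 * inner ℝ (c t - c 0) (g t)))) t := by
      filter_upwards [hv2d, hei.ae_hasDerivAt_integral] with t h1 h2 hmem
      have htpos : 0 < t := ha.trans hmem.1
      have h3 := h2 (hsub (by rw [uIcc_of_le hab]; exact Ioo_subset_Icc_self hmem)) 0
        left_mem_uIcc
      have h4 : HasDerivAt (fun t : ℝ => t⁻¹) (-(t ^ 2)⁻¹) t := hasDerivAt_inv htpos.ne'
      have h5 : HasDerivAt (fun t : ℝ => (t⁻¹) ^ 2) (2 * t⁻¹ * (-(t ^ 2)⁻¹)) t := by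
        simpa using h4.fun_pow 2
      exact (h4.mul h3).sub (h5.mul (h1 hmem))
    obtain ⟨hAi, hAeq⟩ := acA.integral_eq_sub hab hdA
    refine ⟨hDi, ?_⟩
    have hle : ∫ t in a..b, (D t - C) ≤ A b - A a := by
      rw [← hAeq]
      refine intervalIntegral.integral_mono_on_of_le_Ioo hab (hDi.sub intervalIntegrable_const) hAi
        fun t ht => ?_
      have htpos : 0 < t := ha.trans ht.1
      obtain ⟨-, h1⟩ := hseg t htpos (ht.2.le.trans hbS)
      have h2 : (t ^ 2)⁻¹ * (∫ u in (0 : ℝ)..t, e u)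
          ≤ (t ^ 2)⁻¹ * (‖c t - c 0‖ ^ 2 / t + t * F (c t) + C * t ^ 2) := by gcongr
      have h3 : (t ^ 2)⁻¹ * (‖c t - c 0‖ ^ 2 / t + t * F (c t) + C * t ^ 2)
          = (t⁻¹) ^ 3 * ‖c t - c 0‖ ^ 2 + t⁻¹ * F (c t) + C := by
        field_simp
      have h5 : t⁻¹ * e t = t⁻¹ * ‖g t‖ ^ 2 + t⁻¹ * F (c t) := by rw [he]; ring
      have h6 : 2 * t⁻¹ * (-(t ^ 2)⁻¹) * ‖c t - c 0‖ ^ 2 = -2 * ((t⁻¹) ^ 3 * ‖c t - c 0‖ ^ 2) := by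
        rw [← inv_pow]; ring
      rw [h5, h6, hDeq]
      linarith
    rw [intervalIntegral.integral_sub hDi intervalIntegrable_const,
      intervalIntegral.integral_const, smul_eq_mul] at hle
    linarith
  have hD0 : ∀ t, 0 < t → 0 ≤ D t := fun t ht => by rw [hD]; positivity
  set f : ℝ → ℝ := fun t => A t + C * t with hf
  have hbdd : BddBelow (f '' Ioc 0 S) := by
    refine ⟨-C ^ 2, ?_⟩
    rintro _ ⟨t, ht, rfl⟩
    obtain ⟨h1, -⟩ := hseg t ht.1 ht.2
    have ht0 := ht.1
    have h2 : (t⁻¹) ^ 2 * ‖c t - c 0‖ ^ 2 ≤ C ^ 2 := by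
      calc (t⁻¹) ^ 2 * ‖c t - c 0‖ ^ 2 ≤ (t⁻¹) ^ 2 * (C * t) ^ 2 := by gcongr
        _ = C ^ 2 := by field_simp
    have h3 : 0 ≤ t⁻¹ * ∫ u in (0 : ℝ)..t, e u :=
      mul_nonneg (inv_nonneg.2 ht0.le)
        (intervalIntegral.integral_nonneg ht0.le fun u _ => he0 u)
    have h4 : 0 ≤ C * t := mul_nonneg hC ht0.le
    simp only [hf, hA]
    linarith
  have hne : (f '' Ioc 0 S).Nonempty := ⟨_, mem_image_of_mem f ⟨hS, le_rfl⟩⟩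
  obtain ⟨_, ⟨s, hs, rfl⟩, hslt⟩ := exists_lt_of_csInf_lt hne (lt_add_of_pos_right (sInf (f '' Ioc 0 S)) hη)
  refine ⟨s, hs.1, hs.2.trans hST, fun a b ha hab hbs => ?_⟩
  obtain ⟨h1, h2⟩ := key a b ha hab (hbs.trans hs.2)
  refine ⟨h1, h2.trans ?_⟩
  have h3 := csInf_le hbdd (mem_image_of_mem f ⟨ha, hab.trans (hbs.trans hs.2)⟩)
  obtain ⟨-, h4⟩ := key b s (ha.trans_le hab) hbs hs.2
  have h5 : 0 ≤ ∫ t in b..s, D t :=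
    intervalIntegral.integral_nonneg hbs fun t ht => hD0 t ((ha.trans_le hab).trans_le ht.1)
  have h6 : f a = A a + C * a := rfl
  have h7 : f s = A s + C * s := rfl
  linarith

/-- The rescaled positions `(c t - c 0) / t` oscillate less and less on the intervals `[a, 8 a]`,
as `a → 0`. -/
lemma LocMin.exists_oscillation_le {F : E → ℝ} (hF : IsPotential F) {c g : ℝ → E} {T ε : ℝ}
    (hT : 0 < T) (hε : 0 < ε) (H : LocMin F c g 0 T ε) (hcone : AlmostConical F (c 0))
    {κ : ℝ} (hκ : 0 < κ) :
    ∃ S, 0 < S ∧ S ≤ T ∧ ∀ a b, 0 < a → a ≤ b → b ≤ 8 * a → b ≤ S →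
      ‖b⁻¹ • (c b - c 0) - a⁻¹ • (c a - c 0)‖ ≤ κ := by
  obtain ⟨S, hS, hST, h⟩ :=
    H.exists_integral_defect_le hF hT hε hcone (η := κ ^ 2 / 7) (by positivity)
  refine ⟨S, hS, hST, fun a b ha hab hb8 hbS => ?_⟩
  obtain ⟨hint, hle⟩ := h a b ha hab hbS
  have Hab := H.mono ha.le hab (hbS.trans hST)
  have hinv : ContDiffOn ℝ 1 (fun t : ℝ => t⁻¹) (uIcc a b) := fun t ht => by
    rw [uIcc_of_le hab] at ht
    exact (contDiffAt_inv ℝ (ha.trans_le ht.1).ne').contDiffWithinAt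
  have hac : AbsolutelyContinuousOnInterval (fun t => t⁻¹ • (c t - c 0)) a b :=
    hinv.absolutelyContinuousOnInterval.fun_smul
      (Hab.ac.fun_sub (absolutelyContinuousOnInterval_const _ _ _))
  have hder : ∀ᵐ t, t ∈ Ioo a b → HasDerivAt (fun t => t⁻¹ • (c t - c 0))
      (t⁻¹ • (g t - t⁻¹ • (c t - c 0))) t := by
    filter_upwards [Hab.hasDeriv] with t ht hmem
    have htpos : 0 < t := ha.trans hmem.1
    refine ((hasDerivAt_inv htpos.ne').fun_smul ((ht hmem).sub_const (c 0))).congr_deriv ?_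
    rw [← inv_pow]
    module
  set z : ℝ → ℝ := fun t => t⁻¹ * ‖g t - t⁻¹ • (c t - c 0)‖ ^ 2 with hz
  -- Young's inequality, with weights that balance the two contributions
  have hu : IntervalIntegrable (fun t => 1 / 2 * (κ / 7 / a + 7 / κ * z t)) volume a b :=
    (intervalIntegrable_const.add (hint.const_mul _)).const_mul _
  have hfin := hac.norm_sub_le_integral hab hder hu fun t ht => by
    have htpos : 0 < t := ha.trans ht.1
    rw [norm_smul, norm_inv, Real.norm_of_nonneg htpos.le, hz]
    set y := ‖g t - t⁻¹ • (c t - c 0)‖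
    have h1 : t⁻¹ * (κ / 7) ≤ κ / 7 / a := by
      rw [div_eq_mul_inv (κ / 7) a, mul_comm]
      have := ht.1.le
      gcongr
    have h2 : y ≤ 1 / 2 * (κ / 7 + 7 / κ * y ^ 2) := by
      have : 1 / 2 * (κ / 7 + 7 / κ * y ^ 2) - y = (κ - 7 * y) ^ 2 / (14 * κ) := by
        field_simp
        ring
      have h3 : 0 ≤ (κ - 7 * y) ^ 2 / (14 * κ) := by positivity
      linarith
    calc t⁻¹ * y ≤ t⁻¹ * (1 / 2 * (κ / 7 + 7 / κ * y ^ 2)) := by gcongr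
      _ = 1 / 2 * (t⁻¹ * (κ / 7) + 7 / κ * (t⁻¹ * y ^ 2)) := by ring
      _ ≤ _ := by gcongr
  refine hfin.trans ?_
  rw [intervalIntegral.integral_const_mul,
    intervalIntegral.integral_add intervalIntegrable_const (hint.const_mul _),
    intervalIntegral.integral_const, intervalIntegral.integral_const_mul, smul_eq_mul]
  have h1 : (b - a) * (κ / 7 / a) ≤ κ := by
    rw [div_div, mul_div_assoc', div_le_iff₀ (by positivity)]
    nlinarith
  have h2 : 7 / κ * (∫ t in a..b, z t) ≤ κ := by
    calc 7 / κ * (∫ t in a..b, z t) ≤ 7 / κ * (κ ^ 2 / 7) := by gcongr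
      _ = κ := by field_simp
  linarith

end

noncomputable section

variable {E : Type*} [NormedAddCommGroup E] [InnerProductSpace ℝ E]

/-! ### The conical structure of the Voronoi cells near a point -/

/-- The direction of the affine space `equidistantSpace H`: the orthogonal complement of the
differences of the points of `H`. -/
def equidistantDirection (H : Set E) : Submodule ℝ E where
  carrier := {y | ∀ p ∈ H, ∀ q ∈ H, inner ℝ y (p - q) = (0 : ℝ)}
  add_mem' {a b} ha hb p hp q hq := by rw [inner_add_left, ha p hp q hq, hb p hp q hq, add_zero]
  zero_mem' p _ q _ := inner_zero_left _
  smul_mem' r a ha p hp q hq := by rw [inner_smul_left, ha p hp q hq, mul_zero]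

lemma sub_mem_equidistantDirection {H : Set E} {x y : E} (hx : x ∈ equidistantSpace H)
    (hy : y ∈ equidistantSpace H) : y - x ∈ equidistantDirection H := fun p hp q hq =>
  inner_sub_eq_zero_of_equidistant (hx p hp q hq) (hy p hp q hq)

lemma add_mem_equidistantSpace {H : Set E} {x v : E} (hx : x ∈ equidistantSpace H)
    (hv : v ∈ equidistantDirection H) : x + v ∈ equidistantSpace H := fun p hp q hq =>
  (norm_add_sub_eq_iff (hx p hp q hq)).2 (hv p hp q hq)

lemma mem_equidistantSpace_optClass (K : Set E) (x : E) : x ∈ equidistantSpace (optClass K x) :=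
  fun _ hp _ hq => norm_sub_eq_of_mem_optClass hp hq

lemma equidistantSpace_anti {H H' : Set E} (h : H ⊆ H') :
    equidistantSpace H' ⊆ equidistantSpace H := fun _ hx p hp q hq => hx p (h hp) q (h hq)

lemma optClass_add_eq_of_mem {K : Set E} (hK : K.Finite) (hne : K.Nonempty) {x v : E} {H : Set E}
    (hH : H ⊆ optClass K x) (h : optClass K (x + v) ⊆ H) (hv : v ∈ equidistantDirection H) :
    optClass K (x + v) = H :=
  optClass_eq_of_equidistant hK hne (hH.trans (optClass_subset K x)) h
    (add_mem_equidistantSpace (equidistantSpace_anti hH (mem_equidistantSpace_optClass K x)) hv)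

lemma mem_of_optClass_add_eq {K : Set E} {x v : E} {H : Set E}
    (hH : H ⊆ optClass K x) (h : optClass K (x + v) = H) : v ∈ equidistantDirection H := by
  have h1 := equidistantSpace_anti hH (mem_equidistantSpace_optClass K x)
  have h2 := mem_equidistantSpace_optClass K (x + v)
  rw [h] at h2
  simpa using sub_mem_equidistantDirection h1 h2

/-- Every direction `w₀` at `x` has a conical neighborhood in which all optimality classes are
contained in the class `H` met in the direction `w₀` itself. The direction `0` is allowed. -/
lemma exists_conical_nhds {K : Set E} (hK : K.Finite) (hne : K.Nonempty) (x w₀ : E) {κ₀ : ℝ}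
    (hκ₀ : 0 < κ₀) : ∃ H ⊆ optClass K x, w₀ ∈ equidistantDirection H ∧
      ∃ κ, 0 < κ ∧ κ ≤ κ₀ ∧ ∃ τ₀ : ℝ, 0 < τ₀ ∧
        ∀ w, ‖w - w₀‖ ≤ κ → ∀ τ : ℝ, 0 < τ → τ ≤ τ₀ → optClass K (x + τ • w) ⊆ H := by
  obtain ⟨ρ, hρ, hball⟩ := Metric.eventually_nhds_iff_ball.1 (eventually_optClass_subset hK x)
  have hsub : ∀ v : E, ‖v‖ < ρ → optClass K (x + v) ⊆ optClass K x := fun v hv =>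
    hball _ (by simpa [Metric.mem_ball, dist_eq_norm] using hv)
  set s := ρ / (2 * (‖w₀‖ + 1)) with hs
  have hn := norm_nonneg w₀
  have hs0 : 0 < s := by positivity
  have hsw : ∀ w : E, ‖w - w₀‖ ≤ 1 → ∀ τ, 0 < τ → τ ≤ s → ‖τ • w‖ < ρ := by
    intro w hw τ hτ hτs
    have h1 : ‖w‖ ≤ ‖w₀‖ + 1 := by
      calc ‖w‖ = ‖(w - w₀) + w₀‖ := by congr 1; abel
        _ ≤ ‖w - w₀‖ + ‖w₀‖ := norm_add_le _ _
        _ ≤ ‖w₀‖ + 1 := by linarith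
    rw [norm_smul, Real.norm_of_nonneg hτ.le]
    calc τ * ‖w‖ ≤ s * (‖w₀‖ + 1) := by gcongr
      _ = ρ / 2 := by rw [hs]; field_simp
      _ < ρ := half_lt_self hρ
  have hw₀ := hsub _ (hsw w₀ (by simp) s hs0 le_rfl)
  obtain ⟨ρ', hρ', hball'⟩ :=
    Metric.eventually_nhds_iff_ball.1 (eventually_optClass_subset hK (x + s • w₀))
  refine ⟨optClass K (x + s • w₀), hw₀, ?_, min (min κ₀ 1) (ρ' / (2 * s)), by positivity,
    (min_le_left _ _).trans (min_le_left _ _), s, hs0, fun w hw τ hτ hτs => ?_⟩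
  · have := mem_of_optClass_add_eq hw₀ rfl
    have h2 := Submodule.smul_mem _ s⁻¹ this
    rwa [smul_smul, inv_mul_cancel₀ hs0.ne', one_smul] at h2
  · have hw1 : ‖w - w₀‖ ≤ 1 := hw.trans ((min_le_left _ _).trans (min_le_right _ _))
    have e : τ • w = (τ / s) • (s • w) := by rw [smul_smul, div_mul_cancel₀ _ hs0.ne']
    rw [e, optClass_add_smul hK hne (by positivity) (hsub _ (hsw w hw1 s hs0 le_rfl))
      (e ▸ hsub _ (hsw w hw1 τ hτ hτs))]
    refine hball' _ ?_
    rw [Metric.mem_ball, dist_eq_norm]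
    calc ‖x + s • w - (x + s • w₀)‖ = s * ‖w - w₀‖ := by
          rw [add_sub_add_left_eq_sub, ← smul_sub, norm_smul, Real.norm_of_nonneg hs0.le]
      _ ≤ s * (ρ' / (2 * s)) := by gcongr; exact hw.trans (min_le_right _ _)
      _ = ρ' / 2 := by field_simp
      _ < ρ' := half_lt_self hρ'

lemma almostConical_potential {K : Set E} (hK : K.Finite) (hne : K.Nonempty) {h : ℝ → ℝ}
    (hs : ContDiffOn ℝ ∞ h (Ici 0)) (x : E) : AlmostConical (potential K h) x := by
  obtain ⟨ρ, hρ, hball⟩ := Metric.eventually_nhds_iff_ball.1 (eventually_optClass_subset hK x)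
  have hsub : ∀ v : E, ‖v‖ < ρ → optClass K (x + v) ⊆ optClass K x := fun v hv =>
    hball _ (by simpa [Metric.mem_ball, dist_eq_norm] using hv)
  obtain ⟨C, hC, hlip⟩ := exists_potential_lipschitz hK hne hs (‖x‖ + ρ)
  refine ⟨ρ, hρ, C, hC, fun v hv s hs0 hs1 => ?_⟩
  have hsv : ‖s • v‖ ≤ ‖v‖ := by
    rw [norm_smul, Real.norm_of_nonneg hs0.le]
    exact mul_le_of_le_one_left (norm_nonneg _) hs1
  refine (hlip _ _ ?_ ?_ (optClass_add_smul hK hne hs0 (hsub v hv)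
    (hsub _ (hsv.trans_lt hv)))).trans ?_
  · exact (norm_add_le _ _).trans (by linarith)
  · exact (norm_add_le _ _).trans (by linarith)
  · gcongr
    rw [add_sub_add_left_eq_sub, show s • v - v = (s - 1) • v by module, norm_smul]
    refine mul_le_of_le_one_left (norm_nonneg _) ?_
    rw [Real.norm_eq_abs, abs_le]
    constructor <;> linarith

/-! ### Projecting the curve on a Voronoi cell -/

/-- The piecewise affine function that goes from `1` to `0` on `[s, s + l]`. -/
lemma ramp_spec (s l : ℝ) (hl : 0 < l) (κ : ℝ) (hκ : |κ| = 1) :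
    ∃ L : NNReal, (L : ℝ) = 1 / l ∧ LipschitzWith L fun t : ℝ => max 0 (1 - κ * (t - s) / l) := by
  have hl' : (0 : ℝ) ≤ 1 / l := by positivity
  refine ⟨Real.toNNReal (1 / l), Real.coe_toNNReal _ hl', ?_⟩
  have : LipschitzWith (Real.toNNReal (1 / l)) fun t : ℝ => 1 - κ * (t - s) / l := by
    refine LipschitzWith.of_dist_le_mul fun t u => ?_
    rw [Real.dist_eq, Real.dist_eq, Real.coe_toNNReal _ hl']
    have e : 1 - κ * (t - s) / l - (1 - κ * (u - s) / l) = κ * ((-1 / l) * (t - u)) := by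
      field_simp
      ring
    rw [e, abs_mul, hκ, one_mul, abs_mul, abs_div, abs_neg, abs_one, abs_of_pos hl]
  exact this.const_max 0

variable [FiniteDimensional ℝ E] [MeasurableSpace E] [BorelSpace E]

/-- Comparison with the orthogonal projection of the curve on `c 0 + L`, corrected near the
endpoints `s` and `r` by affine ramps of length `l` to recover the boundary values. -/
lemma LocMin.integral_le_projection {F : E → ℝ} (hF : IsPotential F) {c g : ℝ → E} {T ε : ℝ}
    (H : LocMin F c g 0 T ε) (L : Submodule ℝ E) {s r l : ℝ} (hs : 0 ≤ s) (hsr : s < r)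
    (hr : r ≤ T) (hl : 0 < l) (hlr : l ≤ r - s) (hclose : ∀ t ∈ Icc s r, ‖c t - c 0‖ ≤ ε / 3)
    (n : ℝ → E) (hn : ∀ t, n t = (c t - c 0) - L.starProjection (c t - c 0)) (c' : ℝ → E)
    (hc' : ∀ t, c' t = c 0 + L.starProjection (c t - c 0) + max 0 (1 - (t - s) / l) • n s
      + max 0 (1 - (r - t) / l) • n r) :
    ContinuousOn c' (Icc s r) ∧ (∀ t ∈ Icc s r, ‖c' t - c t‖ ≤ ε) ∧
      ∫ t in s..r, F (c t) ≤ (r - s) * ((‖n s‖ + ‖n r‖) / l) ^ 2 + ∫ t in s..r, F (c' t) := by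
  have Hsr := H.mono hs hsr.le hr
  set P := L.starProjection with hP
  have hnL : ∀ t, n t ∈ Lᗮ := fun t => by
    rw [hn]; exact Submodule.sub_starProjection_mem_orthogonal _
  have hnle : ∀ t, ‖n t‖ ≤ ‖c t - c 0‖ := fun t => by
    rw [hn]
    have := Submodule.norm_starProjection_apply_le Lᗮ (c t - c 0)
    rwa [Submodule.starProjection_orthogonal', sub_apply] at this
  obtain ⟨L₁, hL₁, hlip₁⟩ := ramp_spec s l hl 1 abs_one
  obtain ⟨L₂, hL₂, hlip₂⟩ := ramp_spec r l hl (-1) (by simp)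
  set φ : ℝ → ℝ := fun t => max 0 (1 - 1 * (t - s) / l) with hφ
  set ψ : ℝ → ℝ := fun t => max 0 (1 - -1 * (t - r) / l) with hψ
  have hc'' : c' = fun t => c 0 + P (c t - c 0) + φ t • n s + ψ t • n r := by
    ext1 t
    rw [hc' t, hφ, hψ]
    congr 4 <;> ring
  have hφac := (hlip₁.lipschitzOnWith (s := uIcc s r)).absolutelyContinuousOnInterval
  have hψac := (hlip₂.lipschitzOnWith (s := uIcc s r)).absolutelyContinuousOnInterval
  have hac : AbsolutelyContinuousOnInterval c' s r := by
    rw [hc'']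
    refine ((AbsolutelyContinuousOnInterval.fun_add (absolutelyContinuousOnInterval_const _ _ _)
      ?_).fun_add (hφac.fun_smul (absolutelyContinuousOnInterval_const _ _ _))).fun_add
      (hψac.fun_smul (absolutelyContinuousOnInterval_const _ _ _))
    exact P.lipschitz.comp_absolutelyContinuousOnInterval
      (Hsr.ac.fun_sub (absolutelyContinuousOnInterval_const _ _ _))
  have hcont : ContinuousOn c' (Icc s r) := by
    have := hac.continuousOn
    rwa [uIcc_of_le hsr.le] at this
  have hl1 : 1 ≤ (r - s) / l := by rwa [one_le_div hl]
  have hφs : φ s = 1 := by simp [hφ]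
  have hφr : φ r = 0 := by
    rw [hφ]
    exact max_eq_left (by rw [one_mul]; linarith)
  have hψr : ψ r = 1 := by simp [hψ]
  have hψs : ψ s = 0 := by
    rw [hψ]
    refine max_eq_left ?_
    have : -1 * (s - r) / l = (r - s) / l := by ring
    rw [this]
    linarith
  have hφ01 : ∀ t ∈ Icc s r, 0 ≤ φ t ∧ φ t ≤ 1 := fun t ht => by
    refine ⟨le_max_left _ _, max_le zero_le_one ?_⟩
    have : 0 ≤ 1 * (t - s) / l := div_nonneg (by linarith [ht.1]) hl.le
    linarith
  have hψ01 : ∀ t ∈ Icc s r, 0 ≤ ψ t ∧ ψ t ≤ 1 := fun t ht => by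
    refine ⟨le_max_left _ _, max_le zero_le_one ?_⟩
    have : 0 ≤ -1 * (t - r) / l := div_nonneg (by linarith [ht.2]) hl.le
    linarith
  have hclose' : ∀ t ∈ Icc s r, ‖c' t - c t‖ ≤ ε := by
    intro t ht
    have e : c' t - c t = (φ t • n s + ψ t • n r) - n t := by
      rw [hc'', hn t]
      module
    have h1 : ‖φ t • n s‖ ≤ ε / 3 := by
      rw [norm_smul, Real.norm_of_nonneg (hφ01 t ht).1]
      exact (mul_le_of_le_one_left (norm_nonneg _) (hφ01 t ht).2).trans
        ((hnle s).trans (hclose s ⟨le_rfl, hsr.le⟩))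
    have h2 : ‖ψ t • n r‖ ≤ ε / 3 := by
      rw [norm_smul, Real.norm_of_nonneg (hψ01 t ht).1]
      exact (mul_le_of_le_one_left (norm_nonneg _) (hψ01 t ht).2).trans
        ((hnle r).trans (hclose r ⟨hsr.le, le_rfl⟩))
    have h3 : ‖n t‖ ≤ ε / 3 := (hnle t).trans (hclose t ht)
    rw [e]
    calc ‖(φ t • n s + ψ t • n r) - n t‖ ≤ ‖φ t • n s + ψ t • n r‖ + ‖n t‖ := norm_sub_le _ _
      _ ≤ ‖φ t • n s‖ + ‖ψ t • n r‖ + ‖n t‖ := by gcongr; exact norm_add_le _ _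
      _ ≤ ε := by linarith
  refine ⟨hcont, hclose', ?_⟩
  set g' : ℝ → E := fun t => P (g t) + (deriv φ t • n s + deriv ψ t • n r) with hg'
  have hder : ∀ᵐ t, t ∈ Ioo s r → HasDerivAt c' (g' t) t := by
    filter_upwards [Hsr.hasDeriv, hφac.ae_differentiableAt, hψac.ae_differentiableAt]
      with t h1 h2 h3 hmem
    have hmem' : t ∈ uIcc s r := by
      rw [uIcc_of_le hsr.le]; exact Ioo_subset_Icc_self hmem
    have hp := P.hasFDerivAt.comp_hasDerivAt t ((h1 hmem).sub_const (c 0))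
    rw [hc'', hg']
    refine (((hp.const_add (c 0)).add ((h2 hmem').hasDerivAt.smul_const (n s))).add
      ((h3 hmem').hasDerivAt.smul_const (n r))).congr_deriv ?_
    module
  set q := ((‖n s‖ + ‖n r‖) / l) ^ 2 with hq
  have hle : ∀ t, ‖g' t‖ ^ 2 ≤ ‖g t‖ ^ 2 + q := by
    intro t
    have horth : inner ℝ (P (g t)) (deriv φ t • n s + deriv ψ t • n r) = (0 : ℝ) := by
      refine Submodule.inner_right_of_mem_orthogonal (K := L)
        (Submodule.starProjection_apply_mem _ _) ?_
      exact Submodule.add_mem _ (Submodule.smul_mem _ _ (hnL s)) (Submodule.smul_mem _ _ (hnL r))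
    rw [hg']
    simp only
    rw [norm_add_sq_real, horth]
    have h1 : ‖P (g t)‖ ^ 2 ≤ ‖g t‖ ^ 2 := by
      gcongr; exact Submodule.norm_starProjection_apply_le _ _
    have h2 : ‖deriv φ t • n s + deriv ψ t • n r‖ ≤ (‖n s‖ + ‖n r‖) / l := by
      have hd1 : ‖deriv φ t‖ ≤ 1 / l := hL₁ ▸ norm_deriv_le_of_lipschitz hlip₁
      have hd2 : ‖deriv ψ t‖ ≤ 1 / l := hL₂ ▸ norm_deriv_le_of_lipschitz hlip₂
      calc _ ≤ ‖deriv φ t • n s‖ + ‖deriv ψ t • n r‖ := norm_add_le _ _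
        _ ≤ 1 / l * ‖n s‖ + 1 / l * ‖n r‖ := by rw [norm_smul, norm_smul]; gcongr
        _ = _ := by ring
    have h3 : ‖deriv φ t • n s + deriv ψ t • n r‖ ^ 2 ≤ q := by rw [hq]; gcongr
    linarith
  have hg'meas : Measurable g' := by
    have h1 : Measurable fun t => P (g t) := P.continuous.measurable.comp H.meas
    exact h1.add (((measurable_deriv φ).smul_const _).add ((measurable_deriv ψ).smul_const _))
  have hg'int : IntervalIntegrable (fun t => ‖g' t‖ ^ 2) volume s r := by
    refine (Hsr.sqInt.add (intervalIntegrable_const (c := q))).mono_fun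
      (hg'meas.norm.pow_const 2).aestronglyMeasurable (Eventually.of_forall fun t => ?_)
    simp only
    rw [Real.norm_of_nonneg (sq_nonneg _), Real.norm_of_nonneg (by positivity)]
    exact hle t
  have hFc' : IntervalIntegrable (fun t => F (c' t)) volume s r :=
    hF.intervalIntegrable hac.continuousOn
  have hmin := Hsr.integral_le s r le_rfl hsr le_rfl c' g' hac
    (by rw [hc'']; simp only [hφs, hψs, hn s]; module)
    (by rw [hc'']; simp only [hφr, hψr, hn r]; module) hclose' hder hg'int
  have hmono : ∫ t in s..r, ‖g' t‖ ^ 2 ≤ (∫ t in s..r, ‖g t‖ ^ 2) + (r - s) * q := by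
    have := intervalIntegral.integral_mono_on hsr.le hg'int
      (Hsr.sqInt.add (intervalIntegrable_const (c := q))) fun t _ => hle t
    rwa [intervalIntegral.integral_add Hsr.sqInt intervalIntegrable_const,
      intervalIntegral.integral_const, smul_eq_mul] at this
  rw [intervalIntegral.integral_add Hsr.sqInt (hF.intervalIntegrable Hsr.ac.continuousOn),
    intervalIntegral.integral_add hg'int hFc'] at hmin
  linarith

end

noncomputable section

variable {E : Type*} [NormedAddCommGroup E] [InnerProductSpace ℝ E]
  [FiniteDimensional ℝ E] [MeasurableSpace E] [BorelSpace E]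

/-! ### Absence of shocks immediately after a given time -/

lemma isPotential_potential {K : Set E} (hK : K.Finite) (hne : K.Nonempty) {h : ℝ → ℝ}
    (h0 : ∀ u ∈ Ici (0 : ℝ), 0 ≤ h u) (hs : ContDiffOn ℝ ∞ h (Ici 0))
    (hm : StrictMonoOn h (Ici 0)) : IsPotential (potential K h) :=
  ⟨measurable_potential hK hne hs.continuousOn, potential_nonneg h0, exists_potential_le hK hne hm⟩

/-- If the class of a minimizing curve stays inside `H` on `[s, r]`, if projecting on the cell of `H`
is harmless there, and if the curve is in the cell of `H` at both times `s` and `r`, then it never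
leaves this cell in between: its projection would have a smaller potential. -/
lemma LocMin.optClass_eq_of_endpoints {K : Set E} {F : E → ℝ} (hF : IsPotential F)
    (hK : K.Finite) {c g : ℝ → E} {T ε : ℝ} (Hm : LocMin F c g 0 T ε) {H : Set E}
    {s r j : ℝ} (hs : 0 ≤ s) (hsr : s < r) (hr : r ≤ T) (hj : 0 < j)
    (hclose : ∀ t ∈ Icc s r, ‖c t - c 0‖ ≤ ε / 3)
    (hsub : ∀ t ∈ Icc s r, optClass K (c t) ⊆ H) (π : ℝ → E)
    (hπ : ∀ t, π t = c 0 + (equidistantDirection H).starProjection (c t - c 0))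
    (hjump : ∀ t ∈ Icc s r, optClass K (c t) ≠ H → F (π t) + j ≤ F (c t))
    (hπeq : ∀ t ∈ Icc s r, optClass K (c t) = H → π t = c t)
    (hes : optClass K (c s) = H) (her : optClass K (c r) = H) :
    ∀ t ∈ Icc s r, optClass K (c t) = H := by
  by_contra! hcon
  obtain ⟨t, ht, htH⟩ := hcon
  have hts : t ∈ Ioo s r := by
    refine ⟨lt_of_le_of_ne ht.1 ?_, lt_of_le_of_ne ht.2 ?_⟩
    · rintro rfl; exact htH hes
    · rintro rfl; exact htH her
  have Hsr := Hm.mono hs hsr.le hr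
  have hcont : ContinuousOn c (Icc s r) := by
    have := Hsr.ac.continuousOn
    rwa [uIcc_of_le hsr.le] at this
  have hev : ∀ᶠ u in 𝓝 t, optClass K (c u) ⊆ optClass K (c t) ∧ u ∈ Icc s r :=
    (((hcont t ht).continuousAt (Icc_mem_nhds hts.1 hts.2)).eventually
      (eventually_optClass_subset hK (c t))).and (Icc_mem_nhds hts.1 hts.2)
  obtain ⟨δ, hδ, hball⟩ := Metric.eventually_nhds_iff_ball.1 hev
  have hnear : ∀ u ∈ Icc (t - δ / 2) (t + δ / 2), optClass K (c u) ≠ H ∧ u ∈ Icc s r := by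
    intro u hu
    obtain ⟨h1, h2⟩ := hball u (by
      rw [Metric.mem_ball, Real.dist_eq, abs_lt]
      constructor <;> linarith [hu.1, hu.2])
    refine ⟨fun he => htH ((hsub t ht).antisymm ?_), h2⟩
    rw [← he]
    exact h1
  set L := equidistantDirection H with hL
  have hns : (c s - c 0) - L.starProjection (c s - c 0) = 0 := by
    have := hπeq s ⟨le_rfl, hsr.le⟩ hes
    rw [hπ] at this
    exact sub_eq_zero.2 (sub_eq_iff_eq_add'.2 this.symm)
  have hnr : (c r - c 0) - L.starProjection (c r - c 0) = 0 := by
    have := hπeq r ⟨hsr.le, le_rfl⟩ her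
    rw [hπ] at this
    exact sub_eq_zero.2 (sub_eq_iff_eq_add'.2 this.symm)
  obtain ⟨hπc, -, hle⟩ := Hm.integral_le_projection hF L hs hsr hr (sub_pos.2 hsr) le_rfl hclose
    (fun t => (c t - c 0) - L.starProjection (c t - c 0)) (fun _ => rfl) π (fun t => by
      simp only [hns, hnr]; rw [hπ]; simp)
  simp only [hns, hnr, norm_zero, add_zero, zero_div] at hle
  norm_num at hle
  have i1 := hF.intervalIntegrable Hsr.ac.continuousOn
  have i2 : IntervalIntegrable (fun t => F (π t)) volume s r :=
    hF.intervalIntegrable (by rwa [uIcc_of_le hsr.le])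
  have hnn : ∀ u ∈ Icc s r, 0 ≤ F (c u) - F (π u) := by
    intro u hu
    by_cases he : optClass K (c u) = H
    · rw [hπeq u hu he, sub_self]
    · linarith [hjump u hu he]
  have hp := (hnear (t - δ / 2) ⟨le_rfl, by linarith⟩).2
  have hq := (hnear (t + δ / 2) ⟨by linarith, le_rfl⟩).2
  have h1 : ∫ u in (t - δ / 2)..(t + δ / 2), (F (c u) - F (π u))
      ≤ ∫ u in s..r, (F (c u) - F (π u)) := by
    refine intervalIntegral.integral_mono_interval hp.1 (by linarith) hq.2 ?_ (i1.sub i2)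
    filter_upwards [ae_restrict_mem measurableSet_Ioc] with u hu
    exact hnn u (Ioc_subset_Icc_self hu)
  have hsub' : uIcc (t - δ / 2) (t + δ / 2) ⊆ uIcc s r := by
    rw [uIcc_of_le (by linarith), uIcc_of_le hsr.le]
    exact Icc_subset_Icc hp.1 hq.2
  have h2 : ∫ _ in (t - δ / 2)..(t + δ / 2), j
      ≤ ∫ u in (t - δ / 2)..(t + δ / 2), (F (c u) - F (π u)) := by
    refine intervalIntegral.integral_mono_on (by linarith) intervalIntegrable_const
      ((i1.sub i2).mono_set hsub') fun u hu => ?_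
    obtain ⟨h3, h4⟩ := hnear u hu
    linarith [hjump u h4 h3]
  rw [intervalIntegral.integral_const, smul_eq_mul] at h2
  have h3 : 0 < (t + δ / 2 - (t - δ / 2)) * j := by
    have : t + δ / 2 - (t - δ / 2) = δ := by ring
    rw [this]
    positivity
  have h4 := intervalIntegral.integral_sub i1 i2
  linarith

/-- A minimizing curve cannot stay away from the cell of `H` for a time `σ` if its distance from
this cell is small with respect to `σ`: reaching the cell costs a small kinetic energy, and lowers
the potential by `j`. -/
lemma LocMin.exists_optClass_eq {K : Set E} {F : E → ℝ} (hF : IsPotential F)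
    {c g : ℝ → E} {T ε : ℝ} (Hm : LocMin F c g 0 T ε) {H : Set E}
    {s σ j κ θ M : ℝ} (hs : 0 ≤ s) (hσ : 0 < σ) (hr : s + σ ≤ T) (hj : 0 < j)
    (hclose : ∀ t ∈ Icc s (s + σ), ‖c t - c 0‖ ≤ ε / 3)
    (hM : ∀ x, ‖x - c 0‖ ≤ 2 * ε → F x ≤ M) (hθ : 0 < θ) (hθ8 : θ ≤ 1 / 8)
    (hθM : θ * M ≤ j / 8) (hκ : 1024 * κ ^ 2 ≤ j * θ ^ 2) (π : ℝ → E)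
    (hπ : ∀ t, π t = c 0 + (equidistantDirection H).starProjection (c t - c 0))
    (hjump : ∀ t ∈ Icc s (s + σ), optClass K (c t) ≠ H → F (π t) + j ≤ F (c t))
    (hdist : ∀ t ∈ Icc s (s + σ), ‖c t - π t‖ ≤ 8 * κ * σ) :
    ∃ t ∈ Icc s (s + σ), optClass K (c t) = H := by
  by_contra! hcon
  set r := s + σ with hrdef
  have hsr : s < r := by linarith
  have Hsr := Hm.mono hs hsr.le hr
  set L := equidistantDirection H with hL
  set l := θ * σ with hl
  have hl0 : 0 < l := by positivity
  have hl8 : l ≤ σ / 8 := by rw [hl]; nlinarith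
  set n : ℝ → E := fun t => (c t - c 0) - L.starProjection (c t - c 0) with hn
  have hnπ : ∀ t, n t = c t - π t := fun t => by simp only [hπ, hn]; abel
  obtain ⟨hcc, hcl, hle⟩ := Hm.integral_le_projection hF L hs hsr hr hl0 (by linarith) hclose
    n (fun _ => rfl) (fun t => c 0 + L.starProjection (c t - c 0)
      + max 0 (1 - (t - s) / l) • n s + max 0 (1 - (r - t) / l) • n r) (fun _ => rfl)
  set c' : ℝ → E := fun t => c 0 + L.starProjection (c t - c 0)
      + max 0 (1 - (t - s) / l) • n s + max 0 (1 - (r - t) / l) • n r with hc'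
  have hε : 0 ≤ ε := by
    have := (norm_nonneg _).trans (hclose s ⟨le_rfl, hsr.le⟩)
    linarith
  have hcost : (r - s) * ((‖n s‖ + ‖n r‖) / l) ^ 2 ≤ σ * (j / 4) := by
    have h1 : ‖n s‖ ≤ 8 * κ * σ := hnπ s ▸ hdist s ⟨le_rfl, hsr.le⟩
    have h2 : ‖n r‖ ≤ 8 * κ * σ := hnπ r ▸ hdist r ⟨hsr.le, le_rfl⟩
    have h3 : (‖n s‖ + ‖n r‖) / l ≤ 16 * κ / θ := by
      rw [div_le_div_iff₀ hl0 hθ, hl]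
      nlinarith
    have h4 : ((‖n s‖ + ‖n r‖) / l) ^ 2 ≤ j / 4 := by
      calc ((‖n s‖ + ‖n r‖) / l) ^ 2 ≤ (16 * κ / θ) ^ 2 := by gcongr
        _ = 256 * κ ^ 2 / θ ^ 2 := by ring
        _ ≤ j / 4 := by
          rw [div_le_iff₀ (by positivity)]
          linarith
    have h5 : r - s = σ := by rw [hrdef]; ring
    rw [h5]
    gcongr
  have hrl : r - l ≤ r := by linarith
  have hsl : s ≤ s + l := by linarith
  have hmid : s + l ≤ r - l := by linarith
  have hFM : ∀ t ∈ Icc s r, F (c' t) ≤ M := by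
    intro t ht
    refine hM _ ?_
    calc ‖c' t - c 0‖ = ‖(c' t - c t) + (c t - c 0)‖ := by congr 1; abel
      _ ≤ ‖c' t - c t‖ + ‖c t - c 0‖ := norm_add_le _ _
      _ ≤ 2 * ε := by linarith [hcl t ht, hclose t ht]
  have i1 := hF.intervalIntegrable Hsr.ac.continuousOn
  have i2 : IntervalIntegrable (fun t => F (c' t)) volume s r :=
    hF.intervalIntegrable (by rwa [uIcc_of_le hsr.le])
  have i := i2.sub i1
  have hsubI : ∀ {p q : ℝ}, s ≤ p → p ≤ q → q ≤ r →
      IntervalIntegrable (fun t => F (c' t) - F (c t)) volume p q := by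
    intro p q h1 h2 h3
    refine i.mono_set ?_
    rw [uIcc_of_le h2, uIcc_of_le hsr.le]
    exact Icc_subset_Icc h1 h3
  have hends : ∀ {p q : ℝ}, s ≤ p → p ≤ q → q ≤ r → q - p = l →
      ∫ t in p..q, (F (c' t) - F (c t)) ≤ l * M := by
    intro p q h1 h2 h3 h4
    have := intervalIntegral.integral_mono_on h2 (hsubI h1 h2 h3)
      (intervalIntegrable_const (c := M)) fun t ht => by
        have h5 := hFM t ⟨h1.trans ht.1, ht.2.trans h3⟩
        have h6 := hF.nonneg (c t)
        linarith
    rwa [intervalIntegral.integral_const, smul_eq_mul, h4] at this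
  have hmiddle : ∫ t in (s + l)..(r - l), (F (c' t) - F (c t)) ≤ (σ - 2 * l) * (-j) := by
    have := intervalIntegral.integral_mono_on hmid (hsubI hsl hmid hrl)
      (intervalIntegrable_const (c := -j)) fun t ht => by
        have htm : t ∈ Icc s r := ⟨hsl.trans ht.1, ht.2.trans hrl⟩
        have h1 : max 0 (1 - (t - s) / l) = 0 := by
          refine max_eq_left ?_
          rw [sub_nonpos, one_le_div hl0]
          linarith [ht.1]
        have h2 : max 0 (1 - (r - t) / l) = 0 := by
          refine max_eq_left ?_
          rw [sub_nonpos, one_le_div hl0]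
          linarith [ht.2]
        have h3 : c' t = π t := by
          rw [hc', hπ]
          simp only [h1, h2, zero_smul, add_zero]
        have := hjump t htm (hcon t htm)
        rw [h3]
        linarith
    rw [intervalIntegral.integral_const, smul_eq_mul] at this
    have e : r - l - (s + l) = σ - 2 * l := by rw [hrdef]; ring
    rwa [e] at this
  have hA := hends le_rfl hsl (hmid.trans hrl) (by ring)
  have hB := hends (hsl.trans hmid) hrl le_rfl (by ring)
  have hsplit := intervalIntegral.integral_add_adjacent_intervals
    (hsubI le_rfl hsl (hmid.trans hrl)) (hsubI hsl hmid hrl)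
  have hsplit2 := intervalIntegral.integral_add_adjacent_intervals
    (hsubI le_rfl (hsl.trans hmid) hrl) (hsubI (hsl.trans hmid) hrl le_rfl)
  have hdiff := intervalIntegral.integral_sub i2 i1
  have hlM : l * M ≤ σ * (j / 8) := by
    have : l * M = σ * (θ * M) := by rw [hl]; ring
    rw [this]
    gcongr
  have hlj : l * j ≤ σ / 8 * j := by gcongr
  have hσj : 0 < σ * j := by positivity
  nlinarith

/-- After any time, the optimality class of a minimizing curve is locally constant for a while. -/
theorem LocMin.exists_eventually_optClass_eq {K : Set E} (hK : K.Finite) (hne : K.Nonempty)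
    (hb : IsBalanced K) {h : ℝ → ℝ} (h0 : ∀ u ∈ Ici (0 : ℝ), 0 ≤ h u)
    (hs : ContDiffOn ℝ ∞ h (Ici 0)) (hm : StrictMonoOn h (Ici 0)) {c g : ℝ → E} {T ε : ℝ}
    (hT : 0 < T) (hε : 0 < ε) (Hm : LocMin (potential K h) c g 0 T ε) :
    ∃ S, 0 < S ∧ S ≤ T ∧ ∀ t ∈ Ioo 0 S, ∀ᶠ u in 𝓝 t, optClass K (c u) = optClass K (c t) := by
  have hF := isPotential_potential hK hne h0 hs hm
  have hcone := almostConical_potential hK hne hs (c 0)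
  obtain ⟨C, hC, S₁, hS₁, hS₁T, hspeed⟩ := Hm.exists_norm_sub_le hF hT hε
  obtain ⟨j, hj, ρ, hρ, hjump⟩ := hb.exists_potential_jump hK hne hs.continuousOn hm (c 0)
  obtain ⟨M, hM⟩ := hF.bdd (‖c 0‖ + 2 * ε)
  have hM' : ∀ x, ‖x - c 0‖ ≤ 2 * ε → potential K h x ≤ M := fun x hx => hM x (by
    calc ‖x‖ = ‖c 0 + (x - c 0)‖ := by congr 1; abel
      _ ≤ ‖c 0‖ + ‖x - c 0‖ := norm_add_le _ _
      _ ≤ _ := by linarith)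
  have hM0 : 0 ≤ M := (hF.nonneg (c 0)).trans (hM' _ (by simpa using hε.le))
  -- `θ σ` is the length of the ramps and `κ₀ σ` the distance from the cell
  set θ := min (1 / 8) (j / (8 * (M + 1))) with hθ
  have hθ0 : 0 < θ := by positivity
  have hθM : θ * M ≤ j / 8 := by
    calc θ * M ≤ j / (8 * (M + 1)) * (M + 1) := by
          gcongr
          · exact min_le_right _ _
          · linarith
      _ = j / 8 := by field_simp
  set κ₀ := θ * min 1 j / 32 with hκ₀
  have hmin0 : 0 < min 1 j := lt_min one_pos hj
  have hκ₀0 : 0 < κ₀ := by positivity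
  have hκ₀θ : 1024 * κ₀ ^ 2 ≤ j * θ ^ 2 := by
    have h1 : min 1 j ^ 2 ≤ j := by
      calc min 1 j ^ 2 = min 1 j * min 1 j := pow_two _
        _ ≤ 1 * j := by gcongr <;> simp
        _ = j := one_mul j
    calc 1024 * κ₀ ^ 2 = min 1 j ^ 2 * θ ^ 2 := by rw [hκ₀]; ring
      _ ≤ j * θ ^ 2 := by gcongr
  -- finitely many conical neighborhoods cover all the rescaled positions
  choose Hc hHc hwH κ hκ hκκ₀ τ hτ hcov using
    fun w₀ : E => exists_conical_nhds hK hne (c 0) w₀ hκ₀0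
  obtain ⟨t, -, htcov⟩ := (isCompact_closedBall (0 : E) C).elim_nhds_subcover
    (fun w => Metric.ball w (κ w / 2)) fun w _ => Metric.ball_mem_nhds _ (half_pos (hκ w))
  have hsmall : ∀ᶠ x : ℝ in 𝓝[>] 0, ∀ w ∈ (t : Set E), x < κ w / 2 ∧ x < τ w := by
    rw [eventually_all_finite t.finite_toSet]
    intro w _
    filter_upwards [Ioo_mem_nhdsGT (half_pos (hκ w)), Ioo_mem_nhdsGT (hτ w)] with x h1 h2
    exact ⟨h1.2, h2.2⟩
  obtain ⟨x, hx, hx0⟩ := (hsmall.and self_mem_nhdsWithin).exists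
  have hx0' : 0 < x := mem_Ioi.1 hx0
  obtain ⟨S₂, hS₂, hS₂T, hosc⟩ := Hm.exists_oscillation_le hF hT hε hcone hx0'
  set m := min (ε / 3) (ρ / 2) with hmdef
  have hm0 : 0 < m := by positivity
  set S := min (min S₁ S₂) (min x (m / (C + 1))) with hSdef
  have hS0 : 0 < S := by positivity
  have hSS₁ : S ≤ S₁ := (min_le_left _ _).trans (min_le_left _ _)
  have hSS₂ : S ≤ S₂ := (min_le_left _ _).trans (min_le_right _ _)
  have hSx : S ≤ x := (min_le_right _ _).trans (min_le_left _ _)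
  have hSm : S ≤ m / (C + 1) := (min_le_right _ _).trans (min_le_right _ _)
  have hvm : ∀ u, 0 < u → u ≤ S → ‖c u - c 0‖ ≤ m := fun u hu huS => by
    calc ‖c u - c 0‖ ≤ C * u := hspeed u hu (huS.trans hSS₁)
      _ ≤ (C + 1) * (m / (C + 1)) := by
        gcongr
        · linarith
        · exact huS.trans hSm
      _ = m := by field_simp
  refine ⟨S / 8, by positivity, by linarith [hSS₁.trans hS₁T], fun t₁ ht₁ => ?_⟩
  set σ := t₁ / 3 with hσ
  have hσ0 : 0 < σ := by rw [hσ]; linarith [ht₁.1]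
  have hσS : 8 * σ ≤ S := by rw [hσ]; linarith [ht₁.2, ht₁.1]
  -- the conical neighborhood that contains the curve during `[σ, 8 σ]`
  have hw0 : σ⁻¹ • (c σ - c 0) ∈ Metric.closedBall (0 : E) C := by
    rw [mem_closedBall_zero_iff, norm_smul, norm_inv, Real.norm_of_nonneg hσ0.le,
      inv_mul_le_iff₀ hσ0, mul_comm]
    exact hspeed σ hσ0 (by linarith)
  obtain ⟨w, hwt, hw⟩ := mem_iUnion₂.1 (htcov hw0)
  rw [Metric.mem_ball, dist_eq_norm] at hw
  obtain ⟨hxκ, hxτ⟩ := hx w hwt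
  have hwu : ∀ u ∈ Icc σ (8 * σ), ‖u⁻¹ • (c u - c 0) - w‖ ≤ κ w := by
    intro u hu
    have h1 := hosc σ u hσ0 hu.1 hu.2 (by linarith [hu.2])
    calc ‖u⁻¹ • (c u - c 0) - w‖
        = ‖(u⁻¹ • (c u - c 0) - σ⁻¹ • (c σ - c 0)) + (σ⁻¹ • (c σ - c 0) - w)‖ := by
          congr 1; abel
      _ ≤ ‖u⁻¹ • (c u - c 0) - σ⁻¹ • (c σ - c 0)‖ + ‖σ⁻¹ • (c σ - c 0) - w‖ := norm_add_le _ _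
      _ ≤ κ w := by linarith
  set H := Hc w with hH
  set L := equidistantDirection H with hL
  set π : ℝ → E := fun u => c 0 + L.starProjection (c u - c 0) with hπ
  have hpos : ∀ u ∈ Icc σ (8 * σ), 0 < u := fun u hu => hσ0.trans_le hu.1
  have huS : ∀ u ∈ Icc σ (8 * σ), u ≤ S := fun u hu => hu.2.trans hσS
  have hcu : ∀ u ∈ Icc σ (8 * σ), c u = c 0 + u • (u⁻¹ • (c u - c 0)) := fun u hu => by
    rw [smul_smul, mul_inv_cancel₀ (hpos u hu).ne', one_smul]
    abel
  have hPw : L.starProjection w = w := Submodule.starProjection_eq_self_iff.2 (hwH w)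
  have hsub : ∀ u ∈ Icc σ (8 * σ), optClass K (c u) ⊆ H := fun u hu => by
    rw [hcu u hu]
    exact hcov w _ (hwu u hu) u (hpos u hu) (by linarith [huS u hu])
  have hπcell : ∀ u ∈ Icc σ (8 * σ), optClass K (π u) = H := fun u hu => by
    refine optClass_add_eq_of_mem hK hne (hHc w) ?_ (Submodule.starProjection_apply_mem _ _)
    have e : L.starProjection (c u - c 0) = u • L.starProjection (u⁻¹ • (c u - c 0)) := by
      rw [← map_smul, smul_smul, mul_inv_cancel₀ (hpos u hu).ne', one_smul]
    rw [e]
    refine hcov w _ ?_ u (hpos u hu) (by linarith [huS u hu])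
    calc ‖L.starProjection (u⁻¹ • (c u - c 0)) - w‖
        = ‖L.starProjection (u⁻¹ • (c u - c 0) - w)‖ := by rw [map_sub, hPw]
      _ ≤ ‖u⁻¹ • (c u - c 0) - w‖ := Submodule.norm_starProjection_apply_le _ _
      _ ≤ κ w := hwu u hu
  have hclose : ∀ u ∈ Icc σ (8 * σ), ‖c u - c 0‖ ≤ ε / 3 := fun u hu =>
    (hvm u (hpos u hu) (huS u hu)).trans (min_le_left _ _)
  have hjump' : ∀ u ∈ Icc σ (8 * σ), optClass K (c u) ≠ H →
      potential K h (π u) + j ≤ potential K h (c u) := by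
    intro u hu hne'
    have h1 : ‖c u - c 0‖ < ρ := ((hvm u (hpos u hu) (huS u hu)).trans
      (min_le_right _ _)).trans_lt (half_lt_self hρ)
    refine hjump _ (by rwa [Metric.mem_ball, dist_eq_norm]) _ ?_ ?_
    · rw [Metric.mem_ball, dist_eq_norm, hπ]
      simp only [add_sub_cancel_left]
      exact (Submodule.norm_starProjection_apply_le _ _).trans_lt h1
    · rw [hπcell u hu]
      exact (hsub u hu).ssubset_of_ne hne'
  have hπeq : ∀ u ∈ Icc σ (8 * σ), optClass K (c u) = H → π u = c u := by
    intro u hu he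
    have h1 : c u - c 0 ∈ L := mem_of_optClass_add_eq (K := K) (x := c 0) (hHc w) (by
      rw [add_sub_cancel]; exact he)
    simp only [hπ]
    rw [Submodule.starProjection_eq_self_iff.2 h1]
    abel
  have hdist : ∀ u ∈ Icc σ (8 * σ), ‖c u - π u‖ ≤ 8 * κ₀ * σ := by
    intro u hu
    have h1 : c u - π u = Lᗮ.starProjection (u • (u⁻¹ • (c u - c 0) - w)) := by
      have h2 : Lᗮ.starProjection w = 0 := by
        rw [Submodule.starProjection_orthogonal', sub_apply, hPw]; simp
      rw [smul_sub, map_sub, map_smul (Lᗮ.starProjection) u w, h2, smul_zero, sub_zero, smul_smul,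
        mul_inv_cancel₀ (hpos u hu).ne', one_smul, Submodule.starProjection_orthogonal', sub_apply]
      change c u - (c 0 + L.starProjection (c u - c 0))
        = (c u - c 0) - L.starProjection (c u - c 0)
      abel
    rw [h1]
    refine (Submodule.norm_starProjection_apply_le _ _).trans ?_
    rw [norm_smul, Real.norm_of_nonneg (hpos u hu).le]
    calc u * ‖u⁻¹ • (c u - c 0) - w‖ ≤ 8 * σ * κ₀ := by
          have := (hwu u hu).trans (hκκ₀ w)
          have := hu.2
          gcongr
      _ = 8 * κ₀ * σ := by ring
  -- the curve visits the cell both in `[σ, 2 σ]` and in `[7 σ, 8 σ]`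
  have hvisit : ∀ s, σ ≤ s → s + σ ≤ 8 * σ → ∃ u ∈ Icc s (s + σ), optClass K (c u) = H := by
    intro s h1 h2
    have hI : ∀ u ∈ Icc s (s + σ), u ∈ Icc σ (8 * σ) := fun u hu =>
      ⟨h1.trans hu.1, hu.2.trans h2⟩
    exact Hm.exists_optClass_eq hF (hσ0.le.trans h1) hσ0 (by linarith [hSS₁.trans hS₁T]) hj
      (fun u hu => hclose u (hI u hu)) hM' hθ0 (min_le_left _ _) hθM hκ₀θ π (fun _ => rfl)
      (fun u hu => hjump' u (hI u hu)) (fun u hu => hdist u (hI u hu))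
  obtain ⟨a, ha, haH⟩ := hvisit σ le_rfl (by linarith)
  obtain ⟨b, hb', hbH⟩ := hvisit (7 * σ) (by linarith) (by linarith)
  have hI : ∀ u ∈ Icc a b, u ∈ Icc σ (8 * σ) := fun u hu =>
    ⟨ha.1.trans hu.1, hu.2.trans (by linarith [hb'.2])⟩
  have hall := Hm.optClass_eq_of_endpoints hF hK (hσ0.le.trans ha.1) (by linarith [ha.2, hb'.1])
    (by linarith [hSS₁.trans hS₁T, hb'.2]) hj (fun u hu => hclose u (hI u hu))
    (fun u hu => hsub u (hI u hu)) π (fun _ => rfl) (fun u hu => hjump' u (hI u hu))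
    (fun u hu => hπeq u (hI u hu)) haH hbH
  have ht₁σ : t₁ = 3 * σ := by rw [hσ]; ring
  have hta : a < t₁ := by linarith [ha.2]
  have htb : t₁ < b := by linarith [hb'.1]
  filter_upwards [Icc_mem_nhds hta htb] with u hu
  rw [hall u hu, hall t₁ ⟨hta.le, htb.le⟩]

end

noncomputable section

variable {E : Type*} [NormedAddCommGroup E] [InnerProductSpace ℝ E]
  [FiniteDimensional ℝ E] [MeasurableSpace E] [BorelSpace E]

/-! ### Local minimizers of the action -/

/-- A curve on `[s, r]` with the endpoints of `c` is glued to `c` by adding to `c` their difference,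
evaluated at the projection of the time on `[s, r]`. -/
lemma glue_spec {c c' : ℝ → E} {s r : ℝ} (hsr : s < r) (hs : c' s = c s) (hr : c' r = c r) :
    ∃ G : ℝ → E, (∀ t, G t = c t + (c' (max s (min t r)) - c (max s (min t r)))) ∧
      (∀ t, t ≤ s → G t = c t) ∧ (∀ t, r ≤ t → G t = c t) ∧ ∀ t ∈ Icc s r, G t = c' t := by
  refine ⟨_, fun t => rfl, fun t ht => ?_, fun t ht => ?_, fun t ht => ?_⟩
  · simp only [max_eq_left ((min_le_left t r).trans ht), hs, sub_self, add_zero]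
  · simp only [min_eq_right ht, max_eq_right hsr.le, hr, sub_self, add_zero]
  · simp only [min_eq_left ht.2, max_eq_right ht.1, add_sub_cancel]

lemma action_eq {K : Set E} (hK : K.Finite) (hne : K.Nonempty) (h : ℝ → ℝ) {δ : ℝ} (hδ : 0 < δ)
    {x₀ x₁ : E} {γ : C(Icc (0 : ℝ) δ, E)}
    (hac : AbsolutelyContinuousOnInterval (IccExtend hδ.le γ) 0 δ)
    (h₀ : γ ⟨0, left_mem_Icc.2 hδ.le⟩ = x₀) (h₁ : γ ⟨δ, right_mem_Icc.2 hδ.le⟩ = x₁) :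
    action K h hδ x₀ x₁ γ = ∫⁻ t in Icc (0 : ℝ) δ,
      ENNReal.ofReal (‖deriv (IccExtend hδ.le γ) t‖ ^ 2 + potential K h (IccExtend hδ.le γ t)) := by
  have := FiniteDimensional.complete ℝ E
  rw [action, if_pos ⟨hac, h₀, h₁⟩]
  simp only [norm_extendedGradient hK hne]
  rfl

/-- Local minimizers of the action minimize the energy on all subintervals. -/
lemma IsLocalMinimizer.exists_locMin {K : Set E} (hK : K.Finite) (hne : K.Nonempty) {h : ℝ → ℝ}
    (hF : IsPotential (potential K h)) {δ : ℝ} (hδ : 0 < δ) {x₀ x₁ : E}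
    {γ : C(Icc (0 : ℝ) δ, E)} (hγ : IsLocalMinimizer K h hδ x₀ x₁ γ) :
    ∃ ε, 0 < ε ∧
      LocMin (potential K h) (IccExtend hδ.le γ) (deriv (IccExtend hδ.le γ)) 0 δ ε := by
  have := FiniteDimensional.complete ℝ E
  obtain ⟨hfin, hmin⟩ := hγ
  have hcond : AbsolutelyContinuousOnInterval (IccExtend hδ.le γ) 0 δ ∧
      γ ⟨0, left_mem_Icc.2 hδ.le⟩ = x₀ ∧ γ ⟨δ, right_mem_Icc.2 hδ.le⟩ = x₁ := by
    by_contra hcon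
    rw [action, if_neg hcon] at hfin
    exact lt_irrefl _ hfin
  obtain ⟨hac, h₀, h₁⟩ := hcond
  set c := IccExtend hδ.le γ with hc
  set F := potential K h with hFdef
  rw [action_eq hK hne h hδ hac h₀ h₁] at hfin
  have hmeas : Measurable (deriv c) := measurable_deriv c
  have hsq : IntervalIntegrable (fun t => ‖deriv c t‖ ^ 2) volume 0 δ := by
    rw [intervalIntegrable_iff_integrableOn_Icc_of_le hδ.le]
    refine ⟨(hmeas.norm.pow_const 2).aestronglyMeasurable, ?_⟩
    rw [hasFiniteIntegral_iff_ofReal (Eventually.of_forall fun t => sq_nonneg _)]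
    refine lt_of_le_of_lt (lintegral_mono fun t => ENNReal.ofReal_le_ofReal ?_) hfin
    linarith [hF.nonneg (c t)]
  obtain ⟨ε₀, hε₀, hball⟩ := Metric.eventually_nhds_iff_ball.1 hmin
  refine ⟨ε₀ / 2, by positivity, hac, ?_, hmeas, hsq, ?_⟩
  · filter_upwards [hac.ae_hasDerivAt_deriv] with t ht hmem
    exact ht (by rw [uIcc_of_le hδ.le]; exact Ioo_subset_Icc_self hmem)
  intro s r hs hsr hr c' g' hac' hs' hr' hclose hder hg'
  obtain ⟨G, hG, hGs, hGr, hGm⟩ := glue_spec hsr hs' hr'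
  have hclampmem : ∀ t : ℝ, max s (min t r) ∈ Icc s r := fun t =>
    ⟨le_max_left _ _, max_le hsr.le (min_le_right _ _)⟩
  have hsub : uIcc s r ⊆ uIcc 0 δ := by
    rw [uIcc_of_le hsr.le, uIcc_of_le hδ.le]
    exact Icc_subset_Icc hs hr
  have hclamp : LipschitzWith 1 fun t : ℝ => max s (min t r) :=
    (LipschitzWith.id.min_const r).const_max s
  have hclampm : Monotone fun t : ℝ => max s (min t r) := fun x y hxy =>
    max_le_max le_rfl (min_le_min hxy le_rfl)
  have hGac : AbsolutelyContinuousOnInterval G 0 δ := by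
    have h1 := (hac'.fun_sub (hac.mono hsub)).comp_monotone (a := 0) (b := δ) (Or.inl hclampm)
      hclamp (fun t _ => by rw [uIcc_of_le hsr.le]; exact hclampmem t)
    have h2 := hac.fun_add h1
    rwa [show G = fun t => c t + (c' (max s (min t r)) - c (max s (min t r))) from funext hG]
  have hGcont : ContinuousOn G (Icc 0 δ) := by
    have := hGac.continuousOn
    rwa [uIcc_of_le hδ.le] at this
  set γ' : C(Icc (0 : ℝ) δ, E) := ⟨fun t => G t, hGcont.domRestrict⟩ with hγ'
  have hγ'G : IccExtend hδ.le γ' = G := by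
    ext t
    rw [IccExtend, Function.comp_apply]
    change G (projIcc 0 δ hδ.le t) = G t
    rcases le_total t 0 with ht | ht
    · rw [projIcc_of_le_left _ ht, hGs _ hs, hGs _ (ht.trans hs), hc, IccExtend_of_le_left _ _ ht,
        IccExtend_left]
    rcases le_total t δ with ht' | ht'
    · rw [projIcc_of_mem _ ⟨ht, ht'⟩]
    · rw [projIcc_of_right_le _ ht', hGr _ hr, hGr _ (hr.trans ht'), hc,
        IccExtend_of_right_le _ _ ht', IccExtend_right]
  have hcγ : ∀ t : Icc (0 : ℝ) δ, c t = γ t := fun t => by rw [hc, IccExtend_val]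
  have hdist : γ' ∈ Metric.ball γ ε₀ := by
    rw [Metric.mem_ball]
    refine lt_of_le_of_lt ((ContinuousMap.dist_le (by positivity : 0 ≤ ε₀ / 2)).2 fun t => ?_)
      (half_lt_self hε₀)
    change dist (G t) (γ t) ≤ ε₀ / 2
    rw [← hcγ, dist_eq_norm, hG, add_sub_cancel_left]
    exact hclose _ (hclampmem t)
  have hle := hball γ' hdist
  have h₀' : γ' ⟨0, left_mem_Icc.2 hδ.le⟩ = x₀ := by
    change G 0 = x₀
    rw [hGs 0 hs, ← h₀]
    exact hcγ ⟨0, left_mem_Icc.2 hδ.le⟩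
  have h₁' : γ' ⟨δ, right_mem_Icc.2 hδ.le⟩ = x₁ := by
    change G δ = x₁
    rw [hGr δ hr, ← h₁]
    exact hcγ ⟨δ, right_mem_Icc.2 hδ.le⟩
  rw [action_eq hK hne h hδ hac h₀ h₁, action_eq hK hne h hδ (hγ'G ▸ hGac) h₀' h₁', hγ'G,
    ← lintegral_inter_add_sdiff _ (Icc (0 : ℝ) δ) (measurableSet_Ioc (a := s) (b := r)),
    ← lintegral_inter_add_sdiff _ (Icc (0 : ℝ) δ) (measurableSet_Ioc (a := s) (b := r))] at hle
  have hinter : Icc 0 δ ∩ Ioc s r = Ioc s r :=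
    inter_eq_right.2 (Ioc_subset_Icc_self.trans (Icc_subset_Icc hs hr))
  have hrest : ∫⁻ t in Icc (0 : ℝ) δ \ Ioc s r, ENNReal.ofReal (‖deriv G t‖ ^ 2 + F (G t))
      = ∫⁻ t in Icc (0 : ℝ) δ \ Ioc s r, ENNReal.ofReal (‖deriv c t‖ ^ 2 + F (c t)) := by
    refine setLIntegral_congr_fun_ae (measurableSet_Icc.diff measurableSet_Ioc) ?_
    filter_upwards [ae_ne s, ae_ne r] with t hts htr hmem
    have hev : G =ᶠ[𝓝 t] c := by
      rcases lt_or_gt_of_ne hts with hlt | hgt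
      · filter_upwards [Iio_mem_nhds hlt] with u hu
        exact hGs u (le_of_lt hu)
      · have : r < t := by
          by_contra hcon
          exact hmem.2 ⟨hgt, not_lt.1 hcon⟩
        filter_upwards [Ioi_mem_nhds this] with u hu
        exact hGr u (le_of_lt hu)
    rw [hev.deriv_eq, hev.eq_of_nhds]
  have hin : ∫⁻ t in Ioc s r, ENNReal.ofReal (‖deriv G t‖ ^ 2 + F (G t))
      = ∫⁻ t in Ioc s r, ENNReal.ofReal (‖g' t‖ ^ 2 + F (c' t)) := by
    refine setLIntegral_congr_fun_ae measurableSet_Ioc ?_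
    filter_upwards [hder, ae_ne r] with t ht htr hmem
    have hmem' : t ∈ Ioo s r := ⟨hmem.1, lt_of_le_of_ne hmem.2 htr⟩
    have hev : G =ᶠ[𝓝 t] c' := by
      filter_upwards [Icc_mem_nhds hmem'.1 hmem'.2] with u hu
      exact hGm u hu
    rw [hev.deriv_eq, hev.eq_of_nhds, (ht hmem').deriv]
  rw [hinter, hrest, hin] at hle
  have hfin' : ∫⁻ t in Icc (0 : ℝ) δ \ Ioc s r,
      ENNReal.ofReal (‖deriv c t‖ ^ 2 + F (c t)) ≠ ⊤ :=
    ((lintegral_mono_set sdiff_subset).trans_lt hfin).ne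
  have hle' := (ENNReal.add_le_add_iff_right hfin').1 hle
  have i1 : IntervalIntegrable (fun t => ‖deriv c t‖ ^ 2 + F (c t)) volume s r :=
    (hsq.mono_set hsub).add (hF.intervalIntegrable (hac.mono hsub).continuousOn)
  have i2 : IntervalIntegrable (fun t => ‖g' t‖ ^ 2 + F (c' t)) volume s r :=
    hg'.add (hF.intervalIntegrable hac'.continuousOn)
  have n1 : ∀ t, 0 ≤ ‖deriv c t‖ ^ 2 + F (c t) := fun t => add_nonneg (sq_nonneg _) (hF.nonneg _)
  have n2 : ∀ t, 0 ≤ ‖g' t‖ ^ 2 + F (c' t) := fun t => add_nonneg (sq_nonneg _) (hF.nonneg _)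
  rw [← ofReal_integral_eq_lintegral_ofReal
      ((intervalIntegrable_iff_integrableOn_Ioc_of_le hsr.le).1 i1) (Eventually.of_forall n1),
    ← ofReal_integral_eq_lintegral_ofReal
      ((intervalIntegrable_iff_integrableOn_Ioc_of_le hsr.le).1 i2) (Eventually.of_forall n2),
    ENNReal.ofReal_le_ofReal_iff (integral_nonneg n2)] at hle'
  rwa [intervalIntegral.integral_of_le hsr.le, intervalIntegral.integral_of_le hsr.le]

/-! ### Translation and reversal of time -/

lemma lipschitzWith_add_right (d : ℝ) : LipschitzWith 1 fun t : ℝ => t + d :=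
  (isometry_add_right d).lipschitz

lemma ae_comp_add {P : ℝ → Prop} (h : ∀ᵐ t, P t) (d : ℝ) : ∀ᵐ t, P (t + d) :=
  (measurePreserving_add_right (volume : Measure ℝ) d).quasiMeasurePreserving.ae h

lemma ae_comp_neg {P : ℝ → Prop} (h : ∀ᵐ t, P t) : ∀ᵐ t, P (-t) :=
  (Measure.measurePreserving_neg (volume : Measure ℝ)).quasiMeasurePreserving.ae h

lemma LocMin.comp_add {F : E → ℝ} {c g : ℝ → E} {a b ε : ℝ} (H : LocMin F c g a b ε) (d : ℝ)
    (hab : a ≤ b) :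
    LocMin F (fun t => c (t + d)) (fun t => g (t + d)) (a - d) (b - d) ε := by
  refine ⟨?_, ?_, H.meas.comp (measurable_add_const d), ?_, ?_⟩
  · refine H.ac.comp_monotone (Or.inl fun x y hxy => by simpa using hxy)
      (lipschitzWith_add_right d) fun t ht => ?_
    rw [uIcc_of_le hab]
    rw [uIcc_of_le (by linarith)] at ht
    exact ⟨by linarith [ht.1], by linarith [ht.2]⟩
  · filter_upwards [ae_comp_add H.hasDeriv d] with t ht hmem
    exact (ht ⟨by linarith [hmem.1], by linarith [hmem.2]⟩).comp_add_const t d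
  · exact H.sqInt.comp_add_right d
  · intro s r hs hsr hr c' g' hac hs' hr' hclose hder hg'
    have hac' : AbsolutelyContinuousOnInterval (fun t => c' (t + -d)) (s + d) (r + d) := by
      refine hac.comp_monotone (Or.inl fun x y hxy => by simpa using hxy)
        (lipschitzWith_add_right (-d)) fun t ht => ?_
      rw [uIcc_of_le hsr.le]
      rw [uIcc_of_le (by linarith)] at ht
      exact ⟨by linarith [ht.1], by linarith [ht.2]⟩
    have hi : IntervalIntegrable (fun t => ‖g' (t + -d)‖ ^ 2) volume (s + d) (r + d) := by
      simpa using hg'.comp_add_right (-d)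
    have hd : ∀ᵐ t, t ∈ Ioo (s + d) (r + d) →
        HasDerivAt (fun t => c' (t + -d)) (g' (t + -d)) t := by
      filter_upwards [ae_comp_add hder (-d)] with t ht hmem
      exact (ht ⟨by linarith [hmem.1], by linarith [hmem.2]⟩).comp_add_const t (-d)
    have := H.integral_le (s + d) (r + d) (by linarith) (by linarith) (by linarith)
      (fun t => c' (t + -d)) (fun t => g' (t + -d)) hac' (by simpa using hs') (by simpa using hr')
      (fun t ht => by
        have := hclose (t + -d) ⟨by linarith [ht.1], by linarith [ht.2]⟩
        simpa using this) hd hi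
    rw [intervalIntegral.integral_comp_add_right (fun t => ‖g t‖ ^ 2 + F (c t))]
    refine this.trans_eq ?_
    rw [intervalIntegral.integral_comp_add_right (fun t => ‖g' t‖ ^ 2 + F (c' t))]
    simp

lemma LocMin.comp_neg {F : E → ℝ} {c g : ℝ → E} {a b ε : ℝ} (H : LocMin F c g a b ε)
    (hab : a ≤ b) : LocMin F (fun t => c (-t)) (fun t => -g (-t)) (-b) (-a) ε := by
  have hneg : LipschitzWith 1 fun t : ℝ => -t := LipschitzWith.id.neg
  have hanti : Antitone fun t : ℝ => -t := fun x y hxy => neg_le_neg hxy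
  refine ⟨?_, ?_, (H.meas.comp measurable_neg).neg, ?_, ?_⟩
  · refine H.ac.comp_monotone (Or.inr hanti) hneg fun t ht => ?_
    rw [uIcc_of_le hab]
    rw [uIcc_of_le (by linarith)] at ht
    exact ⟨by linarith [ht.2], by linarith [ht.1]⟩
  · filter_upwards [ae_comp_neg H.hasDeriv] with t ht hmem
    have := (ht ⟨by linarith [hmem.2], by linarith [hmem.1]⟩).scomp t (hasDerivAt_neg t)
    simpa [Function.comp_def] using this
  · simp only [norm_neg]
    exact ((IntervalIntegrable.iff_comp_neg (by simp)).1 H.sqInt).symm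
  · intro s r hs hsr hr c' g' hac hs' hr' hclose hder hg'
    have hac' : AbsolutelyContinuousOnInterval (fun t => c' (-t)) (-r) (-s) := by
      refine hac.comp_monotone (Or.inr hanti) hneg fun t ht => ?_
      rw [uIcc_of_le hsr.le]
      rw [uIcc_of_le (by linarith)] at ht
      exact ⟨by linarith [ht.2], by linarith [ht.1]⟩
    have hi : IntervalIntegrable (fun t => ‖-g' (-t)‖ ^ 2) volume (-r) (-s) := by
      simp only [norm_neg]
      exact ((IntervalIntegrable.iff_comp_neg (by simp)).1 hg').symm
    have hd : ∀ᵐ t, t ∈ Ioo (-r) (-s) → HasDerivAt (fun t => c' (-t)) (-g' (-t)) t := by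
      filter_upwards [ae_comp_neg hder] with t ht hmem
      have := (ht ⟨by linarith [hmem.2], by linarith [hmem.1]⟩).scomp t (hasDerivAt_neg t)
      simpa [Function.comp_def] using this
    have := H.integral_le (-r) (-s) (by linarith) (by linarith) (by linarith)
      (fun t => c' (-t)) (fun t => -g' (-t)) hac' (by simpa using hr') (by simpa using hs')
      (fun t ht => by
        have := hclose (-t) ⟨by linarith [ht.2], by linarith [ht.1]⟩
        simpa using this) hd hi
    simp only [norm_neg] at this ⊢
    rw [intervalIntegral.integral_comp_neg (fun t => ‖g t‖ ^ 2 + F (c t))]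
    refine this.trans_eq ?_
    rw [intervalIntegral.integral_comp_neg (fun t => ‖g' t‖ ^ 2 + F (c' t))]
    simp

end

noncomputable section

variable {E : Type*} [NormedAddCommGroup E] [InnerProductSpace ℝ E]
  [FiniteDimensional ℝ E] [MeasurableSpace E] [BorelSpace E]

/-! ### Shock times are isolated -/

/-- Every time of the interval has a neighborhood in which it is the only possible shock time. -/
lemma LocMin.eventually_ne_imp {K : Set E} (hK : K.Finite) (hne : K.Nonempty)
    (hb : IsBalanced K) {h : ℝ → ℝ} (h0 : ∀ u ∈ Ici (0 : ℝ), 0 ≤ h u)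
    (hs : ContDiffOn ℝ ∞ h (Ici 0)) (hm : StrictMonoOn h (Ici 0)) {c g : ℝ → E} {δ ε : ℝ}
    (hε : 0 < ε) (Hm : LocMin (potential K h) c g 0 δ ε) {t₀ : ℝ} (ht₀ : t₀ ∈ Icc 0 δ) :
    ∀ᶠ t in 𝓝 t₀, t ∈ Icc 0 δ → t ≠ t₀ → ∀ᶠ u in 𝓝 t, optClass K (c u) = optClass K (c t) := by
  have hright : ∃ S, 0 < S ∧ ∀ t ∈ Icc 0 δ, t₀ < t → t < t₀ + S →
      ∀ᶠ u in 𝓝 t, optClass K (c u) = optClass K (c t) := by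
    rcases ht₀.2.eq_or_lt with rfl | hlt
    · exact ⟨1, one_pos, fun t ht h1 _ => absurd ht.2 (not_le.2 h1)⟩
    have H1 := (Hm.mono ht₀.1 ht₀.2 le_rfl).comp_add t₀ ht₀.2
    rw [sub_self] at H1
    obtain ⟨S, hS, -, hloc⟩ :=
      H1.exists_eventually_optClass_eq hK hne hb h0 hs hm (sub_pos.2 hlt) hε
    refine ⟨S, hS, fun t _ h1 h2 => ?_⟩
    have h3 := hloc (t - t₀) ⟨by linarith, by linarith⟩
    have hc : Tendsto (fun u : ℝ => u - t₀) (𝓝 t) (𝓝 (t - t₀)) :=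
      (continuous_sub_right t₀).tendsto t
    filter_upwards [hc.eventually h3] with u hu
    simpa using hu
  have hleft : ∃ S, 0 < S ∧ ∀ t ∈ Icc 0 δ, t < t₀ → t₀ - S < t →
      ∀ᶠ u in 𝓝 t, optClass K (c u) = optClass K (c t) := by
    rcases ht₀.1.eq_or_lt with rfl | hlt
    · exact ⟨1, one_pos, fun t ht h1 _ => absurd ht.1 (not_le.2 h1)⟩
    have H1 := ((Hm.mono le_rfl ht₀.1 ht₀.2).comp_neg ht₀.1).comp_add (-t₀) (by linarith [ht₀.1])
    rw [sub_self] at H1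
    obtain ⟨S, hS, -, hloc⟩ :=
      H1.exists_eventually_optClass_eq hK hne hb h0 hs hm (by linarith) hε
    refine ⟨S, hS, fun t _ h1 h2 => ?_⟩
    have h3 := hloc (t₀ - t) ⟨by linarith, by linarith⟩
    have hc : Tendsto (fun u : ℝ => t₀ - u) (𝓝 t) (𝓝 (t₀ - t)) :=
      (continuous_sub_left t₀).tendsto t
    filter_upwards [hc.eventually h3] with u hu
    simpa using hu
  obtain ⟨S₁, hS₁, h1⟩ := hright
  obtain ⟨S₂, hS₂, h2⟩ := hleft
  filter_upwards [Ioo_mem_nhds (show t₀ - S₂ < t₀ by linarith) (show t₀ < t₀ + S₁ by linarith)]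
    with t ht hmem hne'
  rcases lt_or_gt_of_ne hne' with hlt | hgt
  · exact h2 t hmem hlt ht.1
  · exact h1 t hmem hgt ht.2

lemma notMem_shockTimes_iff {K : Set E} {δ : ℝ} {γ : C(Icc (0 : ℝ) δ, E)} {t : Icc (0 : ℝ) δ} :
    t ∉ shockTimes K γ ↔ ∀ᶠ s in 𝓝 t, optClass K (γ s) = optClass K (γ t) := by
  constructor
  · intro h
    by_contra hcon
    refine h fun I hI hconst => hcon ?_
    filter_upwards [hI] with s hs
    exact hconst s hs t (mem_of_mem_nhds hI)
  · intro h hcon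
    exact hcon _ h fun s hs r hr => Eq.trans hs (Eq.symm hr)

lemma finite_of_locally_subsingleton {X : Type*} [TopologicalSpace X] [CompactSpace X] {S : Set X}
    (h : ∀ x, ∀ᶠ y in 𝓝 x, y ≠ x → y ∉ S) : S.Finite := by
  obtain ⟨t, -, ht⟩ := isCompact_univ.elim_nhds_subcover
    (fun x => {y | y ≠ x → y ∉ S}) fun x _ => h x
  refine t.finite_toSet.subset fun y hy => ?_
  obtain ⟨x, hx, hyx⟩ := mem_iUnion₂.1 (ht (mem_univ y))
  by_cases hxy : y = x
  · rw [hxy]; exact hx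
  · exact absurd hy (hyx hxy)

lemma IsPreconnected.eq_of_eventually_eq {X Y : Type*} [TopologicalSpace X] {A : Set X}
    (hA : IsPreconnected A) {f : X → Y} (h : ∀ x ∈ A, ∀ᶠ y in 𝓝 x, f y = f x) {x y : X}
    (hx : x ∈ A) (hy : y ∈ A) : f x = f y := by
  have : PreconnectedSpace A := Subtype.preconnectedSpace hA
  have hl : IsLocallyConstant fun a : A => f a := by
    rw [IsLocallyConstant.iff_eventually_eq]
    intro a
    exact (continuous_subtype_val.tendsto a).eventually (h a a.2)
  exact hl.apply_eq_of_preconnectedSpace ⟨x, hx⟩ ⟨y, hy⟩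

/-! ### Balanced cells: center, projection, potential -/

lemma inner_eq_zero_of_mem_vectorSpan {H : Set E} {y w : E} (hy : y ∈ equidistantDirection H)
    (hw : w ∈ vectorSpan ℝ H) : inner ℝ y w = (0 : ℝ) := by
  rw [vectorSpan_def] at hw
  induction hw using Submodule.span_induction with
  | mem x hx =>
    obtain ⟨p, hp, q, hq, rfl⟩ := Set.mem_vsub.1 hx
    exact hy p hp q hq
  | zero => exact inner_zero_right _
  | add a b _ _ ha hb => rw [inner_add_right, ha, hb, add_zero]
  | smul r a _ ha => rw [inner_smul_right, ha, mul_zero]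

/-- The affine span of `H` meets the space of equidistant points, if the latter is nonempty, in
exactly one point, the circumcenter of `H`. -/
lemma exists_affineSpan_inter_equidistantSpace {H : Set E} (hne : H.Nonempty) {z : E}
    (hz : z ∈ equidistantSpace H) :
    ∃ p, (affineSpan ℝ H : Set E) ∩ equidistantSpace H = {p} := by
  obtain ⟨q, hq⟩ := hne
  set W := vectorSpan ℝ H with hW
  set p := q + W.starProjection (z - q) with hp
  have hpa : p ∈ affineSpan ℝ H := by
    have h1 : W.starProjection (z - q) ∈ (affineSpan ℝ H).direction := by
      rw [direction_affineSpan]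
      exact Submodule.starProjection_apply_mem _ _
    have h2 := AffineSubspace.vadd_mem_of_mem_direction h1 (mem_affineSpan ℝ hq)
    rwa [vadd_eq_add, add_comm] at h2
  have hpe : p ∈ equidistantSpace H := by
    have h1 : p - z ∈ equidistantDirection H := by
      intro a ha b hb
      have h2 : p - z = -((z - q) - W.starProjection (z - q)) := by rw [hp]; abel
      rw [h2, inner_neg_left, neg_eq_zero]
      exact Submodule.inner_left_of_mem_orthogonal (K := W) (vsub_mem_vectorSpan ℝ ha hb)
        (Submodule.sub_starProjection_mem_orthogonal _)
    have h3 := add_mem_equidistantSpace hz h1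
    rwa [add_sub_cancel] at h3
  refine ⟨p, Set.eq_singleton_iff_unique_mem.2 ⟨⟨hpa, hpe⟩, ?_⟩⟩
  rintro p' ⟨hpa', hpe'⟩
  have h1 : p' - p ∈ vectorSpan ℝ H := by
    rw [← direction_affineSpan]
    exact AffineSubspace.vsub_mem_direction hpa' hpa
  have h2 := inner_eq_zero_of_mem_vectorSpan (sub_mem_equidistantDirection hpe hpe') h1
  rwa [inner_self_eq_zero, sub_eq_zero] at h2

lemma potential_eq_of_etaMap {K : Set E} (hK : K.Finite) (hne : K.Nonempty) (h : ℝ → ℝ) {x η : E}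
    (hη : etaMap K x = η) : potential K h x = h (‖x - η‖ ^ 2) := by
  rw [potential, hullDist, ← hη, etaMap, norm_sub_nearestPoint
    ((optClass_finite hK x).isCompact_convexHull ℝ)
    (convexHull_nonempty_iff.2 (optClass_nonempty hK hne x))]

lemma etaMap_mem_affineSpan {K : Set E} (hK : K.Finite) (hne : K.Nonempty) (x : E) :
    etaMap K x ∈ affineSpan ℝ (optClass K x) :=
  convexHull_subset_affineSpan _ (nearestPoint_spec
    ((optClass_finite hK x).isCompact_convexHull ℝ)
    (convexHull_nonempty_iff.2 (optClass_nonempty hK hne x)) x).1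

/-- Near a compact part of the cell of `H`, the cell is a neighborhood in the affine space of the
points that are equidistant from `H`. -/
lemma exists_optClass_add_eq {K : Set E} (hK : K.Finite) (hne : K.Nonempty) {H : Set E}
    {C : Set E} (hC : IsCompact C) (hCH : ∀ x ∈ C, optClass K x = H) :
    ∃ ρ > 0, ∀ x ∈ C, ∀ v ∈ equidistantDirection H, ‖v‖ < ρ → optClass K (x + v) = H := by
  have hopen : IsOpen {x | optClass K x ⊆ H} := by
    rw [isOpen_iff_mem_nhds]
    intro x hx
    filter_upwards [eventually_optClass_subset hK x] with y hy
    exact hy.trans hx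
  obtain ⟨ρ, hρ, hsub⟩ := hC.exists_thickening_subset_open hopen fun x hx => (hCH x hx).le
  refine ⟨ρ, hρ, fun x hx v hv hvρ => ?_⟩
  have h1 : x + v ∈ Metric.thickening ρ C := by
    refine Metric.mem_thickening_iff.2 ⟨x, hx, ?_⟩
    simpa [dist_eq_norm] using hvρ
  exact optClass_add_eq_of_mem hK hne (hCH x hx).ge (hsub h1) hv

end

noncomputable section

variable {E : Type*} [NormedAddCommGroup E] [InnerProductSpace ℝ E]
  [FiniteDimensional ℝ E] [MeasurableSpace E] [BorelSpace E]

/-! ### The Euler–Lagrange equation -/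

lemma intervalIntegrable_inner_of_norm_sq {f g : ℝ → E} {a b : ℝ} (hf : Measurable f)
    (hg : Measurable g) (hf2 : IntervalIntegrable (fun t => ‖f t‖ ^ 2) volume a b)
    (hg2 : IntervalIntegrable (fun t => ‖g t‖ ^ 2) volume a b) :
    IntervalIntegrable (fun t => (inner ℝ (f t) (g t) : ℝ)) volume a b := by
  refine (hf2.add hg2).mono_fun (hf.inner hg).aestronglyMeasurable ?_
  refine Eventually.of_forall fun t => ?_
  have h1 := abs_real_inner_le_norm (f t) (g t)
  have h2 : 0 ≤ ‖f t‖ ^ 2 + ‖g t‖ ^ 2 := by positivity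
  simp only [Real.norm_eq_abs, abs_of_nonneg h2]
  nlinarith [sq_nonneg (‖f t‖ - ‖g t‖), sq_nonneg (‖f t‖ + ‖g t‖)]

lemma intervalIntegrable_norm_sub_sq {f g : ℝ → E} {a b : ℝ} (hf : Measurable f)
    (hg : Measurable g) (hf2 : IntervalIntegrable (fun t => ‖f t‖ ^ 2) volume a b)
    (hg2 : IntervalIntegrable (fun t => ‖g t‖ ^ 2) volume a b) :
    IntervalIntegrable (fun t => ‖f t - g t‖ ^ 2) volume a b := by
  have h := (hf2.sub ((intervalIntegrable_inner_of_norm_sq hf hg hf2 hg2).const_mul 2)).add hg2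
  refine h.congr fun t _ => ?_
  exact (norm_sub_sq_real _ _).symm

lemma hasDerivAt_integral_comp_add_smul {V : E → ℝ} (hV : ContDiff ℝ 1 V) {c φ : ℝ → E}
    (hc : Continuous c) (hφ : Continuous φ) (a b : ℝ) :
    IntervalIntegrable (fun t => fderiv ℝ V (c t) (φ t)) volume a b ∧
    HasDerivAt (fun s : ℝ => ∫ t in a..b, V (c t + s • φ t))
      (∫ t in a..b, fderiv ℝ V (c t) (φ t)) 0 := by
  have hcont : Continuous fun p : ℝ × ℝ => fderiv ℝ V (c p.2 + p.1 • φ p.2) (φ p.2) := by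
    have h1 : Continuous fun p : ℝ × ℝ => fderiv ℝ V (c p.2 + p.1 • φ p.2) :=
      (hV.continuous_fderiv one_ne_zero).comp (by fun_prop)
    exact h1.clm_apply (by fun_prop)
  obtain ⟨M, hM⟩ := ((isCompact_Icc (a := (-1 : ℝ)) (b := 1)).prod
    (isCompact_uIcc (a := a) (b := b))).exists_bound_of_continuousOn hcont.continuousOn
  have key := intervalIntegral.hasDerivAt_integral_of_dominated_loc_of_deriv_le (μ := volume)
    (a := a) (b := b) (F := fun s t => V (c t + s • φ t))
    (F' := fun s t => fderiv ℝ V (c t + s • φ t) (φ t)) (x₀ := (0 : ℝ)) (bound := fun _ => M)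
    (Icc_mem_nhds (show (-1 : ℝ) < 0 by norm_num) one_pos)
    (Eventually.of_forall fun s => (hV.continuous.comp
      (by fun_prop : Continuous fun t => c t + s • φ t)).aestronglyMeasurable)
    ((hV.continuous.comp
      (by fun_prop : Continuous fun t => c t + (0 : ℝ) • φ t)).intervalIntegrable _ _)
    (hcont.comp (by fun_prop : Continuous fun t : ℝ => ((0 : ℝ), t))).aestronglyMeasurable
    (Eventually.of_forall fun t ht s hs => hM (s, t) ⟨hs, uIoc_subset_uIcc ht⟩)
    intervalIntegrable_const
    (Eventually.of_forall fun t _ s _ => by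
      have h1 := (hV.differentiable one_ne_zero (c t + s • φ t)).hasFDerivAt
      have h2 : HasDerivAt (fun s : ℝ => c t + s • φ t) (φ t) s := by
        simpa using ((hasDerivAt_id s).smul_const (φ t)).const_add (c t)
      exact h1.comp_hasDerivAt s h2)
  simpa using key

/-- The first variation of the energy vanishes along variations in whose directions the potential
coincides with a `C¹` function. -/
lemma LocMin.firstVariation_eq_zero {F V : E → ℝ} {c g φ ψ : ℝ → E} {a b ε ρ : ℝ}
    (H : LocMin F c g a b ε) (hab : a < b) (hε : 0 < ε) (hρ : 0 < ρ) (hV : ContDiff ℝ 1 V)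
    (hc : Continuous c) (hφ : Continuous φ) (hφac : AbsolutelyContinuousOnInterval φ a b)
    (hφa : φ a = 0) (hφb : φ b = 0) (hψ : ∀ᵐ t, t ∈ Ioo a b → HasDerivAt φ (ψ t) t)
    (hψm : Measurable ψ) (hψ2 : IntervalIntegrable (fun t => ‖ψ t‖ ^ 2) volume a b)
    (hFV : ∀ s : ℝ, |s| < ρ → ∀ t ∈ Icc a b, F (c t + s • φ t) = V (c t + s • φ t)) :
    2 * (∫ t in a..b, (inner ℝ (g t) (ψ t) : ℝ)) + ∫ t in a..b, fderiv ℝ V (c t) (φ t) = 0 := by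
  obtain ⟨B, hB⟩ := (isCompact_Icc (a := a) (b := b)).exists_bound_of_continuousOn hφ.continuousOn
  have hB0 : 0 ≤ B := (norm_nonneg _).trans (hB a (left_mem_Icc.2 hab.le))
  have hinner := intervalIntegrable_inner_of_norm_sq H.meas hψm H.sqInt hψ2
  have hVint : ∀ s : ℝ, IntervalIntegrable (fun t => V (c t + s • φ t)) volume a b := fun s =>
    (hV.continuous.comp (by fun_prop : Continuous fun t => c t + s • φ t)).intervalIntegrable _ _
  set A := ∫ t in a..b, (inner ℝ (g t) (ψ t) : ℝ) with hA
  set D := ∫ t in a..b, ‖ψ t‖ ^ 2 with hD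
  set W : ℝ → ℝ := fun s => ∫ t in a..b, V (c t + s • φ t) with hW
  have hexp : ∀ s : ℝ, (fun t => ‖g t + s • ψ t‖ ^ 2)
      = fun t => ‖g t‖ ^ 2 + 2 * s * inner ℝ (g t) (ψ t) + s ^ 2 * ‖ψ t‖ ^ 2 := by
    intro s; ext t
    rw [norm_add_sq_real, inner_smul_right, norm_smul, mul_pow, Real.norm_eq_abs, sq_abs]
    ring
  have hsq : ∀ s : ℝ, IntervalIntegrable (fun t => ‖g t + s • ψ t‖ ^ 2) volume a b := by
    intro s
    rw [hexp]
    exact (H.sqInt.add (hinner.const_mul _)).add (hψ2.const_mul _)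
  have hJ : ∀ s : ℝ, |s| < ρ → ∫ t in a..b, (‖g t + s • ψ t‖ ^ 2 + F (c t + s • φ t))
      = (∫ t in a..b, ‖g t‖ ^ 2) + 2 * s * A + s ^ 2 * D + W s := by
    intro s hs
    have h1 : ∫ t in a..b, (‖g t + s • ψ t‖ ^ 2 + F (c t + s • φ t))
        = ∫ t in a..b, (‖g t + s • ψ t‖ ^ 2 + V (c t + s • φ t)) := by
      refine intervalIntegral.integral_congr fun t ht => ?_
      rw [uIcc_of_le hab.le] at ht
      simp only [hFV s hs t ht]
    rw [h1, intervalIntegral.integral_add (hsq s) (hVint s), hexp,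
      intervalIntegral.integral_add (H.sqInt.add (hinner.const_mul _)) (hψ2.const_mul _),
      intervalIntegral.integral_add H.sqInt (hinner.const_mul _),
      intervalIntegral.integral_const_mul, intervalIntegral.integral_const_mul]
  have hmin : IsLocalMin (fun s : ℝ => 2 * s * A + s ^ 2 * D + W s) 0 := by
    have h1 : 0 < min ρ (ε / (B + 1)) := lt_min hρ (by positivity)
    filter_upwards [Metric.ball_mem_nhds (0 : ℝ) h1] with s hs
    rw [Metric.mem_ball, dist_zero_right, Real.norm_eq_abs] at hs
    have hs1 := hs.trans_le (min_le_left _ _)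
    have hs2 := hs.trans_le (min_le_right _ _)
    rw [lt_div_iff₀ (by positivity)] at hs2
    have h2 := H.integral_le a b le_rfl hab le_rfl (fun t => c t + s • φ t)
      (fun t => g t + s • ψ t)
      (H.ac.fun_add ((lipschitzWith_smul s).comp_absolutelyContinuousOnInterval hφac))
      (by simp [hφa]) (by simp [hφb])
      (fun t ht => by
        rw [add_sub_cancel_left, norm_smul, Real.norm_eq_abs]
        nlinarith [hB t ht, abs_nonneg s])
      (by
        filter_upwards [H.hasDeriv, hψ] with t h3 h4 ht
        exact (h3 ht).add ((h4 ht).const_smul s))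
      (hsq s)
    have h5 := hJ 0 (by simpa using hρ)
    simp only [zero_smul, add_zero] at h5
    rw [h5, hJ s hs1] at h2
    linarith
  have hder : HasDerivAt (fun s : ℝ => 2 * s * A + s ^ 2 * D + W s)
      (2 * A + ∫ t in a..b, fderiv ℝ V (c t) (φ t)) 0 := by
    have h1 : HasDerivAt (fun s : ℝ => 2 * s * A) (2 * A) 0 := by
      simpa using ((hasDerivAt_id (0 : ℝ)).const_mul 2).mul_const A
    have h2 : HasDerivAt (fun s : ℝ => s ^ 2 * D) 0 0 := by
      simpa using (hasDerivAt_pow 2 (0 : ℝ)).mul_const D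
    have h3 := (h1.fun_add h2).fun_add (hasDerivAt_integral_comp_add_smul hV hc hφ a b).2
    rwa [add_zero] at h3
  exact hmin.hasDerivAt_eq_zero hder

lemma intervalIntegral_mem_submodule (M : Submodule ℝ E) {f : ℝ → E} (hf : Continuous f) {a b : ℝ}
    (hM : ∀ t ∈ uIcc a b, f t ∈ M) : ∫ t in a..b, f t ∈ M := by
  have := FiniteDimensional.complete ℝ E
  have h := M.starProjection.intervalIntegral_comp_comm (hf.intervalIntegrable (μ := volume) a b)
  rw [← Submodule.starProjection_eq_self_iff, ← h]
  exact intervalIntegral.integral_congr fun t ht =>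
    Submodule.starProjection_eq_self_iff.2 (hM t ht)

/-- The integrated Euler–Lagrange equation (du Bois-Reymond): a minimizer that stays in an affine
subspace with direction `M`, near which the potential is a `C¹` function `V` with gradient `2 Q`
along `M`, solves `c'' = Q (c)`. -/
lemma LocMin.exists_sub_eq_integral {F V : E → ℝ} {Q : E → E} {c g : ℝ → E} {a b ε ρ : ℝ}
    (H : LocMin F c g a b ε) (hab : a < b) (hε : 0 < ε) (hρ : 0 < ρ) (hV : ContDiff ℝ 1 V)
    (hQ : Continuous Q) (hc : Continuous c) (M : Submodule ℝ E)
    (hVQ : ∀ x, ∀ v ∈ M, fderiv ℝ V x v = 2 * inner ℝ (Q x) v)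
    (hcM : ∀ t ∈ Icc a b, c t - c a ∈ M) (hQM : ∀ t ∈ Icc a b, Q (c t) ∈ M)
    (hFV : ∀ t ∈ Icc a b, ∀ v ∈ M, ‖v‖ < ρ → F (c t + v) = V (c t + v)) :
    ∃ m, ∀ t ∈ Icc a b, c t - c a = ∫ s in a..t, (m + ∫ r in a..s, Q (c r)) := by
  have := FiniteDimensional.complete ℝ E
  have hQc : Continuous fun t => Q (c t) := hQ.comp hc
  set Φ : ℝ → E := fun t => ∫ r in a..t, Q (c r) with hΦ
  have hΦd : ∀ t, HasDerivAt Φ (Q (c t)) t := fun t =>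
    intervalIntegral.integral_hasDerivAt_right (hQc.intervalIntegrable _ _)
      hQc.stronglyMeasurable.stronglyMeasurableAtFilter hQc.continuousAt
  have hΦc : Continuous Φ := continuous_iff_continuousAt.2 fun t => (hΦd t).continuousAt
  set m : E := (b - a)⁻¹ • (c b - c a - ∫ t in a..b, Φ t) with hm
  refine ⟨m, ?_⟩
  set k : ℝ → E := fun t => m + Φ t with hk
  have hkc : Continuous k := continuous_const.add hΦc
  have hkd : ∀ t, HasDerivAt k (Q (c t)) t := fun t => (hΦd t).const_add m
  set P : ℝ → E := fun t => ∫ s in a..t, k s with hP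
  have hPd : ∀ t, HasDerivAt P (k t) t := fun t =>
    intervalIntegral.integral_hasDerivAt_right (hkc.intervalIntegrable _ _)
      hkc.stronglyMeasurable.stronglyMeasurableAtFilter hkc.continuousAt
  have hPc : Continuous P := continuous_iff_continuousAt.2 fun t => (hPd t).continuousAt
  have hPac : AbsolutelyContinuousOnInterval P a b := by
    have h1 : ContDiff ℝ 1 P := by
      rw [contDiff_one_iff_deriv]
      refine ⟨fun t => (hPd t).differentiableAt, ?_⟩
      rw [show deriv P = k from funext fun t => (hPd t).deriv]
      exact hkc
    obtain ⟨L, hL⟩ := h1.contDiffOn.exists_lipschitzOnWith (s := uIcc a b) one_ne_zero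
      (convex_uIcc a b) isCompact_uIcc
    exact hL.absolutelyContinuousOnInterval
  have hkac : AbsolutelyContinuousOnInterval k a b := by
    have h1 : ContDiff ℝ 1 k := by
      rw [contDiff_one_iff_deriv]
      refine ⟨fun t => (hkd t).differentiableAt, ?_⟩
      rw [show deriv k = fun t => Q (c t) from funext fun t => (hkd t).deriv]
      exact hQc
    obtain ⟨L, hL⟩ := h1.contDiffOn.exists_lipschitzOnWith (s := uIcc a b) one_ne_zero
      (convex_uIcc a b) isCompact_uIcc
    exact hL.absolutelyContinuousOnInterval
  -- The variation is the error in the integrated equation; `m` makes it vanish at `b`.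
  set φ : ℝ → E := fun t => c t - c a - P t with hφ
  set ψ : ℝ → E := fun t => g t - k t with hψ
  have hφc : Continuous φ := (hc.sub continuous_const).sub hPc
  have hφac : AbsolutelyContinuousOnInterval φ a b :=
    (H.ac.fun_sub (absolutelyContinuousOnInterval_const (c a) a b)).fun_sub hPac
  have hφa : φ a = 0 := by simp [hφ, hP]
  have hφb : φ b = 0 := by
    have h1 : P b = c b - c a := by
      simp only [hP, hk]
      rw [intervalIntegral.integral_add intervalIntegrable_const (hΦc.intervalIntegrable _ _),
        intervalIntegral.integral_const, hm, smul_inv_smul₀ (sub_pos.2 hab).ne']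
      abel
    simp only [hφ, h1, sub_self]
  have hφd : ∀ᵐ t, t ∈ Ioo a b → HasDerivAt φ (ψ t) t := by
    filter_upwards [H.hasDeriv] with t ht hmem
    exact ((ht hmem).sub_const (c a)).sub (hPd t)
  have hk2 : IntervalIntegrable (fun t => ‖k t‖ ^ 2) volume a b :=
    (hkc.norm.pow 2).intervalIntegrable _ _
  have hψm : Measurable ψ := H.meas.sub hkc.measurable
  have hψ2 : IntervalIntegrable (fun t => ‖ψ t‖ ^ 2) volume a b :=
    intervalIntegrable_norm_sub_sq H.meas hkc.measurable H.sqInt hk2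
  have hsub : ∀ {t : ℝ}, t ∈ Icc a b → ∀ s ∈ uIcc a t, s ∈ Icc a b := by
    intro t ht s hs
    rw [uIcc_of_le ht.1] at hs
    exact ⟨hs.1, hs.2.trans ht.2⟩
  have hΦM : ∀ t ∈ Icc a b, Φ t ∈ M := fun t ht =>
    intervalIntegral_mem_submodule M hQc fun s hs => hQM s (hsub ht s hs)
  have hmM : m ∈ M := by
    refine M.smul_mem _ (M.sub_mem (hcM b (right_mem_Icc.2 hab.le)) ?_)
    exact intervalIntegral_mem_submodule M hΦc fun s hs =>
      hΦM s (hsub (right_mem_Icc.2 hab.le) s hs)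
  have hφM : ∀ t ∈ Icc a b, φ t ∈ M := fun t ht =>
    M.sub_mem (hcM t ht) (intervalIntegral_mem_submodule M hkc fun s hs =>
      M.add_mem hmM (hΦM s (hsub ht s hs)))
  obtain ⟨B, hB⟩ := (isCompact_Icc (a := a) (b := b)).exists_bound_of_continuousOn hφc.continuousOn
  have hB0 : 0 ≤ B := (norm_nonneg _).trans (hB a (left_mem_Icc.2 hab.le))
  have hfirst := H.firstVariation_eq_zero hab hε (ρ := ρ / (B + 1)) (by positivity) hV hc hφc hφac
    hφa hφb hφd hψm hψ2 fun s hs t ht => hFV t ht _ (M.smul_mem s (hφM t ht)) (by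
      rw [lt_div_iff₀ (by positivity)] at hs
      rw [norm_smul, Real.norm_eq_abs]
      nlinarith [hB t ht, abs_nonneg s])
  have hfd : ∫ t in a..b, fderiv ℝ V (c t) (φ t) = 2 * ∫ t in a..b, inner ℝ (Q (c t)) (φ t) := by
    rw [← intervalIntegral.integral_const_mul]
    refine intervalIntegral.integral_congr fun t ht => ?_
    rw [uIcc_of_le hab.le] at ht
    exact hVQ _ _ (hφM t ht)
  obtain ⟨-, hftc⟩ := (hkac.inner hφac).integral_eq_sub (g := fun t =>
      inner ℝ (k t) (ψ t) + inner ℝ (Q (c t)) (φ t)) hab.le (by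
    filter_upwards [hφd] with t ht hmem
    exact (hkd t).inner ℝ (ht hmem))
  have hint1 := intervalIntegrable_inner_of_norm_sq H.meas hψm H.sqInt hψ2
  have hint2 := intervalIntegrable_inner_of_norm_sq hkc.measurable hψm hk2 hψ2
  have hint3 : IntervalIntegrable (fun t => (inner ℝ (Q (c t)) (φ t) : ℝ)) volume a b :=
    (hQc.inner hφc).intervalIntegrable _ _
  rw [intervalIntegral.integral_add hint2 hint3, hφa, hφb, inner_zero_right, inner_zero_right,
    sub_zero] at hftc
  have hzero : ∫ t in a..b, ‖ψ t‖ ^ 2 = 0 := by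
    have h1 : ∫ t in a..b, ‖ψ t‖ ^ 2
        = (∫ t in a..b, (inner ℝ (g t) (ψ t) : ℝ)) - ∫ t in a..b, (inner ℝ (k t) (ψ t) : ℝ) := by
      rw [← intervalIntegral.integral_sub hint1 hint2]
      refine intervalIntegral.integral_congr fun t _ => ?_
      simp only [← inner_sub_left]
      exact (real_inner_self_eq_norm_sq _).symm
    rw [h1]
    linarith
  have hψ0 : ∀ᵐ t, t ∈ Ioc a b → ψ t = 0 := by
    have h1 := (intervalIntegral.integral_eq_zero_iff_of_le_of_nonneg_ae hab.le
      (Eventually.of_forall fun t => by positivity) hψ2).1 hzero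
    rw [Filter.EventuallyEq, ae_restrict_iff' measurableSet_Ioc] at h1
    filter_upwards [h1] with t ht hmem
    simpa using ht hmem
  intro t ht
  have h1 : ‖φ t - φ a‖ ≤ ∫ s in a..t, ‖ψ s‖ := by
    have hsub' : uIcc a t ⊆ uIcc a b := by
      rw [uIcc_of_le hab.le]
      exact hsub ht
    refine AbsolutelyContinuousOnInterval.norm_sub_le_integral ht.1 (hφac.mono hsub') ?_ ?_
      fun s _ => le_rfl
    · filter_upwards [hφd] with s hs hmem
      exact hs ⟨hmem.1, hmem.2.trans_le ht.2⟩
    · refine (intervalIntegrable_const (c := (0 : ℝ))).congr_ae ?_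
      rw [Filter.EventuallyEq, ae_restrict_iff' measurableSet_uIoc, uIoc_of_le ht.1]
      filter_upwards [hψ0] with s hs hmem
      rw [hs ⟨hmem.1, hmem.2.trans ht.2⟩, norm_zero]
  have h2 : ∫ s in a..t, ‖ψ s‖ = 0 := by
    refine intervalIntegral.integral_zero_ae ?_
    filter_upwards [hψ0] with s hs hmem
    rw [uIoc_of_le ht.1] at hmem
    rw [hs ⟨hmem.1, hmem.2.trans ht.2⟩, norm_zero]
  rw [h2, hφa, sub_zero] at h1
  exact sub_eq_zero.1 (norm_le_zero_iff.1 h1)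

/-- A curve that solves the integrated second-order equation `c'' = Q (c)` on the compact
subintervals of `(a, b)` is smooth up to the endpoints of `[a, b]`. -/
lemma contDiffOn_Icc_of_integral_eq {Q : E → E} (hQ : ContDiff ℝ ∞ Q) {c : ℝ → E}
    (hc : Continuous c) {a b : ℝ} (hab : a < b)
    (hloc : ∀ a' b', a < a' → a' < b' → b' < b → ∃ m, ∀ t ∈ Icc a' b',
      c t - c a' = ∫ s in a'..t, (m + ∫ r in a'..s, Q (c r))) :
    ContDiffOn ℝ ∞ c (Icc a b) ∧ ∀ t ∈ Ioo a b, HasDerivAt (deriv c) (Q (c t)) t := by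
  have := FiniteDimensional.complete ℝ E
  have hQc : Continuous fun t => Q (c t) := hQ.continuous.comp hc
  have hprim : ∀ {f : ℝ → E}, Continuous f → ∀ s t, HasDerivAt (fun t => ∫ r in s..t, f r) (f t) t :=
    fun hf s t => intervalIntegral.integral_hasDerivAt_right (hf.intervalIntegrable _ _)
      hf.stronglyMeasurable.stronglyMeasurableAtFilter hf.continuousAt
  have hinner : ∀ t ∈ Ioo a b, DifferentiableAt ℝ c t ∧ HasDerivAt (deriv c) (Q (c t)) t := by
    intro t ht
    obtain ⟨a', ha, hat⟩ := exists_between ht.1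
    obtain ⟨b', htb, hb⟩ := exists_between ht.2
    obtain ⟨m, hm⟩ := hloc a' b' ha (hat.trans htb) hb
    set k : ℝ → E := fun s => m + ∫ r in a'..s, Q (c r) with hk
    have hkd : ∀ s, HasDerivAt k (Q (c s)) s := fun s => (hprim hQc a' s).const_add m
    have hkc : Continuous k := continuous_iff_continuousAt.2 fun s => (hkd s).continuousAt
    have hcd : ∀ s ∈ Ioo a' b', HasDerivAt c (k s) s := by
      intro s hs
      refine ((hprim hkc a' s).const_add (c a')).congr_of_eventuallyEq ?_
      filter_upwards [Icc_mem_nhds hs.1 hs.2] with u hu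
      rw [← hm u hu, add_sub_cancel]
    refine ⟨(hcd t ⟨hat, htb⟩).differentiableAt, (hkd t).congr_of_eventuallyEq ?_⟩
    filter_upwards [Ioo_mem_nhds hat htb] with s hs
    exact (hcd s hs).deriv
  refine ⟨?_, fun t ht => (hinner t ht).2⟩
  obtain ⟨t₁, ht₁⟩ := exists_between hab
  -- The velocity `k` extends continuously to the closed interval.
  set k : ℝ → E := fun t => deriv c t₁ + ∫ r in t₁..t, Q (c r) with hk
  have hkd : ∀ t, HasDerivAt k (Q (c t)) t := fun t => (hprim hQc t₁ t).const_add _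
  have hkc : Continuous k := continuous_iff_continuousAt.2 fun s => (hkd s).continuousAt
  have hconst : ∀ {f : ℝ → E}, (∀ t ∈ Ioo a b, HasDerivAt f 0 t) →
      ∀ t ∈ Ioo a b, f t = f t₁ := fun hf t ht =>
    isOpen_Ioo.is_const_of_deriv_eq_zero isPreconnected_Ioo
      (fun s hs => (hf s hs).differentiableAt.differentiableWithinAt)
      (fun s hs => (hf s hs).deriv) ht ht₁
  have hck : ∀ t ∈ Ioo a b, deriv c t = k t := by
    intro t ht
    have h1 := hconst (f := fun t => deriv c t - k t) (fun s hs => by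
      simpa using (hinner s hs).2.fun_sub (hkd s)) t ht
    simp only [hk, intervalIntegral.integral_same, add_zero, sub_self] at h1
    exact sub_eq_zero.1 h1
  have hcP : EqOn c (fun t => c t₁ + ∫ s in t₁..t, k s) (Icc a b) := by
    rw [← closure_Ioo hab.ne]
    refine EqOn.closure (fun t ht => ?_) hc (continuous_const.add
      (continuous_iff_continuousAt.2 fun s => (hprim hkc t₁ s).continuousAt))
    have h1 := hconst (f := fun t => c t - ∫ s in t₁..t, k s) (fun s hs => by
      have h2 := (hinner s hs).1.hasDerivAt
      rw [hck s hs] at h2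
      simpa using h2.fun_sub (hprim hkc t₁ s)) t ht
    simp only [intervalIntegral.integral_same, sub_zero] at h1
    exact sub_eq_iff_eq_add.1 h1
  have hpair : ContDiffOn ℝ ((⊤ : ℕ∞) : WithTop ℕ∞) (fun t => (c t, k t)) (Icc a b) := by
    refine ODE.contDiffOn_enat_Icc_of_hasDerivWithinAt (f := fun _ (z : E × E) => (z.2, Q z.1))
      (u := univ) ?_ (fun t ht => ?_) (mapsTo_univ _ _)
    · refine ContDiff.contDiffOn ?_
      exact (contDiff_snd.comp contDiff_snd).prodMk (hQ.comp (contDiff_fst.comp contDiff_snd))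
    · refine HasDerivWithinAt.prodMk ?_ (hkd t).hasDerivWithinAt
      exact ((hprim hkc t₁ t).const_add (c t₁)).hasDerivWithinAt.congr hcP (hcP ht)
  exact contDiff_fst.comp_contDiffOn hpair

/-- Where the optimality class of a minimizer is constant, the minimizer is smooth up to the
endpoints and solves the Euler–Lagrange equation. -/
lemma LocMin.contDiffOn_and_hasDerivAt_deriv {K : Set E} (hK : K.Finite) (hne : K.Nonempty)
    {h : ℝ → ℝ} (hs : ContDiffOn ℝ ∞ h (Ici 0)) {c g : ℝ → E} {a b ε : ℝ}
    (Hm : LocMin (potential K h) c g a b ε) (hab : a < b) (hε : 0 < ε) (hc : Continuous c)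
    {H : Set E} {η p : E} (hH : ∀ t ∈ Ioo a b, optClass K (c t) = H)
    (hη : etaMap K '' voronoiCell K H = {η})
    (hp : (affineSpan ℝ H : Set E) ∩ equidistantSpace H = {p}) :
    ContDiffOn ℝ ∞ c (Icc a b) ∧ ∀ t ∈ Ioo a b,
      HasDerivAt (deriv c) (derivWithin h (Ici 0) (‖c t - η‖ ^ 2) • (c t - p)) t := by
  have hcell : ∀ {x}, optClass K x = H → etaMap K x = η := fun {x} hx => by
    have h1 : etaMap K x ∈ etaMap K '' voronoiCell K H := mem_image_of_mem _ hx
    rwa [hη] at h1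
  have hpm : p ∈ (affineSpan ℝ H : Set E) ∩ equidistantSpace H := by rw [hp]; rfl
  obtain ⟨t₁, ht₁⟩ := exists_between hab
  have hηp : η - p ∈ vectorSpan ℝ H := by
    rw [← direction_affineSpan]
    refine AffineSubspace.vsub_mem_direction ?_ hpm.1
    rw [← hcell (hH t₁ ht₁), ← hH t₁ ht₁]
    exact etaMap_mem_affineSpan hK hne _
  have hsqs : ContDiff ℝ ∞ fun x : E => ‖x - η‖ ^ 2 := (contDiff_id.sub contDiff_const).norm_sq ℝ
  have hpos : ∀ x : E, ‖x - η‖ ^ 2 ∈ Ici (0 : ℝ) := fun x => mem_Ici.2 (sq_nonneg _)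
  have hs' := ((contDiffOn_infty_iff_derivWithin (uniqueDiffOn_Ici (0 : ℝ))).1 hs).2
  have hQ : ContDiff ℝ ∞ fun x : E => derivWithin h (Ici 0) (‖x - η‖ ^ 2) • (x - p) :=
    (hs'.comp_contDiff hsqs hpos).smul (contDiff_id.sub contDiff_const)
  have hV : ContDiff ℝ ∞ fun x : E => h (‖x - η‖ ^ 2) := hs.comp_contDiff hsqs hpos
  have hVd : ∀ x v : E, fderiv ℝ (fun x : E => h (‖x - η‖ ^ 2)) x v
      = derivWithin h (Ici 0) (‖x - η‖ ^ 2) * (2 * inner ℝ (x - η) v) := by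
    intro x v
    have h1 : HasDerivWithinAt h (derivWithin h (Ici 0) (‖x - η‖ ^ 2)) (Ici 0) (‖x - η‖ ^ 2) :=
      (hs.differentiableOn (by simp) _ (hpos x)).hasDerivWithinAt
    have h2 : HasFDerivAt (fun x : E => ‖x - η‖ ^ 2) (2 • (innerSL ℝ (x - η))) x := by
      simpa using ((hasFDerivAt_id x).sub_const η).norm_sq
    have h3 := (h1.comp_hasFDerivWithinAt x h2.hasFDerivWithinAt (s := univ)
      (fun y _ => hpos y)).hasFDerivAt univ_mem
    have h4 : fderiv ℝ (fun x : E => h (‖x - η‖ ^ 2)) x = _ := h3.fderiv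
    rw [h4]
    simp [two_mul, inner_sub_left]
  refine contDiffOn_Icc_of_integral_eq hQ hc hab fun a' b' ha' hab' hb' => ?_
  have hsub : ∀ t ∈ Icc a' b', t ∈ Ioo a b := fun t ht =>
    ⟨ha'.trans_le ht.1, ht.2.trans_lt hb'⟩
  have heq : ∀ t ∈ Icc a' b', c t ∈ equidistantSpace H := fun t ht => by
    rw [← hH t (hsub t ht)]
    exact mem_equidistantSpace_optClass K _
  obtain ⟨ρ, hρ, hnear⟩ := exists_optClass_add_eq hK hne (H := H)
    ((isCompact_Icc (a := a') (b := b')).image hc) (by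
      rintro _ ⟨t, ht, rfl⟩
      exact hH t (hsub t ht))
  refine (Hm.mono ha'.le hab'.le hb'.le).exists_sub_eq_integral hab' hε hρ
    (hV.of_le (by simp)) hQ.continuous hc (equidistantDirection H) (fun x v hv => ?_)
    (fun t ht => sub_mem_equidistantDirection (heq a' (left_mem_Icc.2 hab'.le)) (heq t ht))
    (fun t ht => Submodule.smul_mem _ _ (sub_mem_equidistantDirection hpm.2 (heq t ht)))
    fun t ht v hv hvρ => potential_eq_of_etaMap hK hne h
      (hcell (hnear (c t) (mem_image_of_mem c ht) v hv hvρ))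
  -- Along the cell, `x - η` and `x - p` have the same tangential component.
  have h1 : inner ℝ (x - p) v = (inner ℝ (x - η) v : ℝ) := by
    rw [← sub_eq_zero, ← inner_sub_left, sub_sub_sub_cancel_left, real_inner_comm]
    exact inner_eq_zero_of_mem_vectorSpan hv hηp
  rw [hVd, real_inner_smul_left, h1]
  ring

end

theorem mainTheorem2 (d : ℕ) (K : Set (EuclideanSpace ℝ (Fin d))) (hKfin : K.Finite)
    (hKne : K.Nonempty) (hKbal : IsBalanced K)
    (h : ℝ → ℝ) (h_nonneg : ∀ u ∈ Ici (0 : ℝ), 0 ≤ h u)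
    (h_smooth : ContDiffOn ℝ ∞ h (Ici 0)) (h_mono : StrictMonoOn h (Ici 0))
    (δ : ℝ) (hδ : 0 < δ) (x₀ x₁ : EuclideanSpace ℝ (Fin d))
    (γ : C(Icc (0 : ℝ) δ, EuclideanSpace ℝ (Fin d)))
    (hγ : IsLocalMinimizer K h hδ x₀ x₁ γ) :
    (shockTimes K γ).Finite ∧
    (∀ s ∈ (shockTimes K γ)ᶜ, ∀ r ∈ connectedComponentIn (shockTimes K γ)ᶜ s,
      optClass K (γ r) = optClass K (γ s)) ∧
    ∃ (ℓ : ℕ) (t : Fin (ℓ + 2) → Icc (0 : ℝ) δ),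
      (t 0 : ℝ) = 0 ∧ (t (Fin.last (ℓ + 1)) : ℝ) = δ ∧
      StrictMono (fun i : Fin ℓ => t i.succ.castSucc) ∧
      range (fun i : Fin ℓ => t i.succ.castSucc) = shockTimes K γ ∧
      ∀ i : Fin (ℓ + 1),
        ContDiffOn ℝ ∞ (IccExtend hδ.le γ) (Icc (t i.castSucc : ℝ) (t i.succ)) ∧
        (t i.castSucc < t i.succ →
          ∃ (H : Set (EuclideanSpace ℝ (Fin d))) (ηH pH : EuclideanSpace ℝ (Fin d)),
            (∀ s : Icc (0 : ℝ) δ, s ∈ Ioo (t i.castSucc) (t i.succ) → optClass K (γ s) = H) ∧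
            etaMap K '' voronoiCell K H = {ηH} ∧
            (affineSpan ℝ H : Set (EuclideanSpace ℝ (Fin d))) ∩ equidistantSpace H = {pH} ∧
            ∀ s : Icc (0 : ℝ) δ, s ∈ Ioo (t i.castSucc) (t i.succ) →
              HasDerivAt (deriv (IccExtend hδ.le γ))
                (derivWithin h (Ici 0) (‖γ s - ηH‖ ^ 2) • (γ s - pH)) (s : ℝ)) := by
  set c := IccExtend hδ.le γ with hcdef
  have hc : Continuous c := γ.continuous.Icc_extend'
  have hcγ : ∀ s : Icc (0 : ℝ) δ, c s = γ s := fun s => IccExtend_val hδ.le γ s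
  obtain ⟨ε, hε, Hm⟩ := hγ.exists_locMin hKfin hKne
    (isPotential_potential hKfin hKne h_nonneg h_smooth h_mono) hδ
  -- Shock times are isolated in the compact interval, hence finite in number.
  have hfin : (shockTimes K γ).Finite := by
    refine finite_of_locally_subsingleton fun s₀ => ?_
    have h1 := (continuous_subtype_val.tendsto s₀).eventually
      (Hm.eventually_ne_imp hKfin hKne hKbal h_nonneg h_smooth h_mono hε s₀.2)
    filter_upwards [h1] with s hs hne
    refine notMem_shockTimes_iff.2 ?_
    filter_upwards [(continuous_subtype_val.tendsto s).eventually
      (hs s.2 fun h2 => hne (Subtype.ext h2))] with r hr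
    rwa [← hcdef, hcγ, hcγ] at hr
  have hconst : ∀ A : Set (Icc (0 : ℝ) δ), IsPreconnected A → A ⊆ (shockTimes K γ)ᶜ →
      ∀ s ∈ A, ∀ r ∈ A, optClass K (γ r) = optClass K (γ s) := fun A hA hsub s hs r hr =>
    IsPreconnected.eq_of_eventually_eq (f := fun s => optClass K (γ s)) hA
      (fun x hx => notMem_shockTimes_iff.1 (hsub hx)) hr hs
  refine ⟨hfin, fun s hs r hr => hconst _ isPreconnected_connectedComponentIn
    (connectedComponentIn_subset _ _) s (mem_connectedComponentIn hs) r hr, ?_⟩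
  obtain ⟨ℓ, hℓ⟩ : ∃ ℓ, hfin.toFinset.card = ℓ := ⟨_, rfl⟩
  set e := hfin.toFinset.orderEmbOfFin hℓ with he
  -- The subdivision: `0`, then the increasing enumeration of the shock times, then `δ`.
  set t : Fin (ℓ + 2) → Icc (0 : ℝ) δ :=
    Fin.cons ⟨0, left_mem_Icc.2 hδ.le⟩ (Fin.snoc (α := fun _ => Icc (0 : ℝ) δ) e
      ⟨δ, right_mem_Icc.2 hδ.le⟩) with ht
  have ht0 : t 0 = ⟨0, left_mem_Icc.2 hδ.le⟩ := rfl
  have htl : t (Fin.last (ℓ + 1)) = ⟨δ, right_mem_Icc.2 hδ.le⟩ := by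
    rw [← Fin.succ_last, ht, Fin.cons_succ, Fin.snoc_last]
  have htm : ∀ i : Fin ℓ, t i.succ.castSucc = e i := fun i => by
    rw [← Fin.succ_castSucc, ht, Fin.cons_succ, Fin.snoc_castSucc]
  have hte : (fun i : Fin ℓ => t i.succ.castSucc) = e := funext htm
  have hmono : Monotone t := by
    refine Fin.monotone_iff_le_succ.2 fun i => ?_
    induction i using Fin.cases with
    | zero => exact (t (Fin.succ 0)).2.1
    | succ i =>
      rcases Fin.eq_castSucc_or_eq_last i.succ with ⟨j, hj⟩ | hj
      · have h1 : i.succ.succ = j.succ.castSucc := by rw [hj, Fin.succ_castSucc]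
        rw [h1, htm, htm]
        refine e.monotone ?_
        have h2 := congrArg Fin.val hj
        simp only [Fin.val_succ, Fin.val_castSucc] at h2
        exact Fin.le_def.2 (by omega)
      · rw [hj, Fin.succ_last, htl]
        exact (t (Fin.last ℓ).castSucc).2.2
  have hrange : range e = shockTimes K γ := by
    rw [he, Finset.range_orderEmbOfFin, Finite.coe_toFinset]
  refine ⟨ℓ, t, by rw [ht0], by rw [htl], ?_, by rw [hte, hrange], fun i => ?_⟩
  · rw [hte]
    exact e.strictMono
  rcases (hmono (Fin.castSucc_lt_succ (i := i)).le).eq_or_lt with heq | hlt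
  · refine ⟨?_, fun hlt => absurd heq hlt.ne⟩
    rw [heq, Icc_self]
    rintro x rfl
    exact contDiffWithinAt_singleton
  have hsub : Ioo (t i.castSucc) (t i.succ) ⊆ (shockTimes K γ)ᶜ := by
    intro s hs hsS
    rw [← hrange] at hsS
    obtain ⟨j, rfl⟩ := hsS
    rw [← htm j] at hs
    have h1 := hmono.reflect_lt hs.1
    have h2 := hmono.reflect_lt hs.2
    simp only [Fin.lt_def, Fin.val_succ, Fin.val_castSucc] at h1 h2
    omega
  have hltR : (t i.castSucc : ℝ) < t i.succ := hlt
  have hlow := (t i.castSucc).2.1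
  have hupp := (t i.succ).2.2
  obtain ⟨r₀, hr₀⟩ := exists_between hltR
  set s₀ : Icc (0 : ℝ) δ := ⟨r₀, hlow.trans hr₀.1.le, hr₀.2.le.trans hupp⟩ with hs₀
  have hs₀m : s₀ ∈ Ioo (t i.castSucc) (t i.succ) := ⟨hr₀.1, hr₀.2⟩
  have hpre : IsPreconnected (Ioo (t i.castSucc) (t i.succ)) := by
    refine (Topology.IsInducing.subtypeVal.isPreconnected_image).1 ?_
    have h1 : Subtype.val '' Ioo (t i.castSucc) (t i.succ)
        = Ioo (t i.castSucc : ℝ) (t i.succ : ℝ) := by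
      ext r
      constructor
      · rintro ⟨s, hs, rfl⟩
        exact ⟨hs.1, hs.2⟩
      · exact fun hr => ⟨⟨r, hlow.trans hr.1.le, hr.2.le.trans hupp⟩, ⟨hr.1, hr.2⟩, rfl⟩
    rw [h1]
    exact isPreconnected_Ioo
  have hH := hconst _ hpre hsub s₀ hs₀m
  have hη : etaMap K '' voronoiCell K (optClass K (γ s₀)) = {etaMap K (γ s₀)} := by
    refine eq_singleton_iff_unique_mem.2 ⟨⟨γ s₀, rfl, rfl⟩, ?_⟩
    rintro _ ⟨x, hx, rfl⟩
    exact hKbal.etaMap_eq hx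
  obtain ⟨p, hp⟩ := exists_affineSpan_inter_equidistantSpace (optClass_nonempty hKfin hKne (γ s₀))
    (mem_equidistantSpace_optClass K (γ s₀))
  obtain ⟨hsm, hode⟩ := (Hm.mono hlow hltR.le hupp).contDiffOn_and_hasDerivAt_deriv hKfin hKne
    h_smooth hltR hε hc (H := optClass K (γ s₀)) (fun r hr => by
      have h1 := hH ⟨r, hlow.trans hr.1.le, hr.2.le.trans hupp⟩ ⟨hr.1, hr.2⟩
      rwa [← hcγ] at h1) hη hp
  refine ⟨hsm, fun _ => ⟨_, _, p, hH, hη, hp, fun s hs => ?_⟩⟩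
  rw [← hcγ s]
  exact hode s ⟨hs.1, hs.2⟩
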